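/- **Setting.** Let $d\ge 1$, let $\mathcal K\subset\mathbb R^d$ be convex and compact with $\mathbb B_r^d\subset\mathcal K\subset\mathbb B_R^d$, $r>0$ (closed Euclidean balls centred at $0$), and let $f:\mathcal K\to[0,1]$ be convex, satisfy $|f(x)-f(y)|\le G\|x-y\|_2$ on $\mathcal K$, and have a minimizer $x_\star\in\mathcal K$. For $\beta>0$, $\ell\ge1$, $f$ is *$(\beta,\ell)$-convex* on $\mathcal K$ if $f(x)-\beta\|x-x_\star\|_2^{\ell}$ is convex on $\mathcal K$. Let $\pi(x)=\inf\{t>0:x\in t\mathcal K\}$, $\pi^+=\max(1,\pi)$, and let $e(x)=\pi^+(x)f\big(\tfrac{x}{\pi^+(x)}\big)+GR(\pi^+(x)-1)$. Write $\|x\|_A^2=x^\top Ax$, and $A\preceq B$ if $B-A$ is positive semidefinite. **Algorithm (RONM)** with parameters $\eta,\sigma,\gamma>0$, $\lambda\in(0,1)$ and horizon $n$. Put $\mu_1=0$, $\Sigma_1=\sigma^2\mathbf I_d$, $Y_0=0$. For $t=1,\dots,n$ (as long as the matrices $\Sigma_t$ are positive definite): given the past $\mathscr F_{t-1}=\sigma(X_1,Y_1,\dots,X_{t-1},Y_{t-1})$,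 sample $X_t\sim\mathcal N(\mu_t,\Sigma_t)$, with density $p_t$; observe $$Y_t=\pi^+(X_t)\Big[f\Big(\tfrac{X_t}{\pi^+(X_t)}\Big)+\varepsilon_t\Big]+GR(\pi^+(X_t)-1),$$ where, conditionally on $\mathscr F_{t-1}$ and $X_t$, the noise $\varepsilon_t$ has mean zero and is $\sigma_t$-subgaussian with $\sigma_t\le\big\|\tfrac{X_t}{\pi^+(X_t)}-x_\star\big\|_2$ (linear vanishing noise); put $Z_t=Y_t-Y_{t-1}$, $R_t=\dfrac{p_t\big((X_t-\lambda\mu_t)/(1-\lambda)\big)}{(1-\lambda)^dp_t(X_t)}$ and $$g_t=\frac{R_tZ_t\Sigma_t^{-1}(X_t-\mu_t)}{(1-\lambda)^2},\qquad H_t=\frac{\lambda R_tZ_t}{(1-\lambda)^2}\Big[\frac{\Sigma_t^{-1}(X_t-\mu_t)(X_t-\mu_t)^\top\Sigma_t^{-1}}{(1-\lambda)^2}-\Sigma_t^{-1}\Big],$$ $$\Sigma_{t+1}^{-1}=\Sigma_t^{-1}+\eta\big(\tfrac12H_t+\gamma\mathbf I_d\big),\qquad \mu_{t+1}=\arg\min_{\mu\in\mathcal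 K}\big\|\mu-[\mu_t-\eta\Sigma_{t+1}g_t]\big\|_{\Sigma_{t+1}^{-1}}.$$ **Stopping time.** Let $s_t(x)=\mathbb E_{X\sim\mathcal N(\mu_t,\Sigma_t)}\big[(1-\tfrac1\lambda)e(X)+\tfrac1\lambda e((1-\lambda)X+\lambda x)\big]$ and $\bar\Sigma_t^{-1}=\Sigma_1^{-1}+\frac\eta2\sum_{u=1}^{t-1}\nabla^2s_u(\mu_u)+(t-1)\eta\gamma\mathbf I_d$. For $L>0$ let $\tau$ be the first round $t\in\{1,\dots,n\}$ at which one of the following fails, and $\tau=n$ if there is none: (a) $\tfrac12\|\mu_{t+1}-x_\star\|^2_{\Sigma_{t+1}^{-1}}\le\frac1{2\lambda^2L^2}$; (b) $\Sigma_{t+1}$ is positive definite; (c) $\tfrac12\bar\Sigma_{t+1}^{-1}\preceq\Sigma_{t+1}^{-1}\preceq\tfrac32\bar\Sigma_{t+1}^{-1}$. **Lemma.** Suppose that $f$ is $(\beta,\ell)$-convex on $\mathcal K$ with $1<\ell\le2$, that $\frac r{\sqrt2\,\sigma}\ge5d$, $\lambda\le\frac1{10dL}$ and $\sigma^{-2}\ge\Theta$,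 where $$\Theta=\Big(\frac{\ell-1}{30}\Big)^{2/\ell}\beta^{2/\ell}d^{-1/\ell}\Big(\frac r{\sqrt2R}\Big)^{2(d-1)/\ell}\eta^{2/\ell}\lambda^{6/\ell-2}L^{4/\ell-2},$$ and that the inequality in (a) also holds for the initial iterate, i.e. $\frac{\|x_\star\|_2^2}{2\sigma^2}\le\frac1{2\lambda^2L^2}$. Then, almost surely, $$\Sigma_t^{-1}\succeq\frac{\Theta}{16}\,t^{2/\ell}\,\mathbf I_d\qquad\text{for all }1\le t\le\tau .$$ -/

import Mathlib

open MeasureTheory ProbabilityTheory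
open scoped Matrix

noncomputable section

namespace RONM

/-- `ℝ^d` with its Euclidean norm. -/
abbrev Vec (d : ℕ) : Type := EuclideanSpace ℝ (Fin d)

/-- Real `d × d` matrices. -/
abbrev Mat (d : ℕ) : Type := Matrix (Fin d) (Fin d) ℝ

/-- The matrix-vector product `A x`, as a vector of `ℝ^d`. -/
def mulV {d : ℕ} (A : Mat d) (x : Vec d) : Vec d := WithLp.toLp 2 (A *ᵥ x.ofLp)

/-- `‖x‖_A ^ 2 = xᵀ A x`. -/
def sqNorm {d : ℕ} (A : Mat d) (x : Vec d) : ℝ := x.ofLp ⬝ᵥ (A *ᵥ x.ofLp)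

/-- The Loewner order: `A ⪯ B` if `B - A` is positive semidefinite. -/
def Loewner {d : ℕ} (A B : Mat d) : Prop := (B - A).PosSemidef

/-- `f` is `(β, ℓ)`-convex on `K` (with respect to the minimizer `xs` of `f` on `K`). -/
def IsBetaEllConvex {d : ℕ} (K : Set (Vec d)) (f : Vec d → ℝ) (xs : Vec d) (β ℓ : ℝ) : Prop :=
  0 < β ∧ 1 ≤ ℓ ∧ ConvexOn ℝ K (fun x => f x - β * ‖x - xs‖ ^ ℓ)

/-- `π⁺(x) = max (1, π(x))`, where `π` is the Minkowski functional of `K`. -/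
def piPlus {d : ℕ} (K : Set (Vec d)) (x : Vec d) : ℝ := max 1 (gauge K x)

/-- The action `x / π⁺(x)` that is really played when the learner chooses `x`. -/
def action {d : ℕ} (K : Set (Vec d)) (x : Vec d) : Vec d := (piPlus K x)⁻¹ • x

/-- The convex extension `e(x) = π⁺(x) f(x / π⁺(x)) + G R (π⁺(x) - 1)`. -/
def extension {d : ℕ} (K : Set (Vec d)) (f : Vec d → ℝ) (G R : ℝ) (x : Vec d) : ℝ :=
  piPlus K x * f (action K x) + G * R * (piPlus K x - 1)

/-- The surrogate
`s(x) = E [(1 - 1/lam) e(X) + (1/lam) e((1 - lam) X + lam x)]`, `X ∼ N(m, S)`. -/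
def surrogate {d : ℕ} (e : Vec d → ℝ) (lam : ℝ) (m : Vec d) (S : Mat d) (x : Vec d) : ℝ :=
  ∫ X, ((1 - 1 / lam) * e X + (1 / lam) * e ((1 - lam) • X + lam • x))
    ∂(multivariateGaussian m S)

/-- The Hessian matrix of `s` at `x`. -/
def hessian {d : ℕ} (s : Vec d → ℝ) (x : Vec d) : Mat d :=
  Matrix.of fun i j =>
    iteratedFDeriv ℝ 2 s x ![EuclideanSpace.single i (1 : ℝ), EuclideanSpace.single j (1 : ℝ)]

/-- The density at `x` of the Gaussian with mean `m` and precision matrix (inverse covariance)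
`P`. -/
def gaussianDensity {d : ℕ} (m : Vec d) (P : Mat d) (x : Vec d) : ℝ :=
  (Real.sqrt ((2 * Real.pi) ^ d))⁻¹ * Real.sqrt P.det * Real.exp (-(1 / 2) * sqNorm P (x - m))

/-- The parameters that the algorithm requires. -/
structure Params where
  /-- learning rate -/
  eta : ℝ
  /-- smoothing parameter -/
  lam : ℝ
  /-- initial standard deviation -/
  sig : ℝ
  /-- regularization -/
  gam : ℝ

/-- The random quantities of a run. `prec t` is the precision matrix `Σ_t⁻¹`; rounds are numbered
from `1`. -/
structure Run (Ω : Type*) (d : ℕ) where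
  /-- the sampled point `X_t` -/
  X : ℕ → Ω → Vec d
  /-- the noise `ε_t` -/
  noise : ℕ → Ω → ℝ
  /-- the fed-back loss `Y_t` -/
  Y : ℕ → Ω → ℝ
  /-- the iterate `μ_t` -/
  mean : ℕ → Ω → Vec d
  /-- the precision matrix `Σ_t⁻¹` -/
  prec : ℕ → Ω → Mat d

namespace Run

variable {Ω : Type*} {d : ℕ}

/-- The covariance matrix `Σ_t`. -/
def cov (A : Run Ω d) (t : ℕ) (ω : Ω) : Mat d := (A.prec t ω)⁻¹

/-- `R_t = p_t((X_t - lam μ_t) / (1 - lam)) / ((1 - lam)^d p_t(X_t))`. -/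
def ratio (A : Run Ω d) (p : Params) (t : ℕ) (ω : Ω) : ℝ :=
  gaussianDensity (A.mean t ω) (A.prec t ω)
      ((1 - p.lam)⁻¹ • (A.X t ω - p.lam • A.mean t ω)) /
    ((1 - p.lam) ^ d * gaussianDensity (A.mean t ω) (A.prec t ω) (A.X t ω))

/-- `Z_t = Y_t - Y_{t-1}`, used for `t ≥ 1`. -/
def Z (A : Run Ω d) (t : ℕ) (ω : Ω) : ℝ := A.Y t ω - A.Y (t - 1) ω

/-- `Σ_t⁻¹ (X_t - μ_t)`. -/
def score (A : Run Ω d) (t : ℕ) (ω : Ω) : Vec d :=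
  mulV (A.prec t ω) (A.X t ω - A.mean t ω)

/-- The gradient estimator `g_t`. -/
def grad (A : Run Ω d) (p : Params) (t : ℕ) (ω : Ω) : Vec d :=
  (A.ratio p t ω * A.Z t ω / (1 - p.lam) ^ 2) • A.score t ω

/-- The Hessian estimator `H_t`. -/
def hess (A : Run Ω d) (p : Params) (t : ℕ) (ω : Ω) : Mat d :=
  (p.lam * A.ratio p t ω * A.Z t ω / (1 - p.lam) ^ 2) •
    ((1 / (1 - p.lam) ^ 2) • Matrix.vecMulVec (A.score t ω).ofLp (A.score t ω).ofLp -
      A.prec t ω)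

/-- The σ-algebra generated by `X_1, Y_1, …, X_t, Y_t`. -/
@[reducible]
def history (A : Run Ω d) (t : ℕ) : MeasurableSpace Ω :=
  ⨆ s ∈ Set.Icc 1 t,
    (MeasurableSpace.comap (A.X s) inferInstance ⊔ MeasurableSpace.comap (A.Y s) inferInstance)

/-- The algorithm can execute round `t`: the covariance matrices `Σ_1, …, Σ_t` are positive
definite. -/
def Alive (A : Run Ω d) (t : ℕ) (ω : Ω) : Prop := ∀ s ∈ Set.Icc 1 t, (A.cov s ω).PosDef

/-- `A` is a run of `n` rounds of the regularized online Newton method, in the stochastic convex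
bandit with loss `f` on `K` and linear vanishing noise. The algorithm samples from `N(μ_t, Σ_t)`
and projects in the norm given by `Σ_{t+1}⁻¹`, so what it does is prescribed as long as these
matrices are positive definite. -/
structure IsRONM [MeasurableSpace Ω] (A : Run Ω d) (Pr : Measure Ω) (n : ℕ)
    (K : Set (Vec d)) (f : Vec d → ℝ) (G R : ℝ) (xs : Vec d) (p : Params) : Prop where
  measurable_X : ∀ t, Measurable (A.X t)
  measurable_noise : ∀ t, Measurable (A.noise t)
  measurable_Y : ∀ t, Measurable (A.Y t)
  mean_one : ∀ ω, A.mean 1 ω = 0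
  prec_one : ∀ ω, A.prec 1 ω = (p.sig ^ 2)⁻¹ • (1 : Mat d)
  Y_zero : ∀ ω, A.Y 0 ω = 0
  /-- given the past, `X_t` is drawn from `N(μ_t, Σ_t)` -/
  sample : ∀ t ∈ Set.Icc 1 n, ∀ B : Set (Vec d), MeasurableSet B →
    ∀ᵐ ω ∂Pr, A.Alive t ω →
      (Pr[(A.X t ⁻¹' B).indicator (fun _ => (1 : ℝ)) | A.history (t - 1)]) ω =
        (multivariateGaussian (A.mean t ω) (A.cov t ω)).real B
  /-- given the past and `X_t`, the noise is centred … -/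
  noise_integrable : ∀ t ∈ Set.Icc 1 n, Integrable (A.noise t) Pr
  noise_centred : ∀ t ∈ Set.Icc 1 n,
    Pr[A.noise t | A.history (t - 1) ⊔ MeasurableSpace.comap (A.X t) inferInstance] =ᵐ[Pr] 0
  /-- … and subgaussian, with parameter at most the distance of the action from `xs` -/
  noise_exp_integrable : ∀ t ∈ Set.Icc 1 n, ∀ u : ℝ,
    Integrable (fun ω => Real.exp (u * A.noise t ω)) Pr
  noise_subgaussian : ∀ t ∈ Set.Icc 1 n, ∀ u : ℝ,
    Pr[fun ω => Real.exp (u * A.noise t ω) |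
        A.history (t - 1) ⊔ MeasurableSpace.comap (A.X t) inferInstance]
      ≤ᵐ[Pr] fun ω => Real.exp (u ^ 2 * ‖action K (A.X t ω) - xs‖ ^ 2 / 2)
  observe : ∀ t ∈ Set.Icc 1 n, ∀ ω,
    A.Y t ω = piPlus K (A.X t ω) * (f (action K (A.X t ω)) + A.noise t ω) +
      G * R * (piPlus K (A.X t ω) - 1)
  prec_succ : ∀ t ∈ Set.Icc 1 n, ∀ ω, A.Alive t ω →
    A.prec (t + 1) ω =
      A.prec t ω + p.eta • ((1 / 2 : ℝ) • A.hess p t ω + p.gam • (1 : Mat d))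
  mean_succ : ∀ t ∈ Set.Icc 1 n, ∀ ω, A.Alive (t + 1) ω →
    A.mean (t + 1) ω ∈ K ∧
      IsMinOn
        (fun m => sqNorm (A.prec (t + 1) ω)
          (m - (A.mean t ω - p.eta • mulV (A.cov (t + 1) ω) (A.grad p t ω))))
        K (A.mean (t + 1) ω)

/-- The Hessian `∇² s_t(μ_t)`, where `s_t` is the surrogate of the extension `e` at round `t`. -/
def surrogateHess (A : Run Ω d) (e : Vec d → ℝ) (p : Params) (t : ℕ) (ω : Ω) : Mat d :=
  hessian (surrogate e p.lam (A.mean t ω) (A.cov t ω)) (A.mean t ω)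

/-- `Σ̄_t⁻¹ = Σ_1⁻¹ + (η / 2) ∑_{1 ≤ u < t} ∇² s_u(μ_u) + (t - 1) η γ I`, used for `t ≥ 1`. -/
def precBar (A : Run Ω d) (e : Vec d → ℝ) (p : Params) (t : ℕ) (ω : Ω) : Mat d :=
  A.prec 1 ω + (p.eta / 2) • ∑ u ∈ Finset.Ico 1 t, A.surrogateHess e p u ω +
    (((t : ℝ) - 1) * p.eta * p.gam) • (1 : Mat d)

/-- `F_t = ½ ‖μ_t - xs‖²` in the norm given by `Σ_t⁻¹`. -/
def potential (A : Run Ω d) (xs : Vec d) (t : ℕ) (ω : Ω) : ℝ :=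
  (1 / 2) * sqNorm (A.prec t ω) (A.mean t ω - xs)

/-- The three conditions that the stopping time monitors, at index `t`. -/
def Good (A : Run Ω d) (e : Vec d → ℝ) (xs : Vec d) (p : Params) (L : ℝ) (t : ℕ) (ω : Ω) :
    Prop :=
  A.potential xs t ω ≤ 1 / (2 * p.lam ^ 2 * L ^ 2) ∧
    (A.cov t ω).PosDef ∧
    Loewner ((1 / 2 : ℝ) • A.precBar e p t ω) (A.prec t ω) ∧
    Loewner (A.prec t ω) ((3 / 2 : ℝ) • A.precBar e p t ω)

/-- The stopping time `τ`: the first round `t ∈ {1, …, n}` such that the conditions fail at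
index `t + 1`, and `n` if there is none. -/
def tau (A : Run Ω d) (e : Vec d → ℝ) (xs : Vec d) (p : Params) (L : ℝ) (n : ℕ) (ω : Ω) : ℕ :=
  sInf ({t | 1 ≤ t ∧ t ≤ n ∧ ¬ A.Good e xs p L (t + 1) ω} ∪ {n})

end Run

/-- The constant `Θ`. -/
def Theta (d : ℕ) (ℓ β r R L : ℝ) (p : Params) : ℝ :=
  ((ℓ - 1) / 30) ^ (2 / ℓ) * β ^ (2 / ℓ) * (d : ℝ) ^ (-(1 / ℓ)) *
    (r / (Real.sqrt 2 * R)) ^ (2 * ((d : ℝ) - 1) / ℓ) * p.eta ^ (2 / ℓ) *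
    p.lam ^ (6 / ℓ - 2) * L ^ (4 / ℓ - 2)

end RONM

end

/-! The bound is deterministic: it holds on every trajectory. Before `τ` the precision dominates
half of Σ̄_t⁻¹, so it suffices that the form q_t(v) = vᵀΣ̄_t⁻¹v is at least Θ t^(2/ℓ)/8 on unit
vectors. Its increments are at least (η/2) vᵀ∇²s_u(μ_u)v. If q_u/2 ≥ z on unit vectors, condition
(a) puts μ_u within D₀ = z^(-1/2)/(λL) of x⋆, and at that distance the curvature of ‖· - x⋆‖^ℓ has
order D₀^(ℓ-2), that is z^(1-ℓ/2) up to constants. The difference inequality z_(u+1) - z_u ≥ c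
z_u^(1-ℓ/2) has growth of order u^(2/ℓ), and Θ is the matching constant.

The obstacle is that e is affine along rays outside K, so curvature may disappear in one direction.
With b the action at x and D ≥ ‖b - x⋆‖, the second derivative of e along v is at least βℓ(ℓ-1)
D^(ℓ-2)/π⁺ · ‖v - Dπ⁺(x)[v] b‖² (`le_liminf_secondDiff`); `hessian_nonneg_and_lintegral_le` carries
this to the surrogate. Three bounds result. In the first round most of the mass lies in the ball of
radius r, where nothing is lost (`hessian_ge_of_mean_zero`). Later, two orthogonal directions cannot
both be annihilated by the same b, so their sum loses only (r/R)^(2-ℓ) (`hessian_add_ge`). For a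
single v, curvature survives in a cone about v on the side of the mean away from the origin;
compressing the Gaussian laterally into this cone costs (r/R)^(d-1), and the remaining lateral
spread costs a multiple of vᵀΣ⁻¹v (tr Σ - vᵀΣv) (`hessian_ge`).

`GrowthData.growth` combines them. If q_(N+1)(v) falls short, the pair bound shows that all
directions orthogonal to v have grown far more, so Σ is narrow across v (`trace_inv_sub_le`), the
lateral term is small, and the single-direction bound supplies the missing increment. The jump of
the first round excludes small N. -/

namespace RONM

/-! ### Uniform convexity of powers of the norm. -/

section NormPower

/-- `r ^ ℓ` minus its best quadratic minorant on `[0, M]` is convex there. -/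
lemma convexOn_rpow_sub_sq {ℓ M : ℝ} (h1 : 1 < ℓ) (h2 : ℓ ≤ 2) :
    ConvexOn ℝ (Set.Icc 0 M)
      (fun t : ℝ => t ^ ℓ - ℓ * (ℓ - 1) / 2 * M ^ (ℓ - 2) * t ^ 2) := by
  refine convexOn_of_hasDerivWithinAt2_nonneg (convex_Icc 0 M)
    (f' := fun t => ℓ * t ^ (ℓ - 1) - ℓ * (ℓ - 1) / 2 * M ^ (ℓ - 2) * (2 * t))
    (f'' := fun t => ℓ * ((ℓ - 1) * t ^ (ℓ - 2)) - ℓ * (ℓ - 1) / 2 * M ^ (ℓ - 2) * 2) ?_ ?_ ?_ ?_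
  · refine ContinuousOn.sub ?_ (by fun_prop)
    exact (Real.continuous_rpow_const (by linarith)).continuousOn
  · intro x hx
    rw [interior_Icc] at hx
    have h := (Real.hasDerivAt_rpow_const (p := ℓ) (Or.inl hx.1.ne'))
    have h' := (hasDerivAt_pow 2 x).const_mul (ℓ * (ℓ - 1) / 2 * M ^ (ℓ - 2))
    have := (h.sub h').hasDerivWithinAt (s := interior (Set.Icc 0 M))
    refine this.congr_deriv ?_
    norm_num
  · intro x hx
    rw [interior_Icc] at hx
    have h := (Real.hasDerivAt_rpow_const (x := x) (p := ℓ - 1) (Or.inl hx.1.ne')).const_mul ℓ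
    have h' := ((hasDerivAt_id x).const_mul 2).const_mul (ℓ * (ℓ - 1) / 2 * M ^ (ℓ - 2))
    have := (h.sub h').hasDerivWithinAt (s := interior (Set.Icc 0 M))
    have e : ℓ - 1 - 1 = ℓ - 2 := by ring
    refine this.congr_deriv ?_
    rw [e]; ring
  · intro x hx
    rw [interior_Icc] at hx
    have : M ^ (ℓ - 2) ≤ x ^ (ℓ - 2) :=
      Real.rpow_le_rpow_of_nonpos hx.1 hx.2.le (by linarith)
    have hp : 0 ≤ ℓ * (ℓ - 1) := by nlinarith
    nlinarith [mul_le_mul_of_nonneg_left this hp]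

/-- Monotonicity allows ‖ax + by‖ to be replaced by a‖x‖ + b‖y‖ before convexity is applied. The
derivative is nonnegative because ℓ - 1 ≤ 1 and t^(ℓ-2) ≥ M^(ℓ-2). -/
lemma monotoneOn_rpow_sub_sq {ℓ M : ℝ} (h1 : 1 < ℓ) (h2 : ℓ ≤ 2) :
    MonotoneOn (fun t : ℝ => t ^ ℓ - ℓ * (ℓ - 1) / 2 * M ^ (ℓ - 2) * t ^ 2) (Set.Icc 0 M) := by
  refine monotoneOn_of_deriv_nonneg (convex_Icc 0 M) ?_ ?_ ?_
  · refine ContinuousOn.sub ?_ (by fun_prop)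
    exact (Real.continuous_rpow_const (by linarith)).continuousOn
  · intro x hx
    rw [interior_Icc] at hx
    have h := (Real.hasDerivAt_rpow_const (p := ℓ) (Or.inl hx.1.ne'))
    have h' := (hasDerivAt_pow 2 x).const_mul (ℓ * (ℓ - 1) / 2 * M ^ (ℓ - 2))
    exact (h.sub h').differentiableAt.differentiableWithinAt
  · intro x hx
    rw [interior_Icc] at hx
    have h := (Real.hasDerivAt_rpow_const (p := ℓ) (Or.inl hx.1.ne'))
    have h' := (hasDerivAt_pow 2 x).const_mul (ℓ * (ℓ - 1) / 2 * M ^ (ℓ - 2))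
    have e := (h.sub h').deriv
    simp only [Pi.sub_def] at e
    rw [e]
    have hle : M ^ (ℓ - 2) ≤ x ^ (ℓ - 2) :=
      Real.rpow_le_rpow_of_nonpos hx.1 hx.2.le (by linarith)
    have hx1 : x ^ (ℓ - 1) = x ^ (ℓ - 2) * x := by
      rw [← Real.rpow_add_one hx.1.ne']; ring_nf
    have hM : 0 ≤ M ^ (ℓ - 2) := Real.rpow_nonneg (hx.1.le.trans hx.2.le) _
    rw [hx1]
    have h3 : (ℓ - 1) * M ^ (ℓ - 2) ≤ x ^ (ℓ - 2) := by nlinarith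
    have h4 := mul_le_mul_of_nonneg_left h3 (by nlinarith [hx.1] : 0 ≤ ℓ * x)
    norm_num
    nlinarith [h4]

variable {E : Type*} [NormedAddCommGroup E] [InnerProductSpace ℝ E]

lemma norm_convexComb_sq {a b : ℝ} (hab : a + b = 1) (x y : E) :
    a * ‖x‖ ^ 2 + b * ‖y‖ ^ 2 - ‖a • x + b • y‖ ^ 2 = a * b * ‖x - y‖ ^ 2 := by
  rw [norm_add_sq_real, norm_sub_sq_real, norm_smul, norm_smul, inner_smul_left, inner_smul_right]
  simp only [mul_pow, Real.norm_eq_abs, sq_abs, conj_trivial]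
  obtain rfl : b = 1 - a := by linarith
  ring

/-- Uniform convexity of `‖·‖ ^ ℓ` on the ball of radius `M`. -/
lemma norm_rpow_uniformConvex {ℓ M : ℝ} (h1 : 1 < ℓ) (h2 : ℓ ≤ 2) {x y : E} (hx : ‖x‖ ≤ M)
    (hy : ‖y‖ ≤ M) {a b : ℝ} (ha : 0 ≤ a) (hb : 0 ≤ b) (hab : a + b = 1) :
    ℓ * (ℓ - 1) / 2 * M ^ (ℓ - 2) * (a * b * ‖x - y‖ ^ 2) ≤
      a * ‖x‖ ^ ℓ + b * ‖y‖ ^ ℓ - ‖a • x + b • y‖ ^ ℓ := by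
  have hn : ‖a • x + b • y‖ ≤ a * ‖x‖ + b * ‖y‖ := by
    refine (norm_add_le _ _).trans_eq ?_
    rw [norm_smul, norm_smul, Real.norm_of_nonneg ha, Real.norm_of_nonneg hb]
  have hM : a * ‖x‖ + b * ‖y‖ ≤ M := by
    have e : M = a * M + b * M := by rw [← add_mul, hab, one_mul]
    rw [e]
    exact add_le_add (mul_le_mul_of_nonneg_left hx ha) (mul_le_mul_of_nonneg_left hy hb)
  -- An increasing convex function of the norm is convex; the quadratic that was subtracted is then
  -- restored exactly by `norm_convexComb_sq`.
  have hmono := monotoneOn_rpow_sub_sq h1 h2 (M := M)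
    (a := ‖a • x + b • y‖) ⟨norm_nonneg _, hn.trans hM⟩
    (b := a * ‖x‖ + b * ‖y‖) ⟨by positivity, hM⟩ hn
  have hconv := (convexOn_rpow_sub_sq h1 h2 (M := M)).2 (x := ‖x‖) ⟨norm_nonneg _, hx⟩
    (y := ‖y‖) ⟨norm_nonneg _, hy⟩ ha hb hab
  simp only [smul_eq_mul] at hmono hconv
  rw [← norm_convexComb_sq hab]
  nlinarith

end NormPower

/-! ### The convex body, the gauge and the convexity of the extension. -/

/-- The assumptions on the convex body and the loss. -/
structure Setting {d : ℕ} (K : Set (Vec d)) (r R : ℝ) (f : Vec d → ℝ) (G : ℝ) (xs : Vec d)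
    (β ℓ : ℝ) : Prop where
  one_le : 1 ≤ d
  convex : Convex ℝ K
  compact : IsCompact K
  r_pos : 0 < r
  ball_subset : Metric.closedBall 0 r ⊆ K
  subset_ball : K ⊆ Metric.closedBall 0 R
  f_mem : ∀ x ∈ K, f x ∈ Set.Icc (0 : ℝ) 1
  lipschitz : ∀ x ∈ K, ∀ y ∈ K, |f x - f y| ≤ G * ‖x - y‖
  xs_mem : xs ∈ K
  one_lt : 1 < ℓ
  le_two : ℓ ≤ 2
  betaEll : IsBetaEllConvex K f xs β ℓ

namespace Setting

variable {d : ℕ} {K : Set (Vec d)} {r R : ℝ} {f : Vec d → ℝ} {G : ℝ} {xs : Vec d} {β ℓ : ℝ}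
  (h : Setting K r R f G xs β ℓ)
include h

lemma exists_norm_eq_one : ∃ v : Vec d, ‖v‖ = 1 :=
  ⟨EuclideanSpace.single ⟨0, h.one_le⟩ 1, by simp⟩

lemma mem_nhds : K ∈ nhds (0 : Vec d) :=
  Filter.mem_of_superset (Metric.closedBall_mem_nhds 0 h.r_pos) h.ball_subset

lemma zero_mem : (0 : Vec d) ∈ K := mem_of_mem_nhds h.mem_nhds

lemma absorbent : Absorbent ℝ K := absorbent_nhds_zero h.mem_nhds

lemma r_le_R : r ≤ R := by
  obtain ⟨v, hv⟩ := h.exists_norm_eq_one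
  have h1 : r • v ∈ Metric.closedBall (0 : Vec d) r := by
    simp [norm_smul, hv, abs_of_pos h.r_pos]
  have := h.subset_ball (h.ball_subset h1)
  simpa [norm_smul, hv, abs_of_pos h.r_pos] using this

lemma R_pos : 0 < R := h.r_pos.trans_le h.r_le_R

lemma beta_pos : 0 < β := h.betaEll.1

lemma norm_le {x : Vec d} (hx : x ∈ K) : ‖x‖ ≤ R := by
  simpa using h.subset_ball hx

lemma G_nonneg : 0 ≤ G := by
  obtain ⟨v, hv⟩ := h.exists_norm_eq_one
  have h1 : r • v ∈ K := h.ball_subset (by simp [norm_smul, hv, abs_of_pos h.r_pos])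
  have := (abs_nonneg _).trans (h.lipschitz _ h1 _ h.zero_mem)
  rw [sub_zero, norm_smul, hv, mul_one, Real.norm_of_nonneg h.r_pos.le] at this
  exact nonneg_of_mul_nonneg_left this h.r_pos

omit h in
lemma one_le_piPlus (x : Vec d) : 1 ≤ piPlus K x := le_max_left _ _

omit h in
lemma piPlus_pos (x : Vec d) : 0 < piPlus K x := one_pos.trans_le (one_le_piPlus x)

lemma r_mul_gauge_le (x : Vec d) : r * gauge K x ≤ ‖x‖ :=
  mul_gauge_le_norm (Metric.ball_subset_closedBall.trans h.ball_subset)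

lemma gauge_le_one_iff (x : Vec d) : gauge K x ≤ 1 ↔ x ∈ K := by
  rw [gauge_le_one_iff_mem_closure h.convex h.mem_nhds, h.compact.isClosed.closure_eq]

lemma inv_smul_mem {t : ℝ} (ht : 0 < t) {x : Vec d} (hx : gauge K x ≤ t) : t⁻¹ • x ∈ K := by
  rw [← h.gauge_le_one_iff, gauge_smul_of_nonneg (by positivity), smul_eq_mul]
  rw [inv_mul_le_iff₀ ht]; simpa using hx

lemma action_mem (x : Vec d) : action K x ∈ K :=
  h.inv_smul_mem (piPlus_pos x) (le_max_right _ _)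

omit h in
lemma piPlus_smul_action (x : Vec d) : piPlus K x • action K x = x := by
  rw [action, smul_smul, mul_inv_cancel₀ (piPlus_pos x).ne', one_smul]

lemma piPlus_convex : ConvexOn ℝ Set.univ (piPlus K) := by
  refine ConvexOn.sup (convexOn_const 1 convex_univ) ⟨convex_univ, ?_⟩
  intro x _ y _ a b ha hb _
  refine (gauge_add_le h.convex h.absorbent _ _).trans_eq ?_
  rw [gauge_smul_of_nonneg ha, gauge_smul_of_nonneg hb]

lemma piPlus_add_le (x u : Vec d) : piPlus K (x + u) ≤ piPlus K x + ‖u‖ / r := by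
  have h1 := gauge_add_le h.convex h.absorbent x u
  have h2 : gauge K u ≤ ‖u‖ / r := by
    rw [le_div_iff₀ h.r_pos, mul_comm]; exact h.r_mul_gauge_le u
  have h3 : gauge K x ≤ piPlus K x := le_max_right _ _
  have h4 : 1 ≤ piPlus K x := le_max_left _ _
  have h5 : 0 ≤ ‖u‖ / r := div_nonneg (norm_nonneg _) h.r_pos.le
  exact max_le (by linarith) (by linarith)

lemma piPlus_lipschitz : LipschitzWith (Real.toNNReal r⁻¹) (piPlus K) := by
  refine LipschitzWith.of_le_add_mul _ fun x y => ?_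
  have := h.piPlus_add_le y (x - y)
  rw [add_sub_cancel] at this
  rw [Real.coe_toNNReal _ (inv_nonneg.2 h.r_pos.le), dist_eq_norm]
  rwa [div_eq_inv_mul] at this

lemma continuous_piPlus : Continuous (piPlus K) := h.piPlus_lipschitz.continuous

lemma continuous_action : Continuous (action K) :=
  (h.continuous_piPlus.inv₀ fun x => (piPlus_pos x).ne').smul continuous_id

lemma continuous_extension : Continuous (extension K f G R) := by
  have hf : ContinuousOn f K := by
    refine LipschitzOnWith.continuousOn (K := Real.toNNReal G) ?_
    refine LipschitzOnWith.of_dist_le_mul fun x hx y hy => ?_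
    rw [Real.coe_toNNReal _ h.G_nonneg, Real.dist_eq, dist_eq_norm]
    exact h.lipschitz x hx y hy
  have h1 : Continuous fun x => f (action K x) :=
    hf.comp_continuous h.continuous_action h.action_mem
  exact (h.continuous_piPlus.mul h1).add
    (continuous_const.mul (h.continuous_piPlus.sub continuous_const))

lemma abs_extension_le (x : Vec d) :
    |extension K f G R x| ≤ (1 + G * R) * (1 + ‖x‖ / r) := by
  have h1 : piPlus K x ≤ 1 + ‖x‖ / r := by
    have := h.piPlus_add_le 0 x
    rwa [zero_add, show piPlus K (0 : Vec d) = 1 by simp [piPlus]] at this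
  have hf := h.f_mem _ (h.action_mem x)
  have hP := one_le_piPlus (K := K) x
  have hGR : 0 ≤ G * R := mul_nonneg h.G_nonneg h.R_pos.le
  have hnn : 0 ≤ extension K f G R x := by
    unfold extension
    have := mul_nonneg (zero_le_one.trans hP) hf.1
    nlinarith [mul_nonneg hGR (sub_nonneg.2 hP)]
  rw [abs_of_nonneg hnn]
  unfold extension
  nlinarith [mul_le_mul_of_nonneg_left hf.2 (zero_le_one.trans hP),
    mul_le_mul_of_nonneg_left h1 hGR]

/-- The perspective of `f` is monotone in the scale. -/
lemma extension_le_perspective (x : Vec d) {t : ℝ} (ht : piPlus K x ≤ t) :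
    extension K f G R x ≤ t * f (t⁻¹ • x) + G * R * (t - 1) := by
  have hP := piPlus_pos (K := K) x
  have htp : 0 < t := hP.trans_le ht
  have hmem : t⁻¹ • x ∈ K := h.inv_smul_mem htp ((le_max_right _ _).trans ht)
  have hl := h.lipschitz _ (h.action_mem x) _ hmem
  -- Rescaling from π⁺(x) to t shrinks the action by the factor π⁺(x)/t, so the Lipschitz loss is at
  -- most GR(t - π⁺(x)), which is what the penalty term gains.
  have hn : ‖action K x - t⁻¹ • x‖ ≤ (1 - piPlus K x / t) * R := by
    have : action K x - t⁻¹ • x = (1 - piPlus K x / t) • action K x := by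
      rw [sub_smul, one_smul, div_eq_inv_mul, mul_smul, piPlus_smul_action]
    rw [this, norm_smul, Real.norm_of_nonneg]
    · exact mul_le_mul_of_nonneg_left (h.norm_le (h.action_mem x))
        (sub_nonneg.2 ((div_le_one htp).2 ht))
    · exact sub_nonneg.2 ((div_le_one htp).2 ht)
  have h2 : f (action K x) - f (t⁻¹ • x) ≤ G * ((1 - piPlus K x / t) * R) :=
    (le_abs_self _).trans (hl.trans (mul_le_mul_of_nonneg_left hn h.G_nonneg))
  have hf := (h.f_mem _ hmem).1
  have h3 := mul_le_mul_of_nonneg_left h2 hP.le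
  have h4 : piPlus K x * (G * ((1 - piPlus K x / t) * R)) ≤ G * R * (t - piPlus K x) := by
    have e : piPlus K x * (G * ((1 - piPlus K x / t) * R)) =
        G * R * ((t - piPlus K x) * (piPlus K x / t)) := by field_simp
    rw [e]
    refine mul_le_mul_of_nonneg_left ?_ (mul_nonneg h.G_nonneg h.R_pos.le)
    exact mul_le_of_le_one_right (sub_nonneg.2 ht) ((div_le_one htp).2 ht)
  unfold extension
  nlinarith [mul_nonneg (sub_nonneg.2 ht) hf]

/-- Strong convexity of the extension, in terms of the actions that are played. -/
lemma extension_secondDiff {y z : Vec d} {M : ℝ} (hy : ‖action K y - xs‖ ≤ M)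
    (hz : ‖action K z - xs‖ ≤ M) :
    β * (ℓ * (ℓ - 1) / 2) * M ^ (ℓ - 2) *
        (piPlus K y * piPlus K z / (piPlus K y + piPlus K z) *
          ‖action K y - action K z‖ ^ 2) ≤
      extension K f G R y + extension K f G R z -
        2 * extension K f G R ((1 / 2 : ℝ) • (y + z)) := by
  set p := piPlus K y with hp
  set q := piPlus K z with hq
  have hp0 : 0 < p := piPlus_pos y
  have hq0 : 0 < q := piPlus_pos z
  set t := (p + q) / 2 with ht
  have ht0 : 0 < t := by positivity
  have hPt : piPlus K ((1 / 2 : ℝ) • (y + z)) ≤ t := by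
    have := h.piPlus_convex.2 (Set.mem_univ y) (Set.mem_univ z) (by norm_num : (0 : ℝ) ≤ 1 / 2)
      (by norm_num : (0 : ℝ) ≤ 1 / 2) (by norm_num)
    rw [← smul_add, smul_eq_mul, smul_eq_mul] at this
    rw [ht]; linarith
  have h1 := h.extension_le_perspective _ hPt
  -- At scale t = (p + q)/2 the midpoint of y and z is the average of their actions with weights
  -- proportional to p and q, so convexity of f on K applies to the actions.
  set a := p / (p + q) with ha
  set b := q / (p + q) with hb
  have hab : a + b = 1 := by rw [ha, hb]; field_simp
  have ha0 : 0 ≤ a := by positivity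
  have hb0 : 0 ≤ b := by positivity
  have hcomb : t⁻¹ • ((1 / 2 : ℝ) • (y + z)) = a • action K y + b • action K z := by
    conv_lhs => rw [← piPlus_smul_action (K := K) y, ← piPlus_smul_action (K := K) z]
    rw [← hp, ← hq, smul_add, smul_add, smul_smul, smul_smul, smul_smul, smul_smul]
    congr 2
    · rw [ht, ha]; field_simp
    · rw [ht, hb]; field_simp
  rw [hcomb] at h1
  have hc := h.betaEll.2.2.2 (h.action_mem y) (h.action_mem z) ha0 hb0 hab
  simp only [smul_eq_mul] at hc
  have hu := norm_rpow_uniformConvex h.one_lt h.le_two hy hz ha0 hb0 hab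
  have e1 : a • (action K y - xs) + b • (action K z - xs) =
      a • action K y + b • action K z - xs := by
    rw [smul_sub, smul_sub]
    have : xs = a • xs + b • xs := by rw [← add_smul, hab, one_smul]
    nth_rewrite 3 [this]
    abel
  rw [e1, sub_sub_sub_cancel_right] at hu
  set F := f (a • action K y + b • action K z)
  set N := ‖a • action K y + b • action K z - xs‖ ^ ℓ
  have h2 : β * (ℓ * (ℓ - 1) / 2 * M ^ (ℓ - 2) * (a * b * ‖action K y - action K z‖ ^ 2)) ≤
      a * f (action K y) + b * f (action K z) - F := by
    have := mul_le_mul_of_nonneg_left hu h.beta_pos.le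
    nlinarith
  have h3 := mul_le_mul_of_nonneg_left h2 (by positivity : 0 ≤ p + q)
  have e2 : (p + q) * (a * f (action K y) + b * f (action K z) - F) =
      p * f (action K y) + q * f (action K z) - 2 * t * F := by
    rw [ha, hb, ht]; field_simp
  have e3 : (p + q) *
      (β * (ℓ * (ℓ - 1) / 2 * M ^ (ℓ - 2) * (a * b * ‖action K y - action K z‖ ^ 2))) =
      β * (ℓ * (ℓ - 1) / 2) * M ^ (ℓ - 2) *
        (p * q / (p + q) * ‖action K y - action K z‖ ^ 2) := by
    rw [ha, hb]; field_simp
  rw [e2, e3] at h3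
  have e4 : extension K f G R y = p * f (action K y) + G * R * (p - 1) := rfl
  have e5 : extension K f G R z = q * f (action K z) + G * R * (q - 1) := rfl
  rw [e4, e5]
  have e6 : 2 * (G * R * (t - 1)) = G * R * (p - 1) + G * R * (q - 1) := by rw [ht]; ring
  linarith [h3, h1, e6]

end Setting

end RONM

/-! ### Infinitesimal curvature of the extension. -/

namespace RONM

open Filter Topology RealInnerProductSpace

namespace Setting

variable {d : ℕ} {K : Set (Vec d)} {r R : ℝ} {f : Vec d → ℝ} {G : ℝ} {xs : Vec d} {β ℓ : ℝ}
  (h : Setting K r R f G xs β ℓ)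
include h

lemma piPlus_of_mem {x : Vec d} (hx : x ∈ K) : piPlus K x = 1 :=
  max_eq_left ((h.gauge_le_one_iff x).2 hx)

lemma piPlus_of_notMem {x : Vec d} (hx : x ∉ K) : piPlus K x = gauge K x ∧ 1 < piPlus K x := by
  have : 1 < gauge K x := not_le.1 fun h' => hx ((h.gauge_le_one_iff x).1 h')
  exact ⟨max_eq_right this.le, lt_max_of_lt_right this⟩

/-- π⁺ attains its global minimum 1 everywhere on K, boundary included; at a point of
non-differentiability `fderiv` is zero by convention. -/
lemma fderiv_piPlus_of_mem {x : Vec d} (hx : x ∈ K) : fderiv ℝ (piPlus K) x = 0 := by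
  refine IsLocalMin.fderiv_eq_zero (Eventually.of_forall fun y => ?_)
  rw [h.piPlus_of_mem hx]
  exact one_le_piPlus y

omit h in
lemma hasDerivAt_piPlus_line {x : Vec d} (hd : DifferentiableAt ℝ (piPlus K) x) (v : Vec d) :
    HasDerivAt (fun t : ℝ => piPlus K (x + t • v)) (fderiv ℝ (piPlus K) x v) 0 := by
  have h1 : HasDerivAt (fun t : ℝ => x + t • v) v 0 := by
    simpa using ((hasDerivAt_id (0 : ℝ)).smul_const v).const_add x
  have h2 : HasFDerivAt (piPlus K) (fderiv ℝ (piPlus K) x) (x + (0 : ℝ) • v) := by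
    simpa using hd.hasFDerivAt
  exact h2.comp_hasDerivAt (0 : ℝ) h1

lemma fderiv_piPlus_sub_le {x : Vec d} (hd : DifferentiableAt ℝ (piPlus K) x) (y : Vec d) :
    fderiv ℝ (piPlus K) x (y - x) ≤ piPlus K y - piPlus K x := by
  have h1 := (hasDerivAt_piPlus_line hd (y - x)).tendsto_slope_zero_right
  refine le_of_tendsto h1 ?_
  filter_upwards [Ioc_mem_nhdsGT (show (0 : ℝ) < 1 by norm_num)] with t ht
  have hc := h.piPlus_convex.2 (Set.mem_univ x) (Set.mem_univ y) (sub_nonneg.2 ht.2) ht.1.le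
    (by ring)
  have e : x + (0 + t) • (y - x) = (1 - t) • x + t • y := by
    rw [zero_add, smul_sub, sub_smul, one_smul]; abel
  rw [e, zero_smul, add_zero, smul_eq_mul, inv_mul_le_iff₀ ht.1]
  simp only [smul_eq_mul] at hc
  linarith

lemma fderiv_piPlus_le {x : Vec d} (hd : DifferentiableAt ℝ (piPlus K) x) (u : Vec d) :
    fderiv ℝ (piPlus K) x u ≤ ‖u‖ / r := by
  have h1 := h.fderiv_piPlus_sub_le hd (x + u)
  have h2 := h.piPlus_add_le x u
  rw [add_sub_cancel_left] at h1
  linarith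

/-- Outside K the action has gauge exactly 1, hence lies at distance at least r from the origin. -/
lemma r_le_norm_action {x : Vec d} (hx : x ∉ K) : r ≤ ‖action K x‖ := by
  obtain ⟨hg, h1x⟩ := h.piPlus_of_notMem hx
  have h1 := h.r_mul_gauge_le (action K x)
  rwa [action, gauge_smul_of_nonneg (inv_nonneg.2 (piPlus_pos x).le), smul_eq_mul, ← hg,
    inv_mul_cancel₀ (piPlus_pos x).ne', mul_one] at h1

omit h in
lemma norm_sub_action (x : Vec d) : ‖x - action K x‖ = (piPlus K x - 1) * ‖action K x‖ := by
  have : x - action K x = (piPlus K x - 1) • action K x := by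
    rw [sub_smul, one_smul, piPlus_smul_action]
  rw [this, norm_smul, Real.norm_of_nonneg (sub_nonneg.2 (one_le_piPlus x))]

omit h in
-- The vector v - Dπ⁺(x)[v] b that appears here measures how much of v is visible to the loss:
-- outside K it vanishes when v points along the ray through x.
lemma hasDerivAt_action_line {x : Vec d} (hd : DifferentiableAt ℝ (piPlus K) x) (v : Vec d) :
    HasDerivAt (fun t : ℝ => action K (x + t • v))
      ((piPlus K x)⁻¹ • (v - fderiv ℝ (piPlus K) x v • action K x)) 0 := by
  have h1 : HasDerivAt (fun t : ℝ => x + t • v) v 0 := by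
    simpa using ((hasDerivAt_id (0 : ℝ)).smul_const v).const_add x
  have h2 := hasDerivAt_piPlus_line hd v
  have hne : piPlus K (x + (0 : ℝ) • v) ≠ 0 := (piPlus_pos _).ne'
  have h3 := (h2.fun_inv hne).smul h1
  refine h3.congr_deriv ?_
  rw [zero_smul, add_zero, action, smul_sub, smul_smul, smul_smul, sub_eq_add_neg, ← neg_smul]
  congr 2
  field_simp

/-- Lower bound for the second difference quotients of the extension. -/
lemma le_liminf_secondDiff {x : Vec d} (hd : DifferentiableAt ℝ (piPlus K) x) (v : Vec d)
    {D : ℝ} (hD : 0 < D) (hxD : ‖action K x - xs‖ ≤ D) {u : ℕ → ℝ}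
    (hu : Tendsto u atTop (𝓝[≠] 0)) :
    ENNReal.ofReal (β * (ℓ * (ℓ - 1)) *
        (D ^ (ℓ - 2) / piPlus K x * ‖v - fderiv ℝ (piPlus K) x v • action K x‖ ^ 2)) ≤
      liminf (fun n => ENNReal.ofReal ((extension K f G R (x + u n • v) +
        extension K f G R (x - u n • v) - 2 * extension K f G R x) / u n ^ 2)) atTop := by
  set e := extension K f G R with he
  -- Including D in the maximum makes M t tend to D > 0, even when the action at x is closer to `xs`
  -- or equal to it, so that the negative power is continuous in the limit.
  set M : ℝ → ℝ := fun t => max D (max ‖action K (x + t • v) - xs‖ ‖action K (x + (-t) • v) - xs‖)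
  set LB : ℝ → ℝ := fun t => β * (ℓ * (ℓ - 1) / 2) * M t ^ (ℓ - 2) *
    (piPlus K (x + t • v) * piPlus K (x + (-t) • v) /
      (piPlus K (x + t • v) + piPlus K (x + (-t) • v)) *
        ‖t⁻¹ • (action K (x + t • v) - action K (x + (-t) • v))‖ ^ 2) with hLB
  have hle : ∀ t : ℝ, t ≠ 0 → LB t ≤ (e (x + t • v) + e (x - t • v) - 2 * e x) / t ^ 2 := by
    intro t ht
    have := h.extension_secondDiff (M := M t) (y := x + t • v) (z := x + (-t) • v)
      ((le_max_left _ _).trans (le_max_right _ _)) ((le_max_right _ _).trans (le_max_right _ _))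
    have e1 : (1 / 2 : ℝ) • (x + t • v + (x + (-t) • v)) = x := by
      rw [neg_smul, add_add_add_comm, add_neg_cancel, add_zero, ← two_smul ℝ x, smul_smul]
      norm_num
    have e2 : x + (-t) • v = x - t • v := by rw [neg_smul, sub_eq_add_neg]
    rw [e1] at this
    rw [le_div_iff₀ (by positivity)]
    refine le_of_eq_of_le ?_ (this.trans_eq (by rw [e2]))
    simp only [hLB]
    rw [norm_smul, mul_pow, norm_inv, Real.norm_eq_abs, inv_pow, sq_abs]
    field_simp
  have hx0 : Tendsto (fun t : ℝ => x + t • v) (𝓝[≠] 0) (𝓝 x) := by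
    have : Continuous fun t : ℝ => x + t • v := by fun_prop
    simpa using (this.tendsto 0).mono_left nhdsWithin_le_nhds
  have hx1 : Tendsto (fun t : ℝ => x + (-t) • v) (𝓝[≠] 0) (𝓝 x) := by
    have : Continuous fun t : ℝ => x + (-t) • v := by fun_prop
    simpa using (this.tendsto 0).mono_left nhdsWithin_le_nhds
  have hP0 := (h.continuous_piPlus.tendsto x).comp hx0
  have hP1 := (h.continuous_piPlus.tendsto x).comp hx1
  have hA0 := (h.continuous_action.tendsto x).comp hx0
  have hA1 := (h.continuous_action.tendsto x).comp hx1
  have hM : Tendsto M (𝓝[≠] 0) (𝓝 D) := by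
    have := tendsto_const_nhds (x := D) (f := 𝓝[≠] (0 : ℝ)) |>.max
      ((hA0.sub_const xs).norm.max (hA1.sub_const xs).norm)
    rwa [max_self, max_eq_left hxD] at this
  have hM' : Tendsto (fun t => M t ^ (ℓ - 2)) (𝓝[≠] 0) (𝓝 (D ^ (ℓ - 2))) :=
    hM.rpow_const (Or.inl hD.ne')
  have hdq : Tendsto (fun t : ℝ => t⁻¹ • (action K (x + t • v) - action K (x + (-t) • v)))
      (𝓝[≠] 0) (𝓝 ((2 * (piPlus K x)⁻¹) • (v - fderiv ℝ (piPlus K) x v • action K x))) := by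
    have h1 := hasDerivAt_action_line hd v
    have h1' : HasDerivAt (fun t : ℝ => action K (x + t • v))
      ((piPlus K x)⁻¹ • (v - fderiv ℝ (piPlus K) x v • action K x)) (-0) := by simpa using h1
    have h2 := h1.sub (h1'.scomp (0 : ℝ) (hasDerivAt_neg (0 : ℝ)))
    have h3 := h2.tendsto_slope_zero
    simp only [Function.comp_def, Pi.sub_apply, zero_add, neg_zero, sub_self, sub_zero] at h3
    rw [neg_one_smul, sub_neg_eq_add, ← two_smul ℝ, smul_smul] at h3
    exact h3
  have hPx := piPlus_pos (K := K) x
  have hLBt : Tendsto LB (𝓝[≠] 0) (𝓝 (β * (ℓ * (ℓ - 1)) *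
        (D ^ (ℓ - 2) / piPlus K x * ‖v - fderiv ℝ (piPlus K) x v • action K x‖ ^ 2))) := by
    -- The weight pq/(p + q) tends to π⁺/2 and the squared difference quotient carries 4/π⁺²; their
    -- product 2/π⁺ turns ℓ(ℓ-1)/2 into ℓ(ℓ-1)/π⁺.
    have h1 := (hM'.const_mul (β * (ℓ * (ℓ - 1) / 2))).mul
      (((hP0.mul hP1).div (hP0.add hP1) (by positivity)).mul (hdq.norm.pow 2))
    have h2 : Tendsto LB (𝓝[≠] 0) _ := h1
    convert h2 using 2
    rw [norm_smul, Real.norm_of_nonneg (by positivity)]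
    field_simp
    ring
  have hfin := (ENNReal.continuous_ofReal.tendsto _).comp (hLBt.comp hu)
  rw [← hfin.liminf_eq]
  refine liminf_le_liminf ?_
  have hne : ∀ᶠ n in atTop, u n ≠ 0 := (tendsto_nhdsWithin_iff.1 hu).2
  filter_upwards [hne] with n hn
  exact ENNReal.ofReal_le_ofReal (hle _ hn)

end Setting

end RONM

/-! ### Pointwise curvature bounds in given directions. -/

namespace RONM

open Filter Topology RealInnerProductSpace

section Hilbert

variable {E : Type*} [NormedAddCommGroup E] [InnerProductSpace ℝ E]

/-- The image of an orthonormal pair under two projections along the same line is not small. -/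
lemma one_le_norm_sub_smul_sq_add {v w : E} (hv : ‖v‖ = 1) (hw : ‖w‖ = 1)
    (hvw : inner ℝ v w = 0) (b : E) (s t : ℝ) :
    1 ≤ ‖v - s • b‖ ^ 2 + ‖w - t • b‖ ^ 2 := by
  -- Bessel's inequality. The squared distance of a unit vector q to the line of b ≠ 0 is 1 -
  -- ⟨q,b⟩²/‖b‖², so the two distances add up to at least 2 - 1.
  have hb : inner ℝ v b ^ 2 + inner ℝ w b ^ 2 ≤ ‖b‖ ^ 2 := by
    have : 0 ≤ ‖b - (inner ℝ v b • v + inner ℝ w b • w)‖ ^ 2 := sq_nonneg _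
    rw [norm_sub_sq_real, norm_add_sq_real, norm_smul, norm_smul, inner_add_right,
      inner_smul_right, inner_smul_right, inner_smul_left, inner_smul_right, hvw, hv, hw,
      real_inner_comm v b, real_inner_comm w b] at this
    simp only [Real.norm_eq_abs, mul_one, sq_abs, conj_trivial] at this
    nlinarith
  have key : ∀ (q : E) (a : ℝ), ‖q‖ = 1 → (‖b‖ ^ 2 = 0 → 1 ≤ ‖q - a • b‖ ^ 2) ∧
      ‖b‖ ^ 2 - inner ℝ q b ^ 2 ≤ ‖b‖ ^ 2 * ‖q - a • b‖ ^ 2 := by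
    intro q a hq
    rw [norm_sub_sq_real, norm_smul, inner_smul_right, hq, mul_pow, Real.norm_eq_abs, sq_abs]
    constructor
    · intro h0
      have : b = 0 := by simpa using h0
      simp [this]
    · nlinarith [sq_nonneg (a * ‖b‖ ^ 2 - inner ℝ q b)]
  rcases eq_or_lt_of_le (sq_nonneg ‖b‖) with h0 | h0
  · nlinarith [(key v s hv).1 h0.symm, sq_nonneg ‖w - t • b‖]
  · have h1 := (key v s hv).2
    have h2 := (key w t hw).2
    by_contra! hlt
    nlinarith [mul_lt_mul_of_pos_left hlt h0]

end Hilbert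

/-- Scaling the argument of a power with exponent in `(-1, 0]`. -/
lemma rpow_mul_div_le {ℓ D₀ D : ℝ} (h1 : 1 < ℓ) (h0 : 0 < D₀) (h : D₀ ≤ D) :
    D₀ ^ (ℓ - 2) * (D₀ / D) ≤ D ^ (ℓ - 2) := by
  have hD : 0 < D := h0.trans_le h
  have e1 : D₀ ^ (ℓ - 2) * D₀ = D₀ ^ (ℓ - 1) := by
    rw [← Real.rpow_add_one h0.ne']; ring_nf
  have e2 : D ^ (ℓ - 2) * D = D ^ (ℓ - 1) := by
    rw [← Real.rpow_add_one hD.ne']; ring_nf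
  rw [← mul_div_assoc, e1, div_le_iff₀ hD, e2]
  exact Real.rpow_le_rpow h0.le h (by linarith)

/-- The factor by which the curvature may drop at relative distance `η` from the mean. -/
noncomputable def omega (η : ℝ) : ℝ := (1 - 3.4 * η ^ 2) / ((1 + η) * (1 + 1.21 * η))

lemma omega_le_inv {η : ℝ} (h0 : 0 ≤ η) : omega η ≤ ((1 + η) * (1 + 1.21 * η))⁻¹ := by
  rw [omega, div_eq_mul_inv]
  exact mul_le_of_le_one_left (by positivity) (by nlinarith [sq_nonneg η])

/-- This is the case where the gauge increases along v, with X = Dπ⁺(x)[v]‖b‖: the two factors bound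
π⁺ and D/D₀, the right side bounds ‖v - Dπ⁺(x)[v] b‖² from below. The constant 3.4 makes 0.92X² -
3.5ηX + 3.4η² nonnegative: for η > 0 its discriminant is (12.25 - 12.512)η² < 0. -/
lemma omega_mul_le {η X : ℝ} (h0 : 0 ≤ η) (h1 : η ≤ 0.4) (hX : 0 ≤ X) :
    omega η * ((1 + η + η * X) * (1 + 1.21 * η + η / 2 * X)) ≤ 1 - 2 * η * X + X ^ 2 := by
  have hA : 0 < (1 + η) * (1 + 1.21 * η) := by positivity
  have hw : 0 ≤ 1 - 3.4 * η ^ 2 := by nlinarith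
  have h2 : (1 + η + η * X) * (1 + 1.21 * η + η / 2 * X) ≤
      (1 + η) * (1 + 1.21 * η) * ((1 + η * X) * (1 + η / 2 * X)) := by
    have a1 : 1 + η + η * X ≤ (1 + η) * (1 + η * X) := by nlinarith [mul_nonneg h0 hX]
    have a2 : 1 + 1.21 * η + η / 2 * X ≤ (1 + 1.21 * η) * (1 + η / 2 * X) := by
      nlinarith [mul_nonneg h0 hX]
    calc _ ≤ ((1 + η) * (1 + η * X)) * ((1 + 1.21 * η) * (1 + η / 2 * X)) := by gcongr
      _ = _ := by ring
  have h3 : omega η * ((1 + η + η * X) * (1 + 1.21 * η + η / 2 * X)) ≤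
      (1 - 3.4 * η ^ 2) * ((1 + η * X) * (1 + η / 2 * X)) := by
    rw [omega, div_mul_eq_mul_div, div_le_iff₀ hA]
    nlinarith [mul_le_mul_of_nonneg_left h2 hw]
  refine h3.trans ?_
  have h4 : (1 - 3.4 * η ^ 2) * ((1 + η * X) * (1 + η / 2 * X)) ≤
      1 - 3.4 * η ^ 2 + 1.5 * (η * X) + (η * X) ^ 2 / 2 := by
    nlinarith [mul_nonneg h0 hX, mul_nonneg (sq_nonneg η) (mul_nonneg h0 hX),
      mul_nonneg (sq_nonneg η) (sq_nonneg (η * X))]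
  refine h4.trans ?_
  have hη2 : η ^ 2 ≤ 0.16 := by nlinarith
  nlinarith [sq_nonneg (X - 1.9 * η), sq_nonneg X, mul_nonneg (sq_nonneg X) (sub_nonneg.2 hη2)]

namespace Setting

variable {d : ℕ} {K : Set (Vec d)} {r R : ℝ} {f : Vec d → ℝ} {G : ℝ} {xs : Vec d} {β ℓ : ℝ}
  (h : Setting K r R f G xs β ℓ)
include h

lemma piPlus_le_of_mem {m : Vec d} (hm : m ∈ K) (x : Vec d) :
    piPlus K x ≤ 1 + ‖x - m‖ / r := by
  have := h.piPlus_add_le m (x - m)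
  rwa [add_sub_cancel, h.piPlus_of_mem hm] at this

/-- The action stays within a multiple of the distance. -/
lemma norm_action_sub_le {m : Vec d} (hm : m ∈ K) {D₀ : ℝ} (hD : ‖m - xs‖ ≤ D₀) (x : Vec d) :
    ‖action K x - xs‖ ≤ R / r * (D₀ + 2 * ‖x - m‖) := by
  have h1 : ‖action K x - xs‖ ≤ ‖x - action K x‖ + ‖x - m‖ + ‖m - xs‖ := by
    have : action K x - xs = -(x - action K x) + (x - m) + (m - xs) := by abel
    rw [this]
    refine (norm_add_le _ _).trans ?_
    gcongr
    refine (norm_add_le _ _).trans ?_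
    rw [norm_neg]
  have h2 : ‖x - action K x‖ ≤ R / r * ‖x - m‖ := by
    rw [norm_sub_action, div_mul_eq_mul_div, mul_comm R, ← div_mul_eq_mul_div]
    refine mul_le_mul ?_ (h.norm_le (h.action_mem x)) (norm_nonneg _)
      (div_nonneg (norm_nonneg _) h.r_pos.le)
    linarith [h.piPlus_le_of_mem hm x]
  have hR : 1 ≤ R / r := (one_le_div h.r_pos).2 h.r_le_R
  nlinarith [norm_nonneg (x - m), norm_nonneg (m - xs)]

/-- Curvature at the points of `K`. -/
lemma curvature_of_mem {x v : Vec d} (hx : x ∈ K) (hv : ‖v‖ = 1) {D₀ D : ℝ} (h0 : 0 < D₀)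
    (hD : D₀ ≤ D) :
    D₀ ^ (ℓ - 2) * (D₀ / D) ≤
      D ^ (ℓ - 2) / piPlus K x * ‖v - fderiv ℝ (piPlus K) x v • action K x‖ ^ 2 := by
  rw [h.fderiv_piPlus_of_mem hx, h.piPlus_of_mem hx]
  simpa [hv] using rpow_mul_div_le h.one_lt h0 hD

set_option maxHeartbeats 1600000 in
/-- Curvature in the direction `v`, on the side of the mean that is turned to the origin. -/
lemma curvature_le {x m v : Vec d} (hd : DifferentiableAt ℝ (piPlus K) x) (hm : m ∈ K)
    (hv : ‖v‖ = 1) (hvm : inner ℝ v m ≤ 0) {D₀ η : ℝ} (h0 : 0 < D₀) (hD : ‖m - xs‖ ≤ D₀)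
    (hη0 : 0 ≤ η) (hη : η ≤ 0.4) (hpos : 0 < inner ℝ v (x - m))
    (hr : inner ℝ v (x - m) ≤ η * r) (hD₀ : inner ℝ v (x - m) ≤ η / 2 * D₀)
    (hc : ‖x - m - inner ℝ v (x - m) • v‖ * R ≤ r * inner ℝ v (x - m)) :
    ∃ D, 0 < D ∧ ‖action K x - xs‖ ≤ D ∧
      omega η * (1 - ‖x - m - inner ℝ v (x - m) • v‖ * R / (r * inner ℝ v (x - m))) ^ 2 *
          D₀ ^ (ℓ - 2) ≤
        D ^ (ℓ - 2) / piPlus K x * ‖v - fderiv ℝ (piPlus K) x v • action K x‖ ^ 2 := by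
  set k := inner ℝ v (x - m) with hk
  set z := x - m - k • v with hz
  set c := ‖z‖ * R / (r * k) with hcdef
  have hr0 := h.r_pos
  have hR0 := h.R_pos
  have hrR := h.r_le_R
  have hrk : 0 < r * k := mul_pos hr0 hpos
  have hc0 : 0 ≤ c := by positivity
  have hc1 : c ≤ 1 := (div_le_one hrk).2 hc
  have hzc : ‖z‖ = c * (r * k) / R := by rw [hcdef]; field_simp
  have hzr : ‖z‖ / r = c * k / R := by rw [hzc]; field_simp
  have hzk : ‖z‖ ≤ c * k := by
    rw [hzc, div_le_iff₀ hR0]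
    nlinarith [mul_nonneg (mul_nonneg hc0 hpos.le) (sub_nonneg.2 hrR)]
  have hxm : x - m = k • v + z := by rw [hz]; abel
  have hvz : inner ℝ v z = 0 := by
    rw [hz, inner_sub_right, ← hk, inner_smul_right, real_inner_self_eq_norm_sq, hv]; ring
  -- Inside the cone the lateral part is at most k, so ‖x - m‖ ≤ √2 k.
  have hg : ‖x - m‖ ≤ 1.42 * k := by
    have h2 : ‖x - m‖ ^ 2 = k ^ 2 + ‖z‖ ^ 2 := by
      rw [hxm, norm_add_sq_real, inner_smul_left, hvz, norm_smul, hv, mul_pow, Real.norm_eq_abs,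
        sq_abs]
      simp
    have h3 : ‖z‖ ≤ k := hzk.trans (mul_le_of_le_one_left hpos.le hc1)
    refine abs_le_of_sq_le_sq' ?_ (by positivity) |>.2
    nlinarith [norm_nonneg z]
  have hω0 : 0 < (1 + η) * (1 + 1.21 * η) := by positivity
  have hωn : 0 ≤ omega η := div_nonneg (by nlinarith) hω0.le
  have hc2 : (1 - c) ^ 2 ≤ 1 := by nlinarith
  have htri : ‖action K x - xs‖ ≤ ‖x - action K x‖ + 1.42 * k + D₀ := by
    have : action K x - xs = -(x - action K x) + (x - m) + (m - xs) := by abel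
    rw [this]
    refine (norm_add_le _ _).trans (add_le_add ((norm_add_le _ _).trans ?_) hD)
    rw [norm_neg]; gcongr
  -- it suffices to compare after clearing denominators
  have suff : ∀ D, D₀ ≤ D → omega η * (1 - c) ^ 2 * (piPlus K x * (D / D₀)) ≤
        ‖v - fderiv ℝ (piPlus K) x v • action K x‖ ^ 2 →
      omega η * (1 - c) ^ 2 * D₀ ^ (ℓ - 2) ≤
        D ^ (ℓ - 2) / piPlus K x * ‖v - fderiv ℝ (piPlus K) x v • action K x‖ ^ 2 := by
    intro D hDD hle
    have hDp : 0 < D := h0.trans_le hDD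
    have hPp := piPlus_pos (K := K) x
    have h3 := rpow_mul_div_le h.one_lt h0 hDD
    have h4 : 0 ≤ D ^ (ℓ - 2) / piPlus K x := by positivity
    refine le_trans ?_ (mul_le_mul_of_nonneg_left hle h4)
    have e : D ^ (ℓ - 2) / piPlus K x * (omega η * (1 - c) ^ 2 * (piPlus K x * (D / D₀))) =
        omega η * (1 - c) ^ 2 * (D ^ (ℓ - 2) * (D / D₀)) := by field_simp
    rw [e]
    refine mul_le_mul_of_nonneg_left ?_ (by positivity)
    have h5 := mul_le_mul_of_nonneg_right h3 (by positivity : 0 ≤ D / D₀)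
    have e2 : D₀ ^ (ℓ - 2) * (D₀ / D) * (D / D₀) = D₀ ^ (ℓ - 2) := by field_simp
    rwa [e2] at h5
  by_cases hx : x ∈ K
  · refine ⟨D₀ + 1.42 * k, by positivity, ?_, suff _ (by linarith) ?_⟩
    · have : ‖x - action K x‖ = 0 := by rw [norm_sub_action, h.piPlus_of_mem hx]; ring
      linarith
    · rw [h.fderiv_piPlus_of_mem hx, h.piPlus_of_mem hx]
      simp only [one_mul, zero_apply, zero_smul, sub_zero, hv, one_pow]
      have h1 : (D₀ + 1.42 * k) / D₀ ≤ (1 + η) * (1 + 1.21 * η) := by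
        rw [div_le_iff₀ h0]
        nlinarith [mul_nonneg hη0 h0.le, mul_nonneg (mul_nonneg hη0 hη0) h0.le]
      calc omega η * (1 - c) ^ 2 * ((D₀ + 1.42 * k) / D₀)
          ≤ ((1 + η) * (1 + 1.21 * η))⁻¹ * 1 * ((1 + η) * (1 + 1.21 * η)) := by
            gcongr
            exact omega_le_inv hη0
        _ = 1 := by field_simp
  · set n := fderiv ℝ (piPlus K) x with hn
    set τ := n v with hτ
    set b := action K x with hb
    set P := piPlus K x with hP
    have hP1 : 1 < P := (h.piPlus_of_notMem hx).2
    have hbR : ‖b‖ ≤ R := h.norm_le (h.action_mem x)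
    have hbr : r ≤ ‖b‖ := h.r_le_norm_action hx
    have hbpos : 0 < ‖b‖ := hr0.trans_le hbr
    have hΓ : ‖x - b‖ = (P - 1) * ‖b‖ := norm_sub_action x
    -- The gradient inequality for π⁺ at x, tested at m ∈ K where π⁺ = 1.
    have hPg : P - 1 ≤ k * τ + n z := by
      have h1 := h.fderiv_piPlus_sub_le hd m
      rw [h.piPlus_of_mem hm, ← neg_sub, map_neg, ← hn, hxm, map_add, map_smul, smul_eq_mul] at h1
      linarith
    have hnz : n z ≤ c * k / R := (h.fderiv_piPlus_le hd z).trans_eq hzr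
    rcases lt_or_ge τ 0 with hneg | hnn
    · -- the gauge decreases along `v`
      -- Since P > 1, the decrease k|τ| along v is at most the lateral increase n z ≤ ck/R; hence ‖τ
      -- b‖ ≤ c.
      have hτc : -τ * R ≤ c := by
        have : k * (-τ) ≤ c * k / R := by linarith
        rw [le_div_iff₀ hR0] at this
        nlinarith
      have hPu : P - 1 ≤ c * k / R := by nlinarith [mul_neg_of_pos_of_neg hpos hneg]
      have hΓ' : ‖x - b‖ ≤ k := by
        rw [hΓ]
        calc (P - 1) * ‖b‖ ≤ (c * k / R) * R := by gcongr
          _ = c * k := by field_simp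
          _ ≤ k := mul_le_of_le_one_left hpos.le hc1
      have hPη : P ≤ 1 + η := by
        have : c * k / R ≤ η := by
          rw [div_le_iff₀ hR0]
          nlinarith [mul_le_of_le_one_left hpos.le hc1, mul_le_mul_of_nonneg_left hrR hη0]
        linarith
      have hnorm : 1 - c ≤ ‖v - τ • b‖ := by
        have h1 : ‖τ • b‖ ≤ c := by
          rw [norm_smul, Real.norm_eq_abs, abs_of_neg hneg]
          exact (mul_le_mul_of_nonneg_left hbR (by linarith)).trans hτc
        have h2 := norm_sub_norm_le v (τ • b)
        rw [hv] at h2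
        linarith
      refine ⟨D₀ + 2.42 * k, by positivity, by linarith, suff _ (by linarith) ?_⟩
      -- The 2.42k is 1.42k for ‖x - m‖ plus k for ‖x - b‖, and k ≤ ηD₀/2.
      have h1 : (D₀ + 2.42 * k) / D₀ ≤ 1 + 1.21 * η := by
        rw [div_le_iff₀ h0]; nlinarith
      calc omega η * (1 - c) ^ 2 * (P * ((D₀ + 2.42 * k) / D₀))
          ≤ ((1 + η) * (1 + 1.21 * η))⁻¹ * (1 - c) ^ 2 * ((1 + η) * (1 + 1.21 * η)) := by
            gcongr
            exact omega_le_inv hη0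
        _ = (1 - c) ^ 2 := by field_simp
        _ ≤ ‖v - τ • b‖ ^ 2 := by
            have := sub_nonneg.2 hc1
            gcongr
    · -- the gauge increases along `v`
      set X := τ * ‖b‖ with hX
      have hX0 : 0 ≤ X := by positivity
      have hkη : k / r ≤ η := (div_le_iff₀ hr0).2 hr
      have hτX : k * τ ≤ η * X := by
        have : k * τ * 1 ≤ η * X := by
          rw [hX]
          calc k * τ * 1 ≤ (η * r) * τ * 1 := by gcongr
            _ ≤ (η * ‖b‖) * τ * 1 := by gcongr
            _ = _ := by ring
        linarith
      have hcR : c * k / R ≤ η := by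
        rw [div_le_iff₀ hR0]
        nlinarith [mul_le_of_le_one_left hpos.le hc1, mul_le_mul_of_nonneg_left hrR hη0]
      have hPη : P ≤ 1 + η + η * X := by linarith
      have hΓ' : ‖x - b‖ ≤ k * X + k := by
        rw [hΓ]
        calc (P - 1) * ‖b‖ ≤ (k * τ + c * k / R) * ‖b‖ := by gcongr; linarith
          _ = k * X + c * k / R * ‖b‖ := by rw [hX]; ring
          _ ≤ k * X + c * k / R * R := by gcongr
          _ = k * X + c * k := by field_simp
          _ ≤ _ := by gcongr; exact mul_le_of_le_one_left hpos.le hc1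
      -- Here ⟨v,m⟩ ≤ 0 enters: the action has only a small component along v, so subtracting τb
      -- cannot cancel v.
      have hvb : inner ℝ v b ≤ k := by
        have h1 : inner ℝ v x ≤ k := by
          have : inner ℝ v x = inner ℝ v m + k := by rw [hk, ← inner_add_right, add_sub_cancel]
          linarith
        rw [hb, action, inner_smul_right, ← hP]
        rw [inv_mul_le_iff₀ (by linarith)]
        nlinarith
      have hnorm : 1 - 2 * η * X + X ^ 2 ≤ ‖v - τ • b‖ ^ 2 := by
        rw [norm_sub_sq_real, norm_smul, inner_smul_right, hv, Real.norm_of_nonneg hnn]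
        have : τ * inner ℝ v b ≤ η * X := (mul_le_mul_of_nonneg_left hvb hnn).trans
          (by rw [mul_comm]; exact hτX)
        rw [← hX]
        linarith
      refine ⟨D₀ + (2.42 + X) * k, by positivity, by linarith, suff _ ?_ ?_⟩
      · have : 0 ≤ (2.42 + X) * k := by positivity
        linarith
      have h1 : (D₀ + (2.42 + X) * k) / D₀ ≤ 1 + 1.21 * η + η / 2 * X := by
        rw [div_le_iff₀ h0]; nlinarith
      calc omega η * (1 - c) ^ 2 * (P * ((D₀ + (2.42 + X) * k) / D₀))
          ≤ omega η * 1 * ((1 + η + η * X) * (1 + 1.21 * η + η / 2 * X)) := by gcongr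
        _ = omega η * ((1 + η + η * X) * (1 + 1.21 * η + η / 2 * X)) := by ring
        _ ≤ 1 - 2 * η * X + X ^ 2 := omega_mul_le hη0 hη hX0
        _ ≤ _ := hnorm

end Setting

end RONM

/-! ### The standard Gaussian: density, translation, contraction, moments. -/

namespace RONM

open Filter Topology RealInnerProductSpace

section Gaussian

variable {d : ℕ}

/-- The density of the standard Gaussian. -/
noncomputable def stdDensity (d : ℕ) (z : Vec d) : ℝ :=
  (2 * Real.pi) ^ (-(d : ℝ) / 2) * Real.exp (-‖z‖ ^ 2 / 2)

lemma stdDensity_pos (z : Vec d) : 0 < stdDensity d z := by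
  unfold stdDensity; positivity

@[fun_prop]
lemma measurable_stdDensity : Measurable (stdDensity d) := by
  unfold stdDensity; fun_prop

lemma integral_cexp_stdDensity (t : Vec d) :
    ∫ z : Vec d, (stdDensity d z : ℂ) * Complex.exp (inner ℝ z t * Complex.I) =
      Complex.exp (-‖t‖ ^ 2 / 2) := by
  have h := GaussianFourier.integral_cexp_neg_mul_sq_norm_add (V := Vec d) (b := 1 / 2)
    (by norm_num) Complex.I t
  have e : ∀ z : Vec d, (stdDensity d z : ℂ) * Complex.exp (inner ℝ z t * Complex.I) =
      ((2 * Real.pi) ^ (-(d : ℝ) / 2) : ℝ) *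
        Complex.exp (-(1 / 2) * ‖z‖ ^ 2 + Complex.I * inner ℝ t z) := by
    intro z
    rw [stdDensity, Complex.ofReal_mul, mul_assoc, Complex.ofReal_exp, ← Complex.exp_add,
      real_inner_comm]
    congr 2
    push_cast
    ring
  simp_rw [e]
  rw [integral_const_mul, h]
  have hp : (0 : ℝ) < 2 * Real.pi := by positivity
  have e1 : ((Real.pi : ℂ) / (1 / 2)) = ((2 * Real.pi : ℝ) : ℂ) := by push_cast; ring
  have e2 : ((Module.finrank ℝ (Vec d) : ℂ) / 2) = (((d : ℝ) / 2 : ℝ) : ℂ) := by simp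
  rw [e1, e2, ← Complex.ofReal_cpow hp.le, ← mul_assoc, ← Complex.ofReal_mul,
    ← Real.rpow_add hp, neg_div, neg_add_cancel, Real.rpow_zero, Complex.ofReal_one, one_mul]
  congr 1
  rw [Complex.I_sq]
  ring

lemma stdGaussian_eq_withDensity :
    stdGaussian (Vec d) = volume.withDensity (fun z => ENNReal.ofReal (stdDensity d z)) := by
  have hint : Integrable (stdDensity d) := by
    have h := GaussianFourier.integrable_cexp_neg_mul_sq_norm_add (V := Vec d) (b := 1 / 2)
      (by norm_num) 0 0
    have h2 := (h.norm).const_mul ((2 * Real.pi) ^ (-(d : ℝ) / 2))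
    refine h2.congr (ae_of_all _ fun z => ?_)
    simp only [Complex.norm_exp, stdDensity]
    congr 2
    simp [← Complex.ofReal_pow]
    ring
  have : IsFiniteMeasure (volume.withDensity (fun z => ENNReal.ofReal (stdDensity d z))) :=
    isFiniteMeasure_withDensity_ofReal hint.2
  apply Measure.ext_of_charFun
  ext t
  rw [charFun_stdGaussian, charFun_apply, integral_withDensity_eq_integral_toReal_smul
    (by fun_prop) (by simp), ← integral_cexp_stdDensity]
  congr 1
  ext z
  rw [ENNReal.toReal_ofReal (stdDensity_pos z).le]
  rfl

lemma lintegral_stdGaussian {F : Vec d → ENNReal} (hF : Measurable F) :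
    ∫⁻ z, F z ∂stdGaussian (Vec d) = ∫⁻ z, ENNReal.ofReal (stdDensity d z) * F z := by
  rw [stdGaussian_eq_withDensity, lintegral_withDensity_eq_lintegral_mul _ (by fun_prop) hF]
  rfl

lemma stdGaussian_absolutelyContinuous : stdGaussian (Vec d) ≪ volume := by
  rw [stdGaussian_eq_withDensity]
  exact withDensity_absolutelyContinuous _ _

/-- Translating the standard Gaussian. -/
lemma stdGaussian_map_add_right (u : Vec d) :
    (stdGaussian (Vec d)).map (fun z => z + u) = (stdGaussian (Vec d)).withDensity
      (fun z => ENNReal.ofReal (Real.exp (inner ℝ u z - ‖u‖ ^ 2 / 2))) := by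
  ext s hs
  rw [Measure.map_apply (by fun_prop) hs, withDensity_apply _ hs, ← lintegral_indicator hs,
    lintegral_stdGaussian (Measurable.indicator (by fun_prop) hs),
    ← lintegral_indicator_one ((measurable_add_const u) hs),
    lintegral_stdGaussian (measurable_one.indicator ((measurable_add_const u) hs))]
  conv_rhs => rw [← lintegral_add_right_eq_self _ u]
  refine lintegral_congr fun z => ?_
  by_cases hz : z + u ∈ s
  · rw [Set.indicator_of_mem hz, Set.indicator_of_mem (by exact hz), Pi.one_apply, mul_one,
      ← ENNReal.ofReal_mul (stdDensity_pos _).le]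
    congr 1
    rw [stdDensity, stdDensity, mul_assoc, ← Real.exp_add, norm_add_sq_real, inner_add_right,
      real_inner_self_eq_norm_sq, real_inner_comm]
    congr 2
    ring
  · rw [Set.indicator_of_notMem hz, Set.indicator_of_notMem (by exact hz)]
    simp

/-- A linear contraction loses at most its determinant. -/
lemma ofReal_det_mul_lintegral_le (D : Vec d →ₗ[ℝ] Vec d) (hD : LinearMap.det D ≠ 0)
    (hc : ∀ z, ‖D z‖ ≤ ‖z‖) {F : Vec d → ENNReal} (hF : Measurable F) :
    ENNReal.ofReal |LinearMap.det D| * ∫⁻ z, F (D z) ∂stdGaussian (Vec d) ≤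
      ∫⁻ z, F z ∂stdGaussian (Vec d) := by
  have hDm : Measurable D := D.continuous_of_finiteDimensional.measurable
  rw [lintegral_stdGaussian (F := fun z => F (D z)) (hF.comp hDm), lintegral_stdGaussian hF]
  have h1 : (volume : Measure (Vec d)) =
      ENNReal.ofReal |LinearMap.det D| • Measure.map D volume := by
    rw [Measure.map_linearMap_addHaar_eq_smul_addHaar volume hD, smul_smul,
      ← ENNReal.ofReal_mul (abs_nonneg _), ← abs_mul, mul_inv_cancel₀ hD]
    simp
  -- A contraction moves points to where the Gaussian density is at least as large; the Jacobian is
  -- the only loss.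
  calc _ ≤ ENNReal.ofReal |LinearMap.det D| *
        ∫⁻ z, ENNReal.ofReal (stdDensity d (D z)) * F (D z) := by
        gcongr with z
        rw [stdDensity, stdDensity]
        gcongr
        exact hc z
    _ = ∫⁻ z, ENNReal.ofReal (stdDensity d z) * F z ∂(ENNReal.ofReal |LinearMap.det D| •
          Measure.map D volume) := by
        rw [lintegral_smul_measure, lintegral_map (by fun_prop) hDm, smul_eq_mul]
    _ = _ := by rw [← h1]

/-- The map fixes e and scales its orthogonal complement by ρ. It is the lateral compression used
for the single-direction bound; the determinant comes from the rank-one update formula. -/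
lemma det_smul_add_rankOne {ρ : ℝ} (hρ : ρ ≠ 0) {e : Vec d} (he : ‖e‖ = 1) :
    LinearMap.det (ρ • (LinearMap.id : Vec d →ₗ[ℝ] Vec d) +
      (1 - ρ) • ((innerSL ℝ e).smulRight e : Vec d →L[ℝ] Vec d).toLinearMap) = ρ ^ (d - 1) := by
  classical
  have hd : d ≠ 0 := by
    rintro rfl
    rw [Subsingleton.elim e 0, norm_zero] at he
    exact zero_ne_one he
  rw [← LinearMap.det_toMatrix (EuclideanSpace.basisFun (Fin d) ℝ).toBasis]
  have : LinearMap.toMatrix (EuclideanSpace.basisFun (Fin d) ℝ).toBasis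
      (EuclideanSpace.basisFun (Fin d) ℝ).toBasis
      (ρ • (LinearMap.id : Vec d →ₗ[ℝ] Vec d) +
    (1 - ρ) • ((innerSL ℝ e).smulRight e : Vec d →L[ℝ] Vec d).toLinearMap) =
      ρ • (1 + Matrix.replicateCol Unit (((1 - ρ) / ρ) • e.ofLp) *
        Matrix.replicateRow Unit e.ofLp) := by
    ext i j
    rw [LinearMap.toMatrix_apply]
    simp [Matrix.mul_apply, Matrix.one_apply, PiLp.inner_apply, mul_add]
    field_simp
  rw [this, Matrix.det_smul, Matrix.det_one_add_replicateCol_mul_replicateRow]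
  have h2 : e.ofLp ⬝ᵥ (((1 - ρ) / ρ) • e.ofLp) = (1 - ρ) / ρ := by
    have := EuclideanSpace.real_norm_sq_eq e
    rw [he, one_pow] at this
    rw [dotProduct_smul, dotProduct]
    simp_rw [← sq]
    rw [← this, smul_eq_mul, mul_one]
  rw [h2, Fintype.card_fin]
  obtain ⟨k, rfl⟩ := Nat.exists_eq_succ_of_ne_zero hd
  rw [Nat.succ_sub_one, pow_succ]
  field_simp
  ring
/-- Reflection. -/
lemma lintegral_neg_stdGaussian {F : Vec d → ENNReal} (hF : Measurable F) :
    ∫⁻ z, F (-z) ∂stdGaussian (Vec d) = ∫⁻ z, F z ∂stdGaussian (Vec d) := by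
  conv_rhs => rw [← stdGaussian_map (LinearIsometryEquiv.neg ℝ (E := Vec d))]
  rw [lintegral_map hF (LinearIsometryEquiv.continuous _).measurable]
  rfl

lemma map_inner_stdGaussian {w : Vec d} (hw : ‖w‖ = 1) :
    (stdGaussian (Vec d)).map (fun z => inner ℝ w z) = gaussianReal 0 1 := by
  have := IsGaussian.map_eq_gaussianReal (μ := stdGaussian (Vec d)) (innerSL ℝ w)
  rw [integral_strongDual_stdGaussian, variance_dual_stdGaussian] at this
  simpa [hw] using this

lemma lintegral_inner_sq_stdGaussian (w : Vec d) :
    ∫⁻ z, ENNReal.ofReal (inner ℝ w z ^ 2) ∂stdGaussian (Vec d) = ENNReal.ofReal (‖w‖ ^ 2) := by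
  have h1 := variance_dual_stdGaussian (innerSL ℝ w : StrongDual ℝ (Vec d))
  have hL : MemLp (innerSL ℝ w : StrongDual ℝ (Vec d)) 2 (stdGaussian (Vec d)) :=
    IsGaussian.memLp_dual _ _ _ (by simp)
  rw [variance_of_integral_eq_zero hL.1.aemeasurable (integral_strongDual_stdGaussian _)] at h1
  have h2 := ofReal_integral_eq_lintegral_ofReal hL.integrable_sq (ae_of_all _ fun _ => sq_nonneg _)
  simp only [innerSL_apply_apply, innerSL_apply_norm] at h1 h2
  rw [← h2, h1]

lemma integrable_exp_norm_stdGaussian (c : ℝ) :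
    Integrable (fun z => Real.exp (c * ‖z‖)) (stdGaussian (Vec d)) := by
  obtain ⟨C, hC, h⟩ := IsGaussian.exists_integrable_exp_sq (stdGaussian (Vec d))
  refine (h.const_mul (Real.exp (c ^ 2 / (4 * C)))).mono' (by fun_prop) (ae_of_all _ fun z => ?_)
  rw [Real.norm_of_nonneg (Real.exp_pos _).le, ← Real.exp_add]
  gcongr
  have : 0 ≤ (c / (2 * C) - ‖z‖) ^ 2 * C := by positivity
  have e : (c / (2 * C) - ‖z‖) ^ 2 * C = c ^ 2 / (4 * C) + C * ‖z‖ ^ 2 - c * ‖z‖ := by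
    field_simp; ring
  linarith

end Gaussian

end RONM

/-! ### Smoothness of Gaussian averages and second differences. -/

namespace RONM

open Filter Topology RealInnerProductSpace

section Smoothness

variable {d : ℕ}

/-- Exponential moments of a vector-valued density depend smoothly on the parameter. -/
lemma contDiff_integral_exp (μ : Measure (Vec d)) (n : ℕ) :
    ∀ {F : Type} [NormedAddCommGroup F] [NormedSpace ℝ F] {ψ : Vec d → F},
      AEStronglyMeasurable ψ μ →
      (∀ c : ℝ, Integrable (fun z => Real.exp (c * ‖z‖) * ‖ψ z‖) μ) →
      ContDiff ℝ n (fun u : Vec d => ∫ z, Real.exp (inner ℝ u z) • ψ z ∂μ) := by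
  -- Differentiating in u replaces ψ by z ↦ ⟨z,·⟩ψ(z), which satisfies the same hypotheses because
  -- ‖z‖ ≤ exp ‖z‖. The target space changes, so the induction on n quantifies over F.
  have main : ∀ {F : Type} [NormedAddCommGroup F] [NormedSpace ℝ F] {ψ : Vec d → F},
      AEStronglyMeasurable ψ μ →
      (∀ c : ℝ, Integrable (fun z => Real.exp (c * ‖z‖) * ‖ψ z‖) μ) →
      AEStronglyMeasurable (fun z => (innerSL ℝ z).smulRight (ψ z)) μ ∧
      (∀ c : ℝ, Integrable (fun z => Real.exp (c * ‖z‖) * ‖(innerSL ℝ z).smulRight (ψ z)‖) μ) ∧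
      ∀ u₀ : Vec d, HasFDerivAt (fun u : Vec d => ∫ z, Real.exp (inner ℝ u z) • ψ z ∂μ)
        (∫ z, Real.exp (inner ℝ u₀ z) • (innerSL ℝ z).smulRight (ψ z) ∂μ) u₀ := by
    intro F _ _ ψ hψ hint
    have hm : AEStronglyMeasurable (fun z => (innerSL ℝ z).smulRight (ψ z)) μ :=
      (ContinuousLinearMap.smulRightL ℝ (Vec d) F).aestronglyMeasurable_comp₂
        (innerSL ℝ).continuous.aestronglyMeasurable hψ
    have hexpm : ∀ u : Vec d, AEStronglyMeasurable (fun z => Real.exp (inner ℝ u z)) μ := fun u =>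
      (by fun_prop : Continuous fun z : Vec d => Real.exp (inner ℝ u z)).aestronglyMeasurable
    have hnorm : ∀ z, ‖(innerSL ℝ z).smulRight (ψ z)‖ = ‖z‖ * ‖ψ z‖ := by
      intro z
      rw [ContinuousLinearMap.norm_smulRight_apply, innerSL_apply_norm]
    have hle : ∀ z : Vec d, ‖z‖ ≤ Real.exp ‖z‖ := fun z =>
      (by linarith : ‖z‖ ≤ ‖z‖ + 1).trans (Real.add_one_le_exp _)
    have hI : ∀ c : ℝ, Integrable
        (fun z => Real.exp (c * ‖z‖) * ‖(innerSL ℝ z).smulRight (ψ z)‖) μ := by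
      intro c
      refine (hint (c + 1)).mono' ((by fun_prop : Continuous fun z : Vec d => Real.exp (c * ‖z‖)).aestronglyMeasurable.mul
        hm.norm)
        (ae_of_all _ fun z => ?_)
      rw [hnorm, Real.norm_of_nonneg (by positivity), add_mul, Real.exp_add, one_mul, ← mul_assoc]
      gcongr
      exact hle z
    refine ⟨hm, hI, fun u₀ => ?_⟩
    refine hasFDerivAt_integral_of_dominated_of_fderiv_le
      (F := fun u z => Real.exp (inner ℝ u z) • ψ z)
      (F' := fun u z => Real.exp (inner ℝ u z) • (innerSL ℝ z).smulRight (ψ z))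
      (bound := fun z => Real.exp ((‖u₀‖ + 1) * ‖z‖) * ‖(innerSL ℝ z).smulRight (ψ z)‖)
      (Metric.ball_mem_nhds u₀ one_pos) ?_ ?_ ?_ ?_ (hI _) ?_
    · exact Eventually.of_forall fun u => (hexpm u).smul hψ
    · refine (hint ‖u₀‖).mono' ((hexpm u₀).smul hψ)
        (ae_of_all _ fun z => ?_)
      rw [norm_smul, Real.norm_of_nonneg (Real.exp_pos _).le]
      gcongr
      exact real_inner_le_norm _ _
    · exact (hexpm u₀).smul hm
    · refine ae_of_all _ fun z u hu => ?_
      rw [norm_smul, Real.norm_of_nonneg (Real.exp_pos _).le]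
      gcongr
      refine (real_inner_le_norm _ _).trans ?_
      gcongr
      have := norm_le_norm_add_norm_sub' u u₀
      rw [Metric.mem_ball, dist_eq_norm] at hu
      linarith
    · refine ae_of_all _ fun z u _ => ?_
      have h1 : HasFDerivAt (fun u : Vec d => inner ℝ u z) (innerSL ℝ z) u := by
        have := (innerSL ℝ z : Vec d →L[ℝ] ℝ).hasFDerivAt (x := u)
        simpa [real_inner_comm] using this
      have h2 := (h1.exp).smul_const (ψ z)
      refine h2.congr_fderiv ?_
      ext w
      simp [smul_smul]
  induction n with
  | zero =>
    intro F _ _ ψ hψ hint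
    rw [Nat.cast_zero, contDiff_zero]
    exact continuous_iff_continuousAt.2 fun u => ((main hψ hint).2.2 u).continuousAt
  | succ k ih =>
    intro F _ _ ψ hψ hint
    obtain ⟨h1, h2, h3⟩ := main hψ hint
    rw [Nat.cast_succ, contDiff_succ_iff_fderiv]
    refine ⟨fun u => (h3 u).differentiableAt, by simp, ?_⟩
    rw [show fderiv ℝ _ = _ from funext fun u => (h3 u).fderiv]
    exact ih h1 h2

/-- The second derivative as a limit of second difference quotients. -/
lemma tendsto_secondDiff {g : Vec d → ℝ} (hg : ContDiff ℝ 2 g) (m v : Vec d) :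
    Tendsto (fun t : ℝ => (g (m + t • v) + g (m - t • v) - 2 * g m) / t ^ 2) (𝓝[>] 0)
      (𝓝 (iteratedFDeriv ℝ 2 g m ![v, v])) := by
  have hdiff : Differentiable ℝ g := hg.differentiable (by norm_num)
  have hline : ∀ (σ t : ℝ), HasDerivAt (fun t : ℝ => m + (σ * t) • v) (σ • v) t := by
    intro σ t
    have := (((hasDerivAt_id t).const_mul σ).smul_const v).const_add m
    simpa using this
  have h1 : ∀ (σ t : ℝ), HasDerivAt (fun t : ℝ => g (m + (σ * t) • v))
      (σ * fderiv ℝ g (m + (σ * t) • v) v) t := by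
    intro σ t
    have := (hdiff (m + (σ * t) • v)).hasFDerivAt.comp_hasDerivAt t (hline σ t)
    simp only [map_smul, smul_eq_mul] at this
    exact this
  have h2 : ∀ t : ℝ, HasDerivAt (fun t : ℝ => g (m + t • v) + g (m - t • v) - 2 * g m)
      (fderiv ℝ g (m + t • v) v - fderiv ℝ g (m - t • v) v) t := by
    intro t
    have := ((h1 1 t).add (h1 (-1) t)).sub_const (2 * g m)
    simpa [sub_eq_add_neg] using this
  have h3 : HasDerivAt (fun t : ℝ => fderiv ℝ g (m + t • v) v - fderiv ℝ g (m - t • v) v)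
      (2 * iteratedFDeriv ℝ 2 g m ![v, v]) 0 := by
    have hd2 : Differentiable ℝ (fderiv ℝ g) :=
      (hg.fderiv_right (m := 1) (by norm_num)).differentiable (by norm_num)
    have h4 : ∀ σ : ℝ, HasDerivAt (fun t : ℝ => fderiv ℝ g (m + (σ * t) • v) v)
        (σ * iteratedFDeriv ℝ 2 g m ![v, v]) 0 := by
      intro σ
      have := (hd2 (m + (σ * 0) • v)).hasFDerivAt.comp_hasDerivAt 0 (hline σ 0)
      have := this.clm_apply (hasDerivAt_const 0 v)
      simpa [iteratedFDeriv_two_apply] using this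
    have := (h4 1).sub (h4 (-1))
    refine (this.congr_deriv (by ring)).congr_of_eventuallyEq (Eventually.of_forall fun t => ?_)
    simp [sub_eq_add_neg]
  refine HasDerivAt.lhopital_zero_nhdsGT (f' := fun t : ℝ =>
      fderiv ℝ g (m + t • v) v - fderiv ℝ g (m - t • v) v) (g' := fun t => 2 * t)
    (Eventually.of_forall h2) (Eventually.of_forall fun t => ?_) ?_ ?_ ?_ ?_
  · simpa using hasDerivAt_pow 2 t
  · filter_upwards [self_mem_nhdsWithin] with t ht
    simpa using (ne_of_gt ht)
  · have := (h2 0).continuousAt.tendsto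
    simp only [zero_smul, add_zero, sub_zero] at this
    rw [show g m + g m - 2 * g m = 0 by ring] at this
    exact this.mono_left nhdsWithin_le_nhds
  · have : Tendsto (fun t : ℝ => t ^ 2) (𝓝 0) (𝓝 (0 ^ 2)) := (continuous_pow 2).tendsto 0
    rw [zero_pow two_ne_zero] at this
    exact this.mono_left nhdsWithin_le_nhds
  · have := h3.tendsto_slope_zero_right
    simp only [zero_add, zero_smul, add_zero, sub_zero, sub_self, smul_eq_mul] at this
    have h5 := this.const_mul (1 / 2)
    rw [← mul_assoc, show (1 / 2 * 2 : ℝ) = 1 by norm_num, one_mul] at h5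
    refine h5.congr fun t => ?_
    rw [div_eq_mul_inv _ (2 * t), mul_inv]
    ring

lemma sqNorm_hessian (g : Vec d → ℝ) (m v : Vec d) :
    sqNorm (hessian g m) v = iteratedFDeriv ℝ 2 g m ![v, v] := by
  have hv : v = ∑ i, v i • EuclideanSpace.single i (1 : ℝ) := by
    have := (EuclideanSpace.basisFun (Fin d) ℝ).sum_repr v
    simpa using this.symm
  have e : iteratedFDeriv ℝ 2 g m ![v, v] = fderiv ℝ (fderiv ℝ g) m v v := by
    rw [iteratedFDeriv_two_apply]; rfl
  rw [e]
  conv_rhs => rw [hv]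
  simp only [sqNorm, hessian, dotProduct, Matrix.mulVec, Matrix.of_apply, iteratedFDeriv_two_apply]
  simp [map_sum, Finset.mul_sum, sum_apply]
  rw [Finset.sum_comm]
  refine Finset.sum_congr rfl fun i _ => Finset.sum_congr rfl fun j _ => ?_
  ring

end Smoothness

end RONM

/-! ### Square roots of covariances and the Hessian of the surrogate. -/

namespace RONM

open Filter Topology RealInnerProductSpace

section Sqrt

open scoped MatrixOrder

variable {d : ℕ}

/-- The square root of a matrix, as an operator on `ℝ^d`. -/
noncomputable def sqrtOp (S : Mat d) : Vec d →L[ℝ] Vec d :=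
  Matrix.toEuclideanCLM (𝕜 := ℝ) (CFC.sqrt S)

/-- The inverse of `sqrtOp S`. -/
noncomputable def invSqrtOp (S : Mat d) : Vec d →L[ℝ] Vec d :=
  Matrix.toEuclideanCLM (𝕜 := ℝ) (CFC.sqrt S * S⁻¹)

lemma mulV_eq (S : Mat d) (x : Vec d) : mulV S x = Matrix.toEuclideanCLM (𝕜 := ℝ) S x := rfl

lemma sqNorm_eq_inner (S : Mat d) (x : Vec d) : sqNorm S x = inner ℝ x (mulV S x) := by
  rw [sqNorm, mulV_eq, Matrix.inner_toEuclideanCLM]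

lemma sqrtOp_sqrtOp {S : Mat d} (hS : S.PosDef) (x : Vec d) :
    sqrtOp S (sqrtOp S x) = mulV S x := by
  rw [sqrtOp, ← mul_apply_eq_comp, ← map_mul,
    CFC.sqrt_mul_sqrt_self S hS.posSemidef.nonneg, mulV_eq]

lemma inner_sqrtOp (S : Mat d) (x y : Vec d) : inner ℝ (sqrtOp S x) y = inner ℝ x (sqrtOp S y) := by
  have h : IsSelfAdjoint (sqrtOp S) := (CFC.sqrt_nonneg S).isSelfAdjoint.map _
  have := ContinuousLinearMap.adjoint_inner_left (sqrtOp S) y x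
  rwa [h.adjoint_eq] at this

lemma norm_sqrtOp_sq {S : Mat d} (hS : S.PosDef) (x : Vec d) :
    ‖sqrtOp S x‖ ^ 2 = sqNorm S x := by
  rw [← real_inner_self_eq_norm_sq, inner_sqrtOp, sqrtOp_sqrtOp hS, sqNorm_eq_inner]

lemma sqrtOp_invSqrtOp {S : Mat d} (hS : S.PosDef) (x : Vec d) :
    sqrtOp S (invSqrtOp S x) = x := by
  rw [sqrtOp, invSqrtOp, ← mul_apply_eq_comp, ← map_mul, ← mul_assoc,
    CFC.sqrt_mul_sqrt_self S hS.posSemidef.nonneg,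
    Matrix.mul_nonsing_inv _ ((Matrix.isUnit_iff_isUnit_det _).1 hS.isUnit), map_one]
  rfl

lemma invSqrtOp_sqrtOp {S : Mat d} (hS : S.PosDef) (x : Vec d) :
    invSqrtOp S (sqrtOp S x) = x := by
  have hs : Function.Surjective (sqrtOp S) := fun y => ⟨_, sqrtOp_invSqrtOp hS y⟩
  have hi : Function.Injective (sqrtOp S) :=
    (LinearMap.injective_iff_surjective (f := (sqrtOp S).toLinearMap)).2 hs
  exact hi (sqrtOp_invSqrtOp hS _)

end Sqrt

section Surrogate

variable {d : ℕ}

lemma integrable_exp_mul_comp {e : Vec d → ℝ} (he : Continuous e) {C c : ℝ} (hc : 0 ≤ c)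
    (hC : ∀ x, |e x| ≤ C * Real.exp (c * ‖x‖)) (y : Vec d) (T : Vec d →L[ℝ] Vec d) (a : ℝ) :
    Integrable (fun z => Real.exp (a * ‖z‖) * ‖e (y + T z)‖) (stdGaussian (Vec d)) := by
  have hC0 : 0 ≤ C := by
    have := (abs_nonneg _).trans (hC 0)
    simpa using this
  refine ((integrable_exp_norm_stdGaussian (a + c * ‖T‖)).const_mul
    (C * Real.exp (c * ‖y‖))).mono' (by fun_prop) (ae_of_all _ fun z => ?_)
  rw [Real.norm_of_nonneg (by positivity), Real.norm_eq_abs]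
  calc Real.exp (a * ‖z‖) * |e (y + T z)|
      ≤ Real.exp (a * ‖z‖) * (C * Real.exp (c * (‖y‖ + ‖T‖ * ‖z‖))) := by
        gcongr
        refine (hC _).trans ?_
        gcongr
        exact (norm_add_le _ _).trans (by gcongr; exact T.le_opNorm z)
    _ = _ := by
        rw [mul_add, Real.exp_add, add_mul, Real.exp_add, mul_assoc c]; ring

lemma integrable_comp_affine {e : Vec d → ℝ} (he : Continuous e) {C c : ℝ} (hc : 0 ≤ c)
    (hC : ∀ x, |e x| ≤ C * Real.exp (c * ‖x‖)) (y : Vec d) (T : Vec d →L[ℝ] Vec d) :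
    Integrable (fun z => e (y + T z)) (stdGaussian (Vec d)) := by
  have := integrable_exp_mul_comp he hc hC y T 0
  simp only [zero_mul, Real.exp_zero, one_mul] at this
  exact (integrable_norm_iff (by fun_prop)).1 this

lemma surrogate_eq {e : Vec d → ℝ} (he : Continuous e) {C c : ℝ} (hc : 0 ≤ c)
    (hC : ∀ x, |e x| ≤ C * Real.exp (c * ‖x‖)) (lam : ℝ) (m : Vec d) (S : Mat d) (x : Vec d) :
    surrogate e lam m S x = (1 - 1 / lam) * ∫ z, e (m + sqrtOp S z) ∂stdGaussian (Vec d) +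
      1 / lam * ∫ z, e (((1 - lam) • m + lam • x) + (1 - lam) • sqrtOp S z)
        ∂stdGaussian (Vec d) := by
  rw [surrogate, multivariateGaussian, integral_map (by fun_prop) (by fun_prop),
    ← integral_const_mul, ← integral_const_mul, ← integral_add]
  · refine integral_congr_ae (ae_of_all _ fun z => ?_)
    have : (1 - lam) • (m + sqrtOp S z) + lam • x =
        ((1 - lam) • m + lam • x) + (1 - lam) • sqrtOp S z := by module
    simp only [← this]
    rfl
  · exact (integrable_comp_affine he hc hC m (sqrtOp S)).const_mul _
  · exact (integrable_comp_affine he hc hC _ ((1 - lam) • sqrtOp S)).const_mul _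

/-- All smoothness comes from the Gaussian. As λ < 1 and S is invertible, a shift of x is a shift of
the Gaussian variable; moved into the density, it leaves x only inside an exponential weight. -/
lemma contDiff_surrogate {e : Vec d → ℝ} (he : Continuous e) {C c : ℝ} (hc : 0 ≤ c)
    (hC : ∀ x, |e x| ≤ C * Real.exp (c * ‖x‖)) {lam : ℝ} (h1 : lam < 1)
    (m : Vec d) {S : Mat d} (hS : S.PosDef) :
    ContDiff ℝ 2 (surrogate e lam m S) := by
  have h1' : 1 - lam ≠ 0 := (sub_pos.2 h1).ne'
  set γ := stdGaussian (Vec d)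
  set h : Vec d → ℝ := fun z => e (m + ((1 - lam) • sqrtOp S) z) with hh
  set U : Vec d →L[ℝ] Vec d := (lam / (1 - lam)) • invSqrtOp S
  have key : ∀ x, surrogate e lam m S x = (1 - 1 / lam) * ∫ z, e (m + sqrtOp S z) ∂γ +
      1 / lam * (Real.exp (-‖U (x - m)‖ ^ 2 / 2) *
        ∫ z, Real.exp (inner ℝ (U (x - m)) z) • h z ∂γ) := by
    intro x
    rw [surrogate_eq he hc hC]
    congr 2
    have e1 : ∀ z, e (((1 - lam) • m + lam • x) + (1 - lam) • sqrtOp S z) =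
        h (z + U (x - m)) := by
      intro z
      simp only [hh, U, smul_apply, map_add, map_smul, sqrtOp_invSqrtOp hS, smul_smul, smul_add]
      congr 1
      rw [mul_div_cancel₀ _ h1']
      module
    simp_rw [e1]
    have hcont : Continuous h := by fun_prop
    rw [← integral_map (φ := fun z => z + U (x - m)) (f := h) (by fun_prop)
      hcont.aestronglyMeasurable,
      stdGaussian_map_add_right, integral_withDensity_eq_integral_toReal_smul (by fun_prop)
      (by simp), ← integral_const_mul]
    refine integral_congr_ae (ae_of_all _ fun z => ?_)
    simp only [smul_eq_mul]
    rw [ENNReal.toReal_ofReal (Real.exp_pos _).le, ← mul_assoc, ← Real.exp_add]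
    ring_nf
  rw [funext key]
  have hΨ := contDiff_integral_exp γ 2 (ψ := h) (by fun_prop)
    (integrable_exp_mul_comp he hc hC m ((1 - lam) • sqrtOp S))
  have hU : ContDiff ℝ 2 fun x : Vec d => U (x - m) := by fun_prop
  refine contDiff_const.add (contDiff_const.mul (ContDiff.mul ?_ (hΨ.comp hU)))
  exact ((hU.norm_sq ℝ).neg.div_const 2).exp

end Surrogate

namespace Setting

variable {d : ℕ} {K : Set (Vec d)} {r R : ℝ} {f : Vec d → ℝ} {G : ℝ} {xs : Vec d} {β ℓ : ℝ}
  (h : Setting K r R f G xs β ℓ)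
include h

lemma abs_extension_le_exp (x : Vec d) :
    |extension K f G R x| ≤ (1 + G * R) * Real.exp (r⁻¹ * ‖x‖) := by
  refine (h.abs_extension_le x).trans ?_
  have := mul_nonneg h.G_nonneg h.R_pos.le
  gcongr
  rw [add_comm, div_eq_inv_mul]
  exact Real.add_one_le_exp _

lemma extension_secondDiff_nonneg (x v : Vec d) :
    0 ≤ extension K f G R (x + v) + extension K f G R (x - v) - 2 * extension K f G R x := by
  have := h.extension_secondDiff (M := max ‖action K (x + v) - xs‖ ‖action K (x - v) - xs‖)
    (y := x + v) (z := x - v) (le_max_left _ _) (le_max_right _ _)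
  rw [show (1 / 2 : ℝ) • (x + v + (x - v)) = x by module] at this
  refine le_trans ?_ this
  have := h.beta_pos
  have := h.one_lt
  have := piPlus_pos (K := K) (x + v)
  have := piPlus_pos (K := K) (x - v)
  have : 0 ≤ max ‖action K (x + v) - xs‖ ‖action K (x - v) - xs‖ := le_max_of_le_left (norm_nonneg _)
  have : 0 < ℓ * (ℓ - 1) := mul_pos (by linarith) (by linarith)
  positivity

/-- Rademacher's theorem, pulled back through an invertible affine map. -/
lemma ae_differentiableAt_piPlus (m : Vec d) {S : Mat d} (hS : S.PosDef) {a : ℝ} (ha : a ≠ 0) :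
    ∀ᵐ z ∂stdGaussian (Vec d), DifferentiableAt ℝ (piPlus K) (m + a • sqrtOp S z) := by
  refine stdGaussian_absolutelyContinuous.ae_le (?_ : ∀ᵐ z ∂(volume : Measure (Vec d)),
    DifferentiableAt ℝ (piPlus K) (m + a • sqrtOp S z))
  have h1 := h.piPlus_lipschitz.ae_differentiableAt (μ := (volume : Measure (Vec d)))
  have hdet : LinearMap.det (a • sqrtOp S).toLinearMap ≠ 0 := by
    have : LinearMap.det ((a • sqrtOp S).toLinearMap ∘ₗ (a⁻¹ • invSqrtOp S).toLinearMap) = 1 := by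
      rw [show (a • sqrtOp S).toLinearMap ∘ₗ (a⁻¹ • invSqrtOp S).toLinearMap = LinearMap.id from ?_,
        LinearMap.det_id]
      ext1 x
      simp [sqrtOp_invSqrtOp hS, smul_smul, mul_inv_cancel₀ ha]
    rw [LinearMap.det_comp] at this
    exact left_ne_zero_of_mul_eq_one this
  rw [ae_iff] at h1 ⊢
  have h2 : volume ((fun y : Vec d => m + y) ⁻¹' {x | ¬DifferentiableAt ℝ (piPlus K) x}) = 0 := by
    rwa [measure_preimage_add]
  have h3 := Measure.addHaar_preimage_linearMap (volume : Measure (Vec d)) hdet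
    ((fun y : Vec d => m + y) ⁻¹' {x | ¬DifferentiableAt ℝ (piPlus K) x})
  rw [h2, mul_zero] at h3
  exact h3

/-- The term in e(X) does not depend on x and cancels. The prefactor 1/λ together with the step λt
leaves a factor λ. -/
lemma surrogate_secondDiff {lam : ℝ} (h0 : 0 < lam) (m : Vec d) (S : Mat d) (v : Vec d) (t : ℝ) :
    Integrable (fun z => (extension K f G R (m + (1 - lam) • sqrtOp S z + (lam * t) • v) +
        extension K f G R (m + (1 - lam) • sqrtOp S z - (lam * t) • v) -
        2 * extension K f G R (m + (1 - lam) • sqrtOp S z)) / (lam * t) ^ 2)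
        (stdGaussian (Vec d)) ∧
    (surrogate (extension K f G R) lam m S (m + t • v) +
      surrogate (extension K f G R) lam m S (m - t • v) -
      2 * surrogate (extension K f G R) lam m S m) / t ^ 2 =
    lam * ∫ z, (extension K f G R (m + (1 - lam) • sqrtOp S z + (lam * t) • v) +
        extension K f G R (m + (1 - lam) • sqrtOp S z - (lam * t) • v) -
        2 * extension K f G R (m + (1 - lam) • sqrtOp S z)) / (lam * t) ^ 2
        ∂stdGaussian (Vec d) := by
  set e := extension K f G R
  have hc : (0 : ℝ) ≤ r⁻¹ := (inv_pos.2 h.r_pos).le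
  have hI : ∀ y : Vec d, Integrable (fun z => e (y + (1 - lam) • sqrtOp S z))
      (stdGaussian (Vec d)) := fun y =>
    integrable_comp_affine h.continuous_extension hc h.abs_extension_le_exp y
      ((1 - lam) • sqrtOp S)
  have e1 : ∀ z, m + (1 - lam) • sqrtOp S z + (lam * t) • v =
      ((1 - lam) • m + lam • (m + t • v)) + (1 - lam) • sqrtOp S z := fun z => by module
  have e2 : ∀ z, m + (1 - lam) • sqrtOp S z - (lam * t) • v =
      ((1 - lam) • m + lam • (m - t • v)) + (1 - lam) • sqrtOp S z := fun z => by module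
  have e3 : m = (1 - lam) • m + lam • m := by module
  simp_rw [e1, e2]
  have i1 := hI ((1 - lam) • m + lam • (m + t • v))
  have i2 := hI ((1 - lam) • m + lam • (m - t • v))
  have i3 := hI m
  refine ⟨((i1.add i2).sub (i3.const_mul 2)).div_const _, ?_⟩
  have a1 := integral_sub (i1.add i2) (i3.const_mul 2)
  simp only [Pi.add_apply] at a1
  rw [integral_div, a1, integral_add i1 i2, integral_const_mul]
  have hs := surrogate_eq h.continuous_extension hc h.abs_extension_le_exp lam m S
  rw [hs (m + t • v), hs (m - t • v), hs m, ← e3]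
  by_cases ht : t = 0
  · simp [ht]
  field_simp
  ring

/-- The Hessian is the limit of averaged second differences of e, which are nonnegative by
convexity; Fatou's lemma moves the limit inside. `Lf` may be any pointwise minorant of the
curvature, with the radius D chosen separately at each x. -/
lemma hessian_nonneg_and_lintegral_le {lam : ℝ} (h0 : 0 < lam) (h1 : lam < 1) (m : Vec d) {S : Mat d}
    (hS : S.PosDef) (v : Vec d) :
    0 ≤ sqNorm (hessian (surrogate (extension K f G R) lam m S) m) v ∧
    ∀ Lf : Vec d → ENNReal, (∀ x, DifferentiableAt ℝ (piPlus K) x → ∃ D, 0 < D ∧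
      ‖action K x - xs‖ ≤ D ∧
      Lf x ≤ ENNReal.ofReal (D ^ (ℓ - 2) / piPlus K x *
        ‖v - fderiv ℝ (piPlus K) x v • action K x‖ ^ 2)) →
    ENNReal.ofReal (lam * (β * (ℓ * (ℓ - 1)))) *
        ∫⁻ z, Lf (m + (1 - lam) • sqrtOp S z) ∂stdGaussian (Vec d) ≤
      ENNReal.ofReal (sqNorm (hessian (surrogate (extension K f G R) lam m S) m) v) := by
  set e := extension K f G R with he
  set s := surrogate e lam m S with hs
  rw [sqNorm_hessian]
  have hs2 : ContDiff ℝ 2 s := contDiff_surrogate h.continuous_extension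
    (inv_pos.2 h.r_pos).le h.abs_extension_le_exp h1 m hS
  set u : ℕ → ℝ := fun n => 1 / ((n : ℝ) + 1)
  have hu0 : ∀ n, 0 < u n := fun n => by positivity
  have hu : Tendsto u atTop (𝓝[>] 0) :=
    tendsto_nhdsWithin_iff.2 ⟨tendsto_one_div_add_atTop_nhds_zero_nat,
      Eventually.of_forall hu0⟩
  have hlim := (tendsto_secondDiff hs2 m v).comp hu
  have hnn : ∀ x t, 0 ≤ (e (x + t • v) + e (x - t • v) - 2 * e x) / t ^ 2 := fun x t =>
    div_nonneg (h.extension_secondDiff_nonneg x _) (sq_nonneg _)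
  refine ⟨ge_of_tendsto' hlim fun n => ?_, fun Lf hL => ?_⟩
  · rw [Function.comp_apply, (h.surrogate_secondDiff h0 m S v (u n)).2]
    exact mul_nonneg h0.le (integral_nonneg fun z => hnn _ _)
  set q : ℕ → Vec d → ENNReal := fun n z => ENNReal.ofReal
    ((e (m + (1 - lam) • sqrtOp S z + (lam * u n) • v) +
        e (m + (1 - lam) • sqrtOp S z - (lam * u n) • v) -
        2 * e (m + (1 - lam) • sqrtOp S z)) / (lam * u n) ^ 2) with hq
  have hqm : ∀ n, Measurable (q n) := by
    intro n
    have := h.continuous_extension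
    refine ENNReal.measurable_ofReal.comp (Continuous.measurable ?_)
    fun_prop
  have hqi : ∀ n, ENNReal.ofReal ((s (m + u n • v) + s (m - u n • v) - 2 * s m) / u n ^ 2) =
      ENNReal.ofReal lam * ∫⁻ z, q n z ∂stdGaussian (Vec d) := by
    intro n
    have h2 := h.surrogate_secondDiff h0 m S v (u n)
    rw [h2.2, ENNReal.ofReal_mul h0.le,
      ofReal_integral_eq_lintegral_ofReal h2.1 (ae_of_all _ fun z => hnn _ _)]
  have hlim2 : Tendsto (fun n => ENNReal.ofReal lam * ∫⁻ z, q n z ∂stdGaussian (Vec d)) atTop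
      (𝓝 (ENNReal.ofReal (iteratedFDeriv ℝ 2 s m ![v, v]))) := by
    have := (ENNReal.continuous_ofReal.tendsto _).comp hlim
    refine this.congr fun n => ?_
    rw [← hqi]
    rfl
  have hlu : Tendsto (fun n => lam * u n) atTop (𝓝[≠] 0) := by
    refine tendsto_nhdsWithin_iff.2 ⟨?_, Eventually.of_forall fun n => (mul_pos h0 (hu0 n)).ne'⟩
    have := (tendsto_nhdsWithin_iff.1 hu).1.const_mul lam
    rwa [mul_zero] at this
  have hβ : 0 ≤ β * (ℓ * (ℓ - 1)) := by
    have := h.beta_pos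
    have := h.one_lt
    have : 0 < ℓ * (ℓ - 1) := mul_pos (by linarith) (by linarith)
    positivity
  calc _ = ENNReal.ofReal lam * ∫⁻ z, ENNReal.ofReal (β * (ℓ * (ℓ - 1))) *
        Lf (m + (1 - lam) • sqrtOp S z) ∂stdGaussian (Vec d) := by
        rw [lintegral_const_mul' _ _ ENNReal.ofReal_ne_top, ENNReal.ofReal_mul h0.le, mul_assoc]
    _ ≤ ENNReal.ofReal lam * ∫⁻ z, liminf (fun n => q n z) atTop ∂stdGaussian (Vec d) := by
        refine mul_le_mul_right (lintegral_mono_ae ?_) _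
        filter_upwards [h.ae_differentiableAt_piPlus m hS (sub_pos.2 h1).ne'] with z hz
        obtain ⟨D, hD, hxD, hLD⟩ := hL _ hz
        refine le_trans ?_ (h.le_liminf_secondDiff hz v hD hxD hlu)
        rw [ENNReal.ofReal_mul hβ]
        exact mul_le_mul_right hLD _
    _ ≤ ENNReal.ofReal lam * liminf (fun n => ∫⁻ z, q n z ∂stdGaussian (Vec d)) atTop := by
        exact mul_le_mul_right (lintegral_liminf_le hqm) _
    _ ≤ _ := by
        have hl : ENNReal.ofReal lam ≠ 0 := by simpa using h0
        have h3 := ENNReal.Tendsto.const_mul (a := (ENNReal.ofReal lam)⁻¹) hlim2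
          (Or.inr (ENNReal.inv_ne_top.2 hl))
        simp only [← mul_assoc, ENNReal.inv_mul_cancel hl ENNReal.ofReal_ne_top, one_mul] at h3
        rw [h3.liminf_eq, ← mul_assoc, ENNReal.mul_inv_cancel hl ENNReal.ofReal_ne_top, one_mul]

end Setting

end RONM

/-! ### Hessian bounds for the first round and for orthogonal pairs. -/

namespace RONM

open Filter Topology RealInnerProductSpace

section Moments

variable {d : ℕ}

lemma lintegral_norm_sq_clm (T : Vec d →L[ℝ] Vec d) (hT : ∀ x y, inner ℝ (T x) y = inner ℝ x (T y)) :
    ∫⁻ z, ENNReal.ofReal (‖T z‖ ^ 2) ∂stdGaussian (Vec d) =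
      ENNReal.ofReal (∑ i, ‖T (EuclideanSpace.single i 1)‖ ^ 2) := by
  have h1 : ∀ z, ENNReal.ofReal (‖T z‖ ^ 2) =
      ∑ i, ENNReal.ofReal (inner ℝ (T (EuclideanSpace.single i 1)) z ^ 2) := by
    intro z
    rw [← ENNReal.ofReal_sum_of_nonneg fun _ _ => sq_nonneg _, EuclideanSpace.real_norm_sq_eq]
    congr 1
    refine Finset.sum_congr rfl fun i _ => ?_
    rw [hT, EuclideanSpace.inner_single_left]
    simp
  simp_rw [h1]
  rw [lintegral_finsetSum _ fun i _ => by fun_prop,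
    ENNReal.ofReal_sum_of_nonneg fun _ _ => sq_nonneg _]
  exact Finset.sum_congr rfl fun i _ => lintegral_inner_sq_stdGaussian _

lemma lintegral_norm_sq :
    ∫⁻ z, ENNReal.ofReal (‖z‖ ^ 2) ∂stdGaussian (Vec d) = ENNReal.ofReal d := by
  have := lintegral_norm_sq_clm (ContinuousLinearMap.id ℝ (Vec d)) (fun _ _ => rfl)
  simpa using this

lemma lintegral_norm_sqrtOp_sq {S : Mat d} (hS : S.PosDef) :
    ∫⁻ z, ENNReal.ofReal (‖sqrtOp S z‖ ^ 2) ∂stdGaussian (Vec d) = ENNReal.ofReal S.trace := by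
  rw [lintegral_norm_sq_clm _ (inner_sqrtOp S)]
  congr 1
  refine Finset.sum_congr rfl fun i _ => ?_
  rw [norm_sqrtOp_sq hS, sqNorm]
  simp [Matrix.mulVec, dotProduct]

/-- From an integral estimate to a real one. -/
lemma mul_sub_le_of_lintegral {γ : Measure (Vec d)} {Lf : Vec d → ENNReal} {c H J q : ℝ}
    (hc : 0 ≤ c) (hH : 0 ≤ H) (hq : 0 ≤ q)
    (h1 : ENNReal.ofReal c * ∫⁻ z, Lf z ∂γ ≤ ENNReal.ofReal H)
    (h2 : ENNReal.ofReal J ≤ ∫⁻ z, Lf z ∂γ + ENNReal.ofReal q) : c * (J - q) ≤ H := by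
  have h3 : ENNReal.ofReal (c * J) ≤ ENNReal.ofReal (H + c * q) := by
    rw [ENNReal.ofReal_mul hc, ENNReal.ofReal_add hH (by positivity), ENNReal.ofReal_mul hc]
    calc _ ≤ ENNReal.ofReal c * (∫⁻ z, Lf z ∂γ + ENNReal.ofReal q) := mul_le_mul_right h2 _
      _ = ENNReal.ofReal c * ∫⁻ z, Lf z ∂γ + ENNReal.ofReal c * ENNReal.ofReal q := mul_add _ _ _
      _ ≤ _ := by gcongr
  have := (ENNReal.ofReal_le_ofReal_iff (by positivity)).1 h3
  linarith

/-- Up to rounding, the bracket is the tangent to (1+q)^(-2), as a function of q², at q² = 1/50.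
This is the largest mean of q² = ‖z‖²/(5d)² when d ≥ 2. -/
lemma tangent_bound {q : ℝ} (hq : 0 ≤ q) : (0.861 - 4.75 * q ^ 2) * (1 + q) ^ 2 ≤ 1 := by
  nlinarith [mul_nonneg hq (sq_nonneg (q - 0.1414)), sq_nonneg (q - 0.1414),
    sq_nonneg (q * (q - 0.1414))]

end Moments

namespace Setting

variable {d : ℕ} {K : Set (Vec d)} {r R : ℝ} {f : Vec d → ℝ} {G : ℝ} {xs : Vec d} {β ℓ : ℝ}
  (h : Setting K r R f G xs β ℓ)
include h

lemma curv_const_pos : 0 < β * (ℓ * (ℓ - 1)) := by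
  have := h.one_lt
  exact mul_pos h.beta_pos (mul_pos (by linarith) (by linarith))

/-- Curvature of the surrogate in the first round. -/
lemma hessian_ge_of_mean_zero {lam : ℝ} (h0 : 0 < lam) (h1 : lam < 1) {S : Mat d} (hS : S.PosDef)
    {v : Vec d} (hv : ‖v‖ = 1) {s D₀ : ℝ} (hs : 0 < s) (hSs : ∀ x, sqNorm S x ≤ s ^ 2 * ‖x‖ ^ 2)
    (hr : 5 * d * (Real.sqrt 2 * s) ≤ r) (hD : 10 * d * s ≤ D₀) (hxs : ‖xs‖ ≤ D₀) :
    0.875 * (lam * (β * (ℓ * (ℓ - 1))) * D₀ ^ (ℓ - 2)) ≤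
      sqNorm (hessian (surrogate (extension K f G R) lam 0 S) 0) v := by
  obtain ⟨hnn, hL⟩ := h.hessian_nonneg_and_lintegral_le h0 h1 0 hS v
  have hd : (1 : ℝ) ≤ d := by exact_mod_cast h.one_le
  have hD0 : 0 < D₀ := by
    have : 0 < 10 * d * s := by positivity
    linarith
  set U := D₀ ^ (ℓ - 2) with hU
  have hU0 : 0 < U := by positivity
  have hr2 : 50 * (d : ℝ) ^ 2 * s ^ 2 ≤ r ^ 2 := by
    have := pow_le_pow_left₀ (by positivity) hr 2
    have e : (5 * (d : ℝ) * (Real.sqrt 2 * s)) ^ 2 = 50 * (d : ℝ) ^ 2 * s ^ 2 := by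
      rw [mul_pow, mul_pow, mul_pow, Real.sq_sqrt (by norm_num)]; ring
    rwa [e] at this
  -- Everything outside the ball of radius r is discarded; inside it the point lies in K and no
  -- curvature is lost.
  specialize hL (fun x => if ‖x‖ ≤ r then ENNReal.ofReal (U * (D₀ / (D₀ + ‖x‖))) else 0) ?_
  · intro x _
    refine ⟨D₀ + ‖x‖, by positivity, ?_, ?_⟩
    · by_cases hx : ‖x‖ ≤ r
      · have hxK : x ∈ K := h.ball_subset (by simpa using hx)
        rw [action, h.piPlus_of_mem hxK, inv_one, one_smul]
        exact (norm_sub_le _ _).trans (by linarith)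
      · have h2 : ‖action K x‖ ≤ ‖x‖ := by
          rw [action, norm_smul, norm_inv, Real.norm_of_nonneg (piPlus_pos x).le]
          exact inv_mul_le_of_le_mul₀ (piPlus_pos x).le (norm_nonneg _)
            (le_mul_of_one_le_left (norm_nonneg _) (one_le_piPlus x))
        exact (norm_sub_le _ _).trans (by linarith)
    · by_cases hx : ‖x‖ ≤ r
      · rw [if_pos hx]
        exact ENNReal.ofReal_le_ofReal (h.curvature_of_mem (h.ball_subset (by simpa using hx)) hv
          hD0 (by linarith [norm_nonneg x]))
      · rw [if_neg hx]; exact zero_le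
  have key := mul_sub_le_of_lintegral (J := U * 0.9) (q := U * 0.025)
    (mul_pos h0 h.curv_const_pos).le hnn (by positivity) hL ?_
  · refine le_of_eq_of_le ?_ key; ring
  have hpt : ∀ z : Vec d, ENNReal.ofReal (U * 0.9) ≤
      (if ‖(0 : Vec d) + (1 - lam) • sqrtOp S z‖ ≤ r then
        ENNReal.ofReal (U * (D₀ / (D₀ + ‖(0 : Vec d) + (1 - lam) • sqrtOp S z‖))) else 0) +
      ENNReal.ofReal (U * (2.5 / (100 * d ^ 2))) * ENNReal.ofReal (‖z‖ ^ 2) := by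
    intro z
    set w := ‖(0 : Vec d) + (1 - lam) • sqrtOp S z‖ with hw
    have hw0 : 0 ≤ w := norm_nonneg _
    have hws : w ≤ s * ‖z‖ := by
      refine abs_le_of_sq_le_sq' ?_ (by positivity) |>.2
      rw [hw, zero_add, norm_smul, mul_pow, norm_sqrtOp_sq hS, Real.norm_of_nonneg (by linarith),
        mul_pow]
      refine le_trans (mul_le_of_le_one_left ?_ (by nlinarith)) (hSs z)
      rw [← norm_sqrtOp_sq hS]; positivity
    rw [← ENNReal.ofReal_mul (by positivity)]
    set t := ‖z‖ / (10 * d) with ht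
    have ht0 : 0 ≤ t := by positivity
    have e : U * (2.5 / (100 * d ^ 2)) * ‖z‖ ^ 2 = U * (2.5 * t ^ 2) := by
      rw [ht]; field_simp; ring
    rw [e]
    split_ifs with hwr
    · rw [← ENNReal.ofReal_add (by positivity) (by positivity)]
      refine ENNReal.ofReal_le_ofReal ?_
      rw [← mul_add]
      refine mul_le_mul_of_nonneg_left ?_ hU0.le
      have h3 : w ≤ t * D₀ := by
        have : s * ‖z‖ = t * (10 * d * s) := by rw [ht]; field_simp
        rw [this] at hws
        exact hws.trans (by gcongr)
      have h4 : 1 / (1 + t) ≤ D₀ / (D₀ + w) := by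
        rw [div_le_div_iff₀ (by positivity) (by positivity)]; linarith
      have h5 : 0.9 - 2.5 * t ^ 2 ≤ 1 / (1 + t) := by
        rw [le_div_iff₀ (by positivity)]
        nlinarith [mul_nonneg ht0 (sq_nonneg (t - 0.25)), sq_nonneg (t - 0.2)]
      linarith
    · rw [zero_add]
      refine ENNReal.ofReal_le_ofReal (mul_le_mul_of_nonneg_left ?_ hU0.le)
      have h3 : r < s * ‖z‖ := (not_le.1 hwr).trans_le hws
      have h4 : 50 * (d : ℝ) ^ 2 * s ^ 2 ≤ (s * ‖z‖) ^ 2 :=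
        hr2.trans (pow_le_pow_left₀ h.r_pos.le h3.le 2)
      have h5 : 50 * (d : ℝ) ^ 2 ≤ ‖z‖ ^ 2 := by
        have : 0 < s ^ 2 := by positivity
        rw [mul_pow, mul_comm (s ^ 2)] at h4
        exact le_of_mul_le_mul_right h4 this
      -- Leaving the ball forces t² ≥ 1/2, where the penalty 2.5t² already exceeds 0.9. The √2 in
      -- `hr` is what gives 50 instead of 25 here.
      have h6 : 0.5 ≤ t ^ 2 := by
        rw [ht, div_pow, le_div_iff₀ (by positivity)]; linarith
      linarith
  have hI := lintegral_mono hpt (μ := stdGaussian (Vec d))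
  rw [lintegral_const, measure_univ, mul_one, lintegral_add_right _ (by fun_prop),
    lintegral_const_mul _ (by fun_prop), lintegral_norm_sq] at hI
  refine hI.trans (add_le_add_right ?_ _)
  rw [← ENNReal.ofReal_mul (by positivity)]
  refine ENNReal.ofReal_le_ofReal ?_
  rw [mul_assoc]
  refine mul_le_mul_of_nonneg_left ?_ hU0.le
  rw [div_mul_eq_mul_div, div_le_iff₀ (by positivity)]
  nlinarith

set_option maxHeartbeats 400000 in
/-- Curvature of the surrogate in a pair of orthogonal directions. -/
lemma hessian_add_ge {lam : ℝ} (h0 : 0 < lam) (h1 : lam < 1) (hd2 : 2 ≤ d) {m : Vec d} (hm : m ∈ K)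
    {S : Mat d} (hS : S.PosDef) {v w : Vec d} (hv : ‖v‖ = 1) (hw : ‖w‖ = 1)
    (hvw : inner ℝ v w = 0) {s D₀ : ℝ} (hs : 0 < s) (hSs : ∀ x, sqNorm S x ≤ s ^ 2 * ‖x‖ ^ 2)
    (hr : 5 * d * s ≤ r) (hD : 10 * d * s ≤ D₀) (hxs : ‖m - xs‖ ≤ D₀) :
    0.765 * (lam * (β * (ℓ * (ℓ - 1))) * D₀ ^ (ℓ - 2)) * (r / R) ^ (2 - ℓ) ≤
      sqNorm (hessian (surrogate (extension K f G R) lam m S) m) v +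
      sqNorm (hessian (surrogate (extension K f G R) lam m S) m) w := by
  have hr0 := h.r_pos
  have hR0 := h.R_pos
  have hd : (2 : ℝ) ≤ d := by exact_mod_cast hd2
  have hD0 : 0 < D₀ := by
    have : 0 < 10 * d * s := by positivity
    linarith
  -- A radius valid at every x and for both directions; its factor R/r is the source of (r/R)^(2-ℓ).
  set D : Vec d → ℝ := fun x => R / r * (D₀ + 2 * ‖x - m‖) with hDdef
  have hDpos : ∀ x, 0 < D x := fun x => by positivity
  set Lf : Vec d → Vec d → ENNReal := fun v x => ENNReal.ofReal
    (D x ^ (ℓ - 2) / piPlus K x * ‖v - fderiv ℝ (piPlus K) x v • action K x‖ ^ 2) with hLf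
  have hmeas : ∀ v, Measurable (Lf v) := by
    intro v
    have a1 := h.continuous_piPlus.measurable
    have a2 := h.continuous_action.measurable
    have a3 := measurable_fderiv_apply_const ℝ (piPlus K) v
    have a4 : Measurable D := by fun_prop
    refine ENNReal.measurable_ofReal.comp ?_
    exact ((a4.pow_const _).div a1).mul ((measurable_const.sub (a3.smul a2)).norm.pow_const 2)
  have hmap : Measurable fun z => m + (1 - lam) • sqrtOp S z := by fun_prop
  obtain ⟨hnv, hLv⟩ := h.hessian_nonneg_and_lintegral_le h0 h1 m hS v
  obtain ⟨hnw, hLw⟩ := h.hessian_nonneg_and_lintegral_le h0 h1 m hS w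
  have hsum := add_le_add
    (hLv (Lf v) fun x _ => ⟨D x, hDpos x, h.norm_action_sub_le hm hxs x, le_rfl⟩)
    (hLw (Lf w) fun x _ => ⟨D x, hDpos x, h.norm_action_sub_le hm hxs x, le_rfl⟩)
  rw [← mul_add, ← ENNReal.ofReal_add hnv hnw,
    ← lintegral_add_left (f := fun z => Lf v (m + (1 - lam) • sqrtOp S z))
      ((hmeas v).comp hmap)] at hsum
  set U := (R / r * D₀) ^ (ℓ - 2) with hU
  have hU0 : 0 < U := by positivity
  have eU : U = D₀ ^ (ℓ - 2) * (r / R) ^ (2 - ℓ) := by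
    rw [hU, Real.mul_rpow (by positivity) hD0.le, mul_comm, ← inv_div r R,
      Real.inv_rpow (by positivity), ← Real.rpow_neg (by positivity), neg_sub]
  have key := mul_sub_le_of_lintegral (J := U * 0.861) (q := U * (4.75 / 50))
    (mul_pos h0 h.curv_const_pos).le (add_nonneg hnv hnw) (by positivity) hsum ?_
  · refine le_trans ?_ key
    rw [eU, ← sub_nonneg]
    have : 0 ≤ lam * (β * (ℓ * (ℓ - 1))) * D₀ ^ (ℓ - 2) * (r / R) ^ (2 - ℓ) := by
      have := h.curv_const_pos
      positivity
    linarith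
  have hpt : ∀ z : Vec d, ENNReal.ofReal (U * 0.861) ≤
      (Lf v (m + (1 - lam) • sqrtOp S z) + Lf w (m + (1 - lam) • sqrtOp S z)) +
      ENNReal.ofReal (U * (4.75 / (25 * d ^ 2))) * ENNReal.ofReal (‖z‖ ^ 2) := by
    intro z
    set x := m + (1 - lam) • sqrtOp S z with hx
    have hws : ‖x - m‖ ≤ s * ‖z‖ := by
      refine abs_le_of_sq_le_sq' ?_ (by positivity) |>.2
      rw [hx, add_sub_cancel_left, norm_smul, mul_pow, norm_sqrtOp_sq hS,
        Real.norm_of_nonneg (by linarith), mul_pow]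
      refine le_trans (mul_le_of_le_one_left ?_ (by nlinarith)) (hSs z)
      rw [← norm_sqrtOp_sq hS]; positivity
    set q := ‖z‖ / (5 * d) with hq
    have hq0 : 0 ≤ q := by positivity
    have e : U * (4.75 / (25 * d ^ 2)) * ‖z‖ ^ 2 = U * (4.75 * q ^ 2) := by
      rw [hq]; field_simp; ring
    have hzq : s * ‖z‖ = q * (5 * d * s) := by rw [hq]; field_simp
    rw [hzq] at hws
    have hP : piPlus K x ≤ 1 + q := by
      refine (h.piPlus_le_of_mem hm x).trans ?_
      gcongr
      rw [div_le_iff₀ hr0]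
      exact hws.trans (by gcongr)
    have hDx : D x ≤ R / r * D₀ * (1 + q) := by
      rw [hDdef, mul_assoc]
      refine mul_le_mul_of_nonneg_left ?_ (by positivity)
      nlinarith [mul_le_mul_of_nonneg_left hD hq0]
    have hP0 := piPlus_pos (K := K) x
    have hDU : U / (1 + q) ≤ D x ^ (ℓ - 2) := by
      refine le_trans ?_ (rpow_mul_div_le h.one_lt (by positivity : 0 < R / r * D₀) (?_ : _ ≤ D x))
      · rw [← hU, div_eq_mul_inv]
        refine mul_le_mul_of_nonneg_left ?_ hU0.le
        rw [le_div_iff₀ (hDpos x), inv_mul_le_iff₀ (by positivity)]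
        linarith
      · simp only [hDdef]
        exact mul_le_mul_of_nonneg_left (by linarith [norm_nonneg (x - m)]) (by positivity)
    -- Both directions are projected along the same action, so they cannot both be lost.
    have hpair := one_le_norm_sub_smul_sq_add hv hw hvw (action K x)
      (fderiv ℝ (piPlus K) x v) (fderiv ℝ (piPlus K) x w)
    have hDn : 0 ≤ D x ^ (ℓ - 2) / piPlus K x := by have := hDpos x; positivity
    rw [← ENNReal.ofReal_mul (by positivity), e, hLf, ← ENNReal.ofReal_add (by positivity)
      (by positivity), ← ENNReal.ofReal_add (by positivity) (by positivity), ← mul_add]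
    refine ENNReal.ofReal_le_ofReal ?_
    have h3 : U / (1 + q) ^ 2 ≤ D x ^ (ℓ - 2) / piPlus K x := by
      rw [sq, ← div_div]
      have : 0 ≤ U / (1 + q) := by positivity
      gcongr
    have h4 : U * (0.861 - 4.75 * q ^ 2) ≤ U / (1 + q) ^ 2 := by
      rw [le_div_iff₀ (by positivity), mul_assoc]
      refine mul_le_of_le_one_right hU0.le ?_
      exact tangent_bound hq0
    have h5 := mul_le_mul_of_nonneg_left hpair hDn
    linarith
  have hI := lintegral_mono hpt (μ := stdGaussian (Vec d))
  rw [lintegral_const, measure_univ, mul_one, lintegral_add_right _ (by fun_prop),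
    lintegral_const_mul _ (by fun_prop), lintegral_norm_sq] at hI
  refine hI.trans (add_le_add_right ?_ _)
  rw [← ENNReal.ofReal_mul (by positivity)]
  refine ENNReal.ofReal_le_ofReal ?_
  rw [mul_assoc]
  refine mul_le_mul_of_nonneg_left ?_ hU0.le
  rw [div_mul_eq_mul_div, div_le_div_iff₀ (by positivity) (by norm_num)]
  nlinarith

end Setting

end RONM

/-! ### The scalar profile for the single-direction bound. -/

namespace RONM

open Filter Topology RealInnerProductSpace

/-- The profile of the curvature along a half-line. -/
noncomputable def profile (s : ℝ) : ℝ :=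
  0.37 * s ^ 2 * (Real.exp (-(0.35 * s ^ 2)) - Real.exp (-5.6))

@[fun_prop]
lemma measurable_profile : Measurable profile := by unfold profile; fun_prop

/-- 5.6 = 0.35 · 4², so the profile changes sign at the truncation point s = 4. -/
lemma profile_nonpos {s : ℝ} (hs : 4 ≤ s) : profile s ≤ 0 := by
  refine mul_nonpos_of_nonneg_of_nonpos (by positivity) (sub_nonpos.2 ?_)
  gcongr
  nlinarith

lemma omega_pos {s : ℝ} (h0 : 0 ≤ s) (h4 : s ≤ 4) : 0 < omega (s / 10) := by
  rw [omega]
  exact div_pos (by nlinarith) (by positivity)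

lemma cubic_le_exp {x : ℝ} (hx : 0 ≤ x) : 1 + x + x ^ 2 / 2 + x ^ 3 / 6 ≤ Real.exp x := by
  have := Real.sum_le_exp_of_nonneg hx 4
  norm_num [Finset.sum_range_succ, Nat.factorial] at this
  linarith

/-- Polynomial form, with u = s², of the inequality in `profile_le`: the exponential is replaced by
its cubic Taylor sum and s by a quadratic majorant nearly tangent at s = 1.2645. -/
lemma quartic_bound {u : ℝ} (h0 : 0 ≤ u) (h16 : u ≤ 16) :
    0.37 * u * (1 + 0.221 * ((u + 1.6) / 2.529) + 0.0121 * u) ≤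
      (1 - 0.034 * u) * (0.075 + 0.35 * u + 0.06125 * u ^ 2 + 0.007145 * u ^ 3) := by
  have key : 0 ≤ 0.075 - 0.074284 * u + 0.01254 * u ^ 2 + 0.005062 * u ^ 3 - 0.000243 * u ^ 4 := by
    have h3 : 0 ≤ u ^ 3 := by positivity
    rcases le_total u 4 with h | h
    · have h4 : 0 ≤ u ^ 3 * (4 - u) := mul_nonneg h3 (by linarith)
      nlinarith [mul_nonneg h0 (sq_nonneg (u - 1.64)), sq_nonneg (u - 1.64)]
    · have h4 : 0 ≤ u ^ 3 * (16 - u) := mul_nonneg h3 (by linarith)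
      nlinarith [mul_nonneg (mul_nonneg h0 h0) (sub_nonneg.2 h), mul_nonneg h0 (sub_nonneg.2 h)]
  have : 0 ≤ u ^ 2 := sq_nonneg u
  have : 0 ≤ u ^ 3 := by positivity
  have : 0 ≤ u ^ 4 := by positivity
  have e : 0.37 * u * (1 + 0.221 * ((u + 1.6) / 2.529) + 0.0121 * u) ≤
      0.421734 * u + 0.03681 * u ^ 2 := by
    rw [← mul_div_assoc, add_div', div_add', mul_div_assoc', div_le_iff₀] <;> nlinarith
  nlinarith

/-- The profile is a lower bound for the curvature, up to a penalty for the lateral distance. -/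
lemma profile_le {s c : ℝ} (h0 : 0 < s) (h4 : s ≤ 4) :
    profile s ≤ omega (s / 10) * (1 - c) ^ 2 + 0.4 * (s ^ 2 * c ^ 2) := by
  have hω := omega_pos h0.le h4
  set ω := omega (s / 10) with hωdef
  set u := s ^ 2 with hu
  have hu0 : 0 < u := by positivity
  have hu16 : u ≤ 16 := by nlinarith
  have hsu : s ≤ (u + 1.6) / 2.529 := by
    rw [le_div_iff₀ (by norm_num)]; nlinarith [sq_nonneg (s - 1.2645)]
  have hE : 0.37 * u + 0.925 * ω ≤ ω * Real.exp (0.35 * u) := by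
    have h1 := cubic_le_exp (by positivity : 0 ≤ 0.35 * u)
    have hden : 0 < (1 + s / 10) * (1 + 1.21 * (s / 10)) := by positivity
    have h2 : 0.37 * u ≤ ω * (Real.exp (0.35 * u) - 0.925) := by
      rw [hωdef, omega, div_mul_eq_mul_div, le_div_iff₀ hden]
      calc 0.37 * u * ((1 + s / 10) * (1 + 1.21 * (s / 10)))
          ≤ 0.37 * u * (1 + 0.221 * ((u + 1.6) / 2.529) + 0.0121 * u) := by
            gcongr
            have : (1 + s / 10) * (1 + 1.21 * (s / 10)) = 1 + 0.221 * s + 0.0121 * u := by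
              rw [hu]; ring
            rw [this]; gcongr
        _ ≤ _ := quartic_bound hu0.le hu16
        _ ≤ (1 - 3.4 * (s / 10) ^ 2) * (Real.exp (0.35 * u) - 0.925) := by
            have e : 1 - 3.4 * (s / 10) ^ 2 = 1 - 0.034 * u := by rw [hu]; ring
            rw [e]
            refine mul_le_mul_of_nonneg_left ?_ (by linarith)
            have : 0 ≤ u ^ 2 := sq_nonneg u
            have : 0 ≤ u ^ 3 := by positivity
            nlinarith
    linarith
  -- The minimum over c of ω(1-c)² + 0.4uc² is 0.4uω/(ω + 0.4u), so only this comparison is needed.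
  have hk : profile s * (ω + 0.4 * u) ≤ 0.4 * u * ω := by
    have h1 : profile s ≤ 0.37 * u * Real.exp (-(0.35 * u)) := by
      rw [profile]
      have := Real.exp_pos (-5.6)
      gcongr
      linarith
    have h2 : 0.37 * (ω + 0.4 * u) ≤ 0.4 * (ω * Real.exp (0.35 * u)) := by linarith
    calc profile s * (ω + 0.4 * u)
        ≤ 0.37 * u * Real.exp (-(0.35 * u)) * (ω + 0.4 * u) := by gcongr
      _ = u * Real.exp (-(0.35 * u)) * (0.37 * (ω + 0.4 * u)) := by ring
      _ ≤ u * Real.exp (-(0.35 * u)) * (0.4 * (ω * Real.exp (0.35 * u))) := by gcongr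
      _ = 0.4 * u * ω * (Real.exp (-(0.35 * u)) * Real.exp (0.35 * u)) := by ring
      _ = _ := by rw [← Real.exp_add]; simp
  have hpos : 0 < ω + 0.4 * u := by positivity
  refine le_of_mul_le_mul_right (hk.trans ?_) hpos
  nlinarith [sq_nonneg (ω * (1 - c) - 0.4 * u * c)]

/-- Outside the cone no curvature is claimed; the lateral penalty alone pays for the profile. -/
lemma profile_le_of_one_le {s c : ℝ} (hc : 1 ≤ c) : profile s ≤ 0.4 * (s ^ 2 * c ^ 2) := by
  have h1 : Real.exp (-(0.35 * s ^ 2)) ≤ 1 := Real.exp_le_one_iff.2 (by nlinarith [sq_nonneg s])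
  have h2 := Real.exp_pos (-5.6)
  have h3 : profile s ≤ 0.37 * s ^ 2 * 1 := by
    rw [profile]; gcongr; linarith
  nlinarith [sq_nonneg s, mul_nonneg (sq_nonneg s) (by nlinarith : 0 ≤ c ^ 2 - 1)]

lemma integral_sq_mul_exp {b : ℝ} (hb : 0 < b) :
    ∫ x in Set.Ioi (0 : ℝ), x ^ 2 * Real.exp (-(b * x ^ 2)) =
      Real.sqrt Real.pi / 4 / (b * Real.sqrt b) := by
  have h := integral_rpow_mul_exp_neg_mul_rpow (p := 2) (q := 2) (b := b) (by norm_num)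
    (by norm_num) hb
  simp only [Real.rpow_two, neg_mul] at h
  rw [h]
  have e1 : Real.Gamma ((2 + 1) / 2) = Real.sqrt Real.pi / 2 := by
    rw [show ((2 : ℝ) + 1) / 2 = 1 / 2 + 1 by norm_num, Real.Gamma_add_one (by norm_num),
      Real.Gamma_one_half_eq]
    ring
  have e2 : b ^ (-((2 : ℝ) + 1) / 2) = (b * Real.sqrt b)⁻¹ := by
    rw [Real.sqrt_eq_rpow, show -((2 : ℝ) + 1) / 2 = -(1 + 1 / 2) by norm_num, Real.rpow_neg hb.le,
      Real.rpow_add hb, Real.rpow_one]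
  rw [e1, e2]
  ring

lemma integrableOn_sq_mul_exp {b : ℝ} (hb : 0 < b) :
    IntegrableOn (fun x : ℝ => x ^ 2 * Real.exp (-(b * x ^ 2))) (Set.Ioi 0) := by
  have := integrable_rpow_mul_exp_neg_mul_sq hb (s := 2) (by norm_num)
  simp only [Real.rpow_two, neg_mul] at this
  exact this.integrableOn

lemma exp_neg_bound : Real.exp (-5.6) ≤ 0.00371 := by
  have h1 := Real.exp_one_gt_d9
  have h2 := cubic_le_exp (x := 0.6) (by norm_num)
  have h3 : Real.exp 5.6 = Real.exp 1 ^ 5 * Real.exp 0.6 := by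
    rw [← Real.exp_nat_mul, ← Real.exp_add]; norm_num
  have h4 : (148.4 : ℝ) ≤ Real.exp 1 ^ 5 :=
    le_trans (by norm_num) (pow_le_pow_left₀ (by norm_num) h1.le 5)
  have h5 : (269.55 : ℝ) ≤ Real.exp 5.6 := by
    rw [h3]
    refine le_trans (by norm_num : (269.55 : ℝ) ≤ 148.4 * 1.8164) ?_
    gcongr
    have := Real.sum_le_exp_of_nonneg (x := 0.6) (by norm_num) 6
    norm_num [Finset.sum_range_succ, Nat.factorial] at this
    linarith
  rw [Real.exp_neg, inv_le_comm₀ (Real.exp_pos _) (by norm_num)]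
  exact le_trans (by norm_num) h5

/-- Against the Gaussian density the profile is a difference of two integrals of x² exp(-bx²), with
b = 0.5 + 0.35 and b = 0.5. Passing to `ENNReal` keeps only the positive part, which helps. -/
lemma lintegral_profile_ge :
    ENNReal.ofReal 0.0827 ≤
      ∫⁻ s in Set.Ioi (0 : ℝ), ENNReal.ofReal (profile s) ∂gaussianReal 0 1 := by
  have hpdf : ∀ s, gaussianPDFReal 0 1 s * profile s =
      (Real.sqrt (2 * Real.pi))⁻¹ * 0.37 * (s ^ 2 * Real.exp (-(0.85 * s ^ 2)) -
        Real.exp (-5.6) * (s ^ 2 * Real.exp (-(0.5 * s ^ 2)))) := by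
    intro s
    have e : Real.exp (-(0.85 * s ^ 2)) =
        Real.exp (-(0.5 * s ^ 2)) * Real.exp (-(0.35 * s ^ 2)) := by
      rw [← Real.exp_add]; congr 1; ring
    have e2 : Real.exp (-(s - 0) ^ 2 / (2 * ((1 : NNReal) : ℝ))) = Real.exp (-(0.5 * s ^ 2)) := by
      congr 1; rw [NNReal.coe_one]; ring
    rw [gaussianPDFReal, e2, profile, e, NNReal.coe_one, mul_one]
    ring
  rw [gaussianReal_of_var_ne_zero _ one_ne_zero, restrict_withDensity measurableSet_Ioi,
    lintegral_withDensity_eq_lintegral_mul _ (measurable_gaussianPDF 0 1) (by fun_prop)]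
  have hI1 := integrableOn_sq_mul_exp (b := 0.85) (by norm_num)
  have hI2 := (integrableOn_sq_mul_exp (b := 0.5) (by norm_num)).const_mul (Real.exp (-5.6))
  have hI : IntegrableOn (fun s => gaussianPDFReal 0 1 s * profile s) (Set.Ioi 0) := by
    simp_rw [hpdf]
    exact (hI1.sub hI2).const_mul _
  have hval : 0.0827 ≤ ∫ s in Set.Ioi (0 : ℝ), gaussianPDFReal 0 1 s * profile s := by
    simp_rw [hpdf]
    rw [integral_const_mul, integral_sub hI1 hI2, integral_const_mul,
      integral_sq_mul_exp (by norm_num), integral_sq_mul_exp (by norm_num)]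
    have hπ : 0 < Real.sqrt Real.pi := Real.sqrt_pos.2 Real.pi_pos
    have e : (Real.sqrt (2 * Real.pi))⁻¹ * 0.37 * (Real.sqrt Real.pi / 4 / (0.85 * Real.sqrt 0.85) -
        Real.exp (-5.6) * (Real.sqrt Real.pi / 4 / (0.5 * Real.sqrt 0.5))) =
        0.37 / 4 * (Real.sqrt 2)⁻¹ * ((0.85 * Real.sqrt 0.85)⁻¹ - Real.exp (-5.6) *
          (0.5 * Real.sqrt 0.5)⁻¹) := by
      rw [Real.sqrt_mul (by norm_num)]
      field_simp
    rw [e]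
    have s1 : Real.sqrt 2 ≤ 1.41422 := Real.sqrt_le_iff.2 ⟨by norm_num, by norm_num⟩
    have s2 : Real.sqrt 0.85 ≤ 0.92196 := Real.sqrt_le_iff.2 ⟨by norm_num, by norm_num⟩
    have s3 : 0.7071 ≤ Real.sqrt 0.5 := Real.le_sqrt_of_sq_le (by norm_num)
    have i1 : (1.41422 : ℝ)⁻¹ ≤ (Real.sqrt 2)⁻¹ := by gcongr
    have i2 : (0.85 * 0.92196 : ℝ)⁻¹ ≤ (0.85 * Real.sqrt 0.85)⁻¹ := by gcongr
    have i3 : (0.5 * Real.sqrt 0.5)⁻¹ ≤ (0.5 * 0.7071 : ℝ)⁻¹ := by gcongr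
    have i4 : Real.exp (-5.6) * (0.5 * Real.sqrt 0.5)⁻¹ ≤ 0.00371 * (0.5 * 0.7071 : ℝ)⁻¹ := by
      gcongr
      exact exp_neg_bound
    calc (0.0827 : ℝ) ≤ 0.37 / 4 * (1.41422 : ℝ)⁻¹ *
          ((0.85 * 0.92196 : ℝ)⁻¹ - 0.00371 * (0.5 * 0.7071 : ℝ)⁻¹) := by norm_num
      _ ≤ _ := by
        have : (0 : ℝ) ≤ (0.85 * 0.92196 : ℝ)⁻¹ - 0.00371 * (0.5 * 0.7071 : ℝ)⁻¹ := by norm_num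
        gcongr
  calc ENNReal.ofReal 0.0827
      ≤ ENNReal.ofReal (∫ s in Set.Ioi (0 : ℝ), max (gaussianPDFReal 0 1 s * profile s) 0) :=
        ENNReal.ofReal_le_ofReal (hval.trans (integral_mono hI hI.pos_part fun s => le_max_left _ _))
    _ = ∫⁻ s in Set.Ioi (0 : ℝ), ENNReal.ofReal (max (gaussianPDFReal 0 1 s * profile s) 0) :=
        ofReal_integral_eq_lintegral_ofReal hI.pos_part (ae_of_all _ fun s => le_max_right _ _)
    _ = _ := by
        refine lintegral_congr fun s => ?_
        rw [Pi.mul_apply, gaussianPDF, ← ENNReal.ofReal_mul (gaussianPDFReal_nonneg _ _ _),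
          ENNReal.ofReal_max, ENNReal.ofReal_zero, max_eq_left zero_le]

end RONM

/-! ### Hessian bound in a single direction. -/

namespace RONM

open Filter Topology RealInnerProductSpace

@[fun_prop]
lemma measurable_omega : Measurable omega := by unfold omega; fun_prop

section Half

variable {d : ℕ}

/-- An even function has half of its integral on a half-space. -/
lemma two_mul_lintegral_halfspace_le (w : Vec d) {F : Vec d → ENNReal} (hF : Measurable F)
    (heven : ∀ z, F (-z) = F z) :
    2 * ∫⁻ z, {z : Vec d | 0 < inner ℝ w z}.indicator F z ∂stdGaussian (Vec d) ≤
      ∫⁻ z, F z ∂stdGaussian (Vec d) := by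
  have hm : MeasurableSet {z : Vec d | 0 < inner ℝ w z} :=
    measurableSet_lt measurable_const (by fun_prop)
  have hI : Measurable ({z : Vec d | 0 < inner ℝ w z}.indicator F) := hF.indicator hm
  rw [two_mul]
  nth_rewrite 2 [← lintegral_neg_stdGaussian hI]
  rw [← lintegral_add_left hI]
  refine lintegral_mono fun z => ?_
  by_cases hz : 0 < inner ℝ w z
  · rw [Set.indicator_of_mem (by exact hz), Set.indicator_of_notMem, add_zero]
    simp only [Set.mem_ofPred_eq, inner_neg_right, not_lt]
    linarith
  · rw [Set.indicator_of_notMem (by exact hz), zero_add]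
    refine (Set.indicator_le_self _ F _).trans (heven z).le

lemma le_ofReal_half {a : ENNReal} {X : ℝ} (h : 2 * a ≤ ENNReal.ofReal X) :
    a ≤ ENNReal.ofReal (X / 2) := by
  rw [ENNReal.ofReal_div_of_pos (by norm_num), ENNReal.ofReal_ofNat,
    ENNReal.le_div_iff_mul_le (by simp) (by simp), mul_comm]
  exact h

/-- Pythagoras: from the total variance tr S one removes the variance of the component along v. -/
lemma lintegral_norm_sqrtOp_perp {S : Mat d} (hS : S.PosDef) {v : Vec d} (hv : ‖v‖ = 1) :
    ∫⁻ z, ENNReal.ofReal (‖sqrtOp S z - (inner ℝ v (sqrtOp S z) : ℝ) • v‖ ^ 2)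
        ∂stdGaussian (Vec d) = ENNReal.ofReal (S.trace - sqNorm S v) := by
  have h1 : ∀ z, ENNReal.ofReal (‖sqrtOp S z‖ ^ 2) =
      ENNReal.ofReal (‖sqrtOp S z - (inner ℝ v (sqrtOp S z) : ℝ) • v‖ ^ 2) +
        ENNReal.ofReal (inner ℝ (sqrtOp S v) z ^ 2) := by
    intro z
    rw [← ENNReal.ofReal_add (sq_nonneg _) (sq_nonneg _), inner_sqrtOp]
    congr 1
    rw [norm_sub_sq_real, norm_smul, inner_smul_right, hv, real_inner_comm v, mul_one,
      Real.norm_eq_abs, sq_abs]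
    ring
  have h2 := lintegral_norm_sqrtOp_sq hS
  simp_rw [h1] at h2
  rw [lintegral_add_right _ (by fun_prop), lintegral_inner_sq_stdGaussian, norm_sqrtOp_sq hS] at h2
  have hnn : 0 ≤ sqNorm S v := by rw [← norm_sqrtOp_sq hS]; positivity
  rw [ENNReal.ofReal_sub _ hnn, ← h2, ENNReal.add_sub_cancel_right ENNReal.ofReal_ne_top]

lemma eq_inner_smul_of_dim_one (hd : d = 1) {v : Vec d} (hv : ‖v‖ = 1) (y : Vec d) :
    y = (inner ℝ v y : ℝ) • v := by
  have hv0 : v ≠ 0 := by rintro rfl; simp at hv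
  have hf : Module.finrank ℝ (Vec d) = 1 := by rw [finrank_euclideanSpace_fin, hd]
  obtain ⟨c, hc⟩ := (finrank_eq_one_iff_of_nonzero' v hv0).1 hf y
  rw [← hc, inner_smul_right, real_inner_self_eq_norm_sq, hv]
  simp

end Half

namespace Setting

variable {d : ℕ} {K : Set (Vec d)} {r R : ℝ} {f : Vec d → ℝ} {G : ℝ} {xs : Vec d} {β ℓ : ℝ}
  (h : Setting K r R f G xs β ℓ)
include h

/-- The one-dimensional case of `curvature_le`. -/
lemma curvature_le_of_dim_one (hd : d = 1) {x m v : Vec d} (hm : m ∈ K)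
    (hv : ‖v‖ = 1) (hvm : inner ℝ v m ≤ 0) {D₀ η : ℝ} (h0 : 0 < D₀) (hD : ‖m - xs‖ ≤ D₀)
    (hη0 : 0 ≤ η) (hpos : 0 < inner ℝ v (x - m))
    (hr : inner ℝ v (x - m) ≤ r) (hD₀ : inner ℝ v (x - m) ≤ η * D₀) :
    ∃ D, 0 < D ∧ ‖action K x - xs‖ ≤ D ∧
      omega η * (1 - ‖x - m - inner ℝ v (x - m) • v‖ * R / (r * inner ℝ v (x - m))) ^ 2 *
          D₀ ^ (ℓ - 2) ≤
        D ^ (ℓ - 2) / piPlus K x * ‖v - fderiv ℝ (piPlus K) x v • action K x‖ ^ 2 := by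
  have hxm := eq_inner_smul_of_dim_one hd hv (x - m)
  have hm' := eq_inner_smul_of_dim_one hd hv m
  set k : ℝ := inner ℝ v (x - m)
  set t : ℝ := inner ℝ v m
  have hz : x - m - k • v = 0 := sub_eq_zero.2 hxm
  have hx' : x = (k + t) • v := by rw [add_smul, ← hxm, ← hm']; abel
  -- Either x is on the side of v, within r of the origin, or it lies between m and the origin.
  have hx : x ∈ K := by
    rcases le_total 0 (k + t) with h1 | h1
    · refine h.ball_subset ?_
      rw [mem_closedBall_zero_iff, hx', norm_smul, hv, Real.norm_of_nonneg h1]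
      linarith
    · have ht : t < 0 := by linarith
      have e : x = ((k + t) / t) • m := by
        rw [hx']
        conv_rhs => rw [hm', smul_smul, div_mul_cancel₀ _ ht.ne]
      rw [e]
      exact h.convex.smul_mem_of_zero_mem h.zero_mem hm
        ⟨div_nonneg_of_nonpos h1 ht.le, (div_le_one_of_neg ht).2 (by linarith)⟩
  have hnx : ‖x - m‖ = k := by
    rw [hxm, norm_smul, hv, mul_one, Real.norm_of_nonneg hpos.le]
  refine ⟨D₀ + k, by positivity, ?_, ?_⟩
  · rw [action, h.piPlus_of_mem hx, inv_one, one_smul]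
    have := norm_add_le (x - m) (m - xs)
    rw [sub_add_sub_cancel] at this
    linarith
  · refine le_trans ?_ (h.curvature_of_mem hx hv h0 (by linarith))
    rw [hz, norm_zero, zero_mul, zero_div, sub_zero, one_pow, mul_one, mul_comm]
    gcongr
    refine (omega_le_inv hη0).trans ?_
    rw [inv_eq_one_div, div_le_div_iff₀ (by positivity) (by positivity)]
    nlinarith [mul_nonneg hη0 h0.le, mul_nonneg (mul_nonneg hη0 hη0) h0.le]

-- `curvature_le` applies only in a narrow cone about v. Compressing z by ρ = r/R orthogonally to e,
-- where √S e is parallel to v, scales the part of √S z orthogonal to v exactly by ρ and costs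
-- ρ^(d-1). The offset along v becomes σ⟨w,z⟩ with w a unit vector, so the profile is integrated
-- against a one-dimensional Gaussian; the lateral penalty integrates to 0.2T.
set_option maxHeartbeats 1000000 in
lemma hessian_ge_of_inner_nonpos {lam : ℝ} (h0 : 0 < lam) (h1 : lam < 1) {m : Vec d} (hm : m ∈ K)
    {S : Mat d} (hS : S.PosDef) {v : Vec d} (hv : ‖v‖ = 1) (hvm : inner ℝ v m ≤ 0)
    {s D₀ T : ℝ} (hs : 0 < s) (hSs : ∀ x, sqNorm S x ≤ s ^ 2 * ‖x‖ ^ 2)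
    (hr : 5 * d * s ≤ r) (hD : 10 * d * s ≤ D₀) (hxs : ‖m - xs‖ ≤ D₀)
    (hT0 : 0 ≤ T) (hT : sqNorm S⁻¹ v * (S.trace - sqNorm S v) ≤ T) :
    lam * (β * (ℓ * (ℓ - 1))) * D₀ ^ (ℓ - 2) * (r / R) ^ (d - 1) * (0.0827 - 0.2 * T) ≤
      sqNorm (hessian (surrogate (extension K f G R) lam m S) m) v := by
  have hr0 := h.r_pos
  have hR0 := h.R_pos
  have hd : (1 : ℝ) ≤ d := by exact_mod_cast h.one_le
  have hD0 : 0 < D₀ := by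
    have : 0 < 10 * d * s := by positivity
    linarith
  obtain ⟨hnn, hL⟩ := h.hessian_nonneg_and_lintegral_le h0 h1 m hS v
  set H := sqNorm (hessian (surrogate (extension K f G R) lam m S) m) v
  set U := D₀ ^ (ℓ - 2) with hU
  have hU0 : 0 < U := by positivity
  set A := sqrtOp S with hA
  set μ := 1 - lam with hμ
  have hμ0 : 0 < μ := by rw [hμ]; linarith
  have hμ1 : μ ≤ 1 := by rw [hμ]; linarith
  set ρ := r / R with hρ
  have hρ0 : 0 < ρ := by positivity
  have hρ1 : ρ ≤ 1 := (div_le_one hR0).2 h.r_le_R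
  -- the direction that is mapped to `v`
  set y := invSqrtOp S v with hy
  have hAy : A y = v := sqrtOp_invSqrtOp hS v
  have hy0 : y ≠ 0 := by
    intro h2
    rw [h2, map_zero] at hAy
    rw [← hAy, norm_zero] at hv
    exact zero_ne_one hv
  set N := ‖y‖ with hN
  have hN0 : 0 < N := norm_pos_iff.2 hy0
  have hN2 : N ^ 2 = sqNorm S⁻¹ v := by
    have e1 : A (mulV S⁻¹ v) = y := by
      have : A (A (mulV S⁻¹ v)) = v := by
        rw [hA, sqrtOp_sqrtOp hS, mulV_eq, mulV_eq, ← mul_apply_eq_comp, ← map_mul,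
          Matrix.mul_nonsing_inv _ ((Matrix.isUnit_iff_isUnit_det _).1 hS.isUnit), map_one]
        rfl
      have := congrArg (invSqrtOp S) this
      rwa [hA, invSqrtOp_sqrtOp hS] at this
    rw [sqNorm_eq_inner, hN, ← real_inner_self_eq_norm_sq]
    nth_rewrite 2 [← e1]
    rw [← inner_sqrtOp, ← hA, hAy]
  set e := N⁻¹ • y with he
  have he1 : ‖e‖ = 1 := by rw [he, norm_smul, norm_inv, Real.norm_of_nonneg hN0.le, ← hN,
    inv_mul_cancel₀ hN0.ne']
  have hAe : A e = N⁻¹ • v := by rw [he, map_smul, hAy]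
  have hAve : inner ℝ (A v) e = N⁻¹ := by
    rw [hA, inner_sqrtOp, ← hA, hAe, inner_smul_right, real_inner_self_eq_norm_sq, hv]; ring
  have hAv : ‖A v‖ ≤ s := by
    refine abs_le_of_sq_le_sq' ?_ hs.le |>.2
    rw [hA, norm_sqrtOp_sq hS]
    simpa [hv] using hSs v
  have hNs : N⁻¹ ≤ s := by
    rw [← hAve]
    refine (real_inner_le_norm _ _).trans ?_
    rwa [he1, mul_one]
  -- W represents the offset along v: after the compression, ⟨v, x - m⟩ = ⟨W,z⟩.
  set W := μ • (ρ • A v + ((1 - ρ) * N⁻¹) • e) with hW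
  have hWe : inner ℝ W e = μ * N⁻¹ := by
    rw [hW, inner_smul_left, inner_add_left, inner_smul_left, inner_smul_left, hAve,
      real_inner_self_eq_norm_sq, he1]
    simp only [conj_trivial]; ring
  have hWlow : μ * N⁻¹ ≤ ‖W‖ := by
    rw [← hWe]
    refine (real_inner_le_norm _ _).trans ?_
    rw [he1, mul_one]
  have hWup : ‖W‖ ≤ s := by
    rw [hW, norm_smul, Real.norm_of_nonneg hμ0.le]
    refine (mul_le_of_le_one_left (norm_nonneg _) hμ1).trans ((norm_add_le _ _).trans ?_)
    have hNn : 0 < N⁻¹ := inv_pos.2 hN0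
    rw [norm_smul, norm_smul, Real.norm_of_nonneg hρ0.le,
      Real.norm_of_nonneg (mul_nonneg (by linarith) hNn.le), he1]
    nlinarith [mul_le_mul_of_nonneg_left hAv hρ0.le,
      mul_le_mul_of_nonneg_left hNs (sub_nonneg.2 hρ1)]
  have hW0 : 0 < ‖W‖ := lt_of_lt_of_le (by positivity) hWlow
  set σ := ‖W‖ with hσ
  set w := σ⁻¹ • W with hw
  have hw1 : ‖w‖ = 1 := by
    rw [hw, norm_smul, norm_inv, Real.norm_of_nonneg hW0.le, ← hσ, inv_mul_cancel₀ hW0.ne']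
  -- the contraction
  set D : Vec d →ₗ[ℝ] Vec d := ρ • (LinearMap.id : Vec d →ₗ[ℝ] Vec d) +
      (1 - ρ) • ((innerSL ℝ e).smulRight e : Vec d →L[ℝ] Vec d).toLinearMap with hDdef
  have hDz : ∀ z, D z = ρ • z + ((1 - ρ) * inner ℝ e z) • e := fun z => by
    simp [hDdef, smul_smul]
  have hDdet : LinearMap.det D = ρ ^ (d - 1) := det_smul_add_rankOne hρ0.ne' he1
  have hDc : ∀ z, ‖D z‖ ≤ ‖z‖ := by
    intro z
    rw [hDz]
    refine (norm_add_le _ _).trans ?_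
    rw [norm_smul, norm_smul, norm_mul, Real.norm_of_nonneg hρ0.le,
      Real.norm_of_nonneg (sub_nonneg.2 hρ1), he1, mul_one]
    have := norm_inner_le_norm (𝕜 := ℝ) e z
    rw [he1, one_mul] at this
    nlinarith [mul_le_mul_of_nonneg_left this (sub_nonneg.2 hρ1)]
  -- the lower bound for the curvature
  set k : Vec d → ℝ := fun x => inner ℝ v (x - m) with hk
  set zz : Vec d → ℝ := fun x => ‖x - m - k x • v‖ with hzz
  -- The cutoff 4σ corresponds to η = 0.4, the limit of `curvature_le`, and to the zero of the
  -- profile.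
  set Lf : Vec d → ENNReal := fun x => if 0 < k x ∧ k x ≤ 4 * σ ∧ zz x * R ≤ r * k x then
    ENNReal.ofReal (omega (k x / σ / 10) * (1 - zz x * R / (r * k x)) ^ 2 * U) else 0 with hLf
  have hkm : Measurable k := by fun_prop
  have hzm : Measurable zz := by fun_prop
  have hLm : Measurable Lf := by
    refine Measurable.ite ?_ (by fun_prop) measurable_const
    exact (measurableSet_lt measurable_const hkm).inter ((measurableSet_le hkm
      measurable_const).inter (measurableSet_le (hzm.mul_const _) (hkm.const_mul _)))
  specialize hL Lf ?_
  · intro x hx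
    by_cases hc : 0 < k x ∧ k x ≤ 4 * σ ∧ zz x * R ≤ r * k x
    · simp only [hLf, if_pos hc]
      obtain ⟨c1, c2, c3⟩ := hc
      have hη0 : 0 ≤ k x / σ / 10 := by positivity
      have hη : k x / σ / 10 ≤ 0.4 := by
        rw [div_div, div_le_iff₀ (by positivity)]; linarith
      have hkσ : k x = k x / σ / 10 * (10 * σ) := by field_simp
      have hds : s ≤ d * s := le_mul_of_one_le_left hs.le hd
      -- For d ≥ 2 one has r ≥ 10s ≥ 10σ, as the general bound needs; for d = 1 only r ≥ 5s is
      -- known.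
      by_cases hd1 : d = 1
      · obtain ⟨D, hD1, hD2, hD3⟩ := h.curvature_le_of_dim_one hd1 (x := x) hm hv hvm hD0 hxs hη0 c1
          (by
            change k x ≤ r
            linarith)
          (by
            change k x ≤ k x / σ / 10 * D₀
            nth_rewrite 1 [hkσ]
            gcongr
            linarith)
        exact ⟨D, hD1, hD2, ENNReal.ofReal_le_ofReal hD3⟩
      · have hd2 : (2 : ℝ) ≤ d := by
          have := h.one_le
          exact_mod_cast (by omega : 2 ≤ d)
        have hds2 : 2 * s ≤ d * s := by gcongr
        obtain ⟨D, hD1, hD2, hD3⟩ := h.curvature_le hx hm hv hvm hD0 hxs hη0 hη c1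
          (by
            change k x ≤ k x / σ / 10 * r
            nth_rewrite 1 [hkσ]
            gcongr
            linarith)
          (by
            change k x ≤ k x / σ / 10 / 2 * D₀
            nth_rewrite 1 [hkσ]
            rw [div_mul_eq_mul_div _ 2, mul_div_assoc]
            gcongr
            linarith) c3
        exact ⟨D, hD1, hD2, ENNReal.ofReal_le_ofReal hD3⟩
    · simp only [hLf, if_neg hc]
      exact ⟨max 1 ‖action K x - xs‖, by positivity, le_max_right _ _, zero_le⟩
  have hcontr := ofReal_det_mul_lintegral_le D (by rw [hDdet]; positivity) hDc
    (F := fun z => Lf (m + μ • A z)) (hLm.comp (by fun_prop))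
  rw [hDdet, abs_of_pos (by positivity)] at hcontr
  have hL2 : ENNReal.ofReal (lam * (β * (ℓ * (ℓ - 1))) * ρ ^ (d - 1)) *
      ∫⁻ z, Lf (m + μ • A (D z)) ∂stdGaussian (Vec d) ≤ ENNReal.ofReal H := by
    refine le_trans ?_ hL
    rw [ENNReal.ofReal_mul (mul_pos h0 h.curv_const_pos).le, mul_assoc]
    exact mul_le_mul_right hcontr _
  have key := mul_sub_le_of_lintegral (J := U * 0.0827) (q := U * (0.2 * T))
    (mul_nonneg (mul_pos h0 h.curv_const_pos).le (by positivity)) hnn (by positivity) hL2 ?_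
  · refine le_of_eq_of_le ?_ key; ring
  -- the pointwise estimate
  set q : Vec d → ℝ := fun z => ‖A z - (inner ℝ v (A z) : ℝ) • v‖ with hq
  set Q : Vec d → ENNReal := fun z => ENNReal.ofReal (U * 0.4 * N ^ 2) * ENNReal.ofReal (q z ^ 2)
    with hQ
  have hQm : Measurable Q := by fun_prop
  set Hs : Set (Vec d) := {z | 0 < inner ℝ w z} with hHs
  have hHm : MeasurableSet Hs := measurableSet_lt measurable_const (by fun_prop)
  have hpt : ∀ z, Hs.indicator (fun z => ENNReal.ofReal U * ENNReal.ofReal (profile (inner ℝ w z))) z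
      ≤ Lf (m + μ • A (D z)) + Hs.indicator Q z := by
    intro z
    by_cases hz : z ∈ Hs
    swap
    · rw [Set.indicator_of_notMem hz]; exact zero_le
    rw [Set.indicator_of_mem hz, Set.indicator_of_mem hz]
    set τ : ℝ := inner ℝ w z with hτ
    have hτ0 : 0 < τ := hz
    set x := m + μ • A (D z) with hx
    have hADz : A (D z) = ρ • A z + ((1 - ρ) * inner ℝ e z * N⁻¹) • v := by
      rw [hDz, map_add, map_smul, map_smul, hAe, smul_smul]
    have hxm : x - m = μ • (ρ • A z + ((1 - ρ) * inner ℝ e z * N⁻¹) • v) := by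
      rw [hx, add_sub_cancel_left, hADz]
    have hkx : k x = σ * τ := by
      have e1 : inner ℝ v (A z) = inner ℝ (A v) z := (inner_sqrtOp S v z).symm
      rw [hτ, hw, inner_smul_left, hW]
      simp only [hk, hxm, inner_smul_left, inner_smul_right, inner_add_left, inner_add_right,
        conj_trivial, e1, real_inner_self_eq_norm_sq, hv]
      rw [← mul_assoc σ, mul_inv_cancel₀ hW0.ne']
      ring
    have hzx : zz x = μ * ρ * q z := by
      have : x - m - k x • v = (μ * ρ) • (A z - (inner ℝ v (A z) : ℝ) • v) := by
        have e1 : k x = μ * (ρ * inner ℝ v (A z) + (1 - ρ) * inner ℝ e z * N⁻¹) := by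
          simp only [hk, hxm, inner_smul_right, inner_add_right, real_inner_self_eq_norm_sq, hv]
          ring
        rw [e1, hxm]
        module
      simp only [hzz, this, norm_smul, hq]
      rw [Real.norm_of_nonneg (by positivity)]
    have hq0 : 0 ≤ q z := norm_nonneg _
    set c := zz x * R / (r * k x) with hc
    have hc' : c = μ * q z / (σ * τ) := by
      rw [hc, hzx, hkx, hρ]; field_simp
    have hc0 : 0 ≤ c := by rw [hc']; positivity
    -- Because σ ≥ μ/N, the penalty is controlled by N² times the lateral square, with N² = vᵀS⁻¹v.
    have hτc : τ ^ 2 * c ^ 2 ≤ N ^ 2 * q z ^ 2 := by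
      have e1 : τ ^ 2 * c ^ 2 = (μ / σ * q z) ^ 2 := by rw [hc']; field_simp
      rw [e1, ← mul_pow]
      gcongr
      rw [div_le_iff₀ hW0]
      have := mul_le_mul_of_nonneg_left hWlow hN0.le
      rwa [mul_left_comm, mul_inv_cancel₀ hN0.ne', mul_one] at this
    have hkpos : 0 < k x := by rw [hkx]; positivity
    have hkσ : k x / σ / 10 = τ / 10 := by rw [hkx]; field_simp
    simp only [hQ]
    rw [← ENNReal.ofReal_mul hU0.le, ← ENNReal.ofReal_mul (by positivity)]
    have hpen : U * (0.4 * (τ ^ 2 * c ^ 2)) ≤ U * 0.4 * N ^ 2 * q z ^ 2 := by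
      have := mul_le_mul_of_nonneg_left hτc (by positivity : 0 ≤ U * 0.4)
      linarith
    rcases le_or_gt τ 4 with h4 | h4
    · by_cases hcond : zz x * R ≤ r * k x
      · have hall : 0 < k x ∧ k x ≤ 4 * σ ∧ zz x * R ≤ r * k x := by
          refine ⟨hkpos, ?_, hcond⟩
          rw [hkx, mul_comm]; gcongr
        simp only [hLf, if_pos hall]
        rw [← hc, hkσ]
        have hω := omega_pos hτ0.le h4
        rw [← ENNReal.ofReal_add (by positivity) (by positivity)]
        refine ENNReal.ofReal_le_ofReal ?_
        have := mul_le_mul_of_nonneg_left (profile_le (c := c) hτ0 h4) hU0.le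
        linarith
      · refine le_add_left (ENNReal.ofReal_le_ofReal (le_trans ?_ hpen))
        refine mul_le_mul_of_nonneg_left (profile_le_of_one_le ?_) hU0.le
        rw [hc, one_le_div (by positivity)]
        exact (not_le.1 hcond).le
    · rw [ENNReal.ofReal_eq_zero.2 (mul_nonpos_of_nonneg_of_nonpos hU0.le (profile_nonpos h4.le))]
      exact zero_le
  have hI := lintegral_mono hpt (μ := stdGaussian (Vec d))
  rw [lintegral_add_right _ (hQm.indicator hHm)] at hI
  have hleft : ENNReal.ofReal (U * 0.0827) ≤ ∫⁻ z, Hs.indicator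
      (fun z => ENNReal.ofReal U * ENNReal.ofReal (profile (inner ℝ w z))) z
      ∂stdGaussian (Vec d) := by
    rw [lintegral_indicator hHm, lintegral_const_mul _ (by fun_prop), ENNReal.ofReal_mul hU0.le]
    refine mul_le_mul_right (lintegral_profile_ge.trans_eq ?_) _
    rw [← map_inner_stdGaussian hw1, setLIntegral_map measurableSet_Ioi (by fun_prop) (by fun_prop)]
    rfl
  have hright : ∫⁻ z, Hs.indicator Q z ∂stdGaussian (Vec d) ≤ ENNReal.ofReal (U * (0.2 * T)) := by
    -- The penalty is even in z and used only on a half-space; this halves 0.4 to 0.2.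
    have h2 := two_mul_lintegral_halfspace_le w hQm (fun z => by
      simp only [hQ, hq, map_neg, inner_neg_right, neg_smul]
      rw [← norm_neg]; congr 4; abel)
    rw [lintegral_const_mul _ (by fun_prop), lintegral_norm_sqrtOp_perp hS hv,
      ← ENNReal.ofReal_mul (by positivity)] at h2
    refine (le_ofReal_half h2).trans (ENNReal.ofReal_le_ofReal ?_)
    rw [← hN2] at hT
    have := mul_le_mul_of_nonneg_left hT (by positivity : 0 ≤ U * 0.2)
    linarith
  exact hleft.trans (hI.trans (add_le_add_right hright _))

/-- Curvature of the surrogate in a single direction, for a covariance that is not too wide in the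
orthogonal directions. -/
lemma hessian_ge {lam : ℝ} (h0 : 0 < lam) (h1 : lam < 1) {m : Vec d} (hm : m ∈ K)
    {S : Mat d} (hS : S.PosDef) {v : Vec d} (hv : ‖v‖ = 1)
    {s D₀ T : ℝ} (hs : 0 < s) (hSs : ∀ x, sqNorm S x ≤ s ^ 2 * ‖x‖ ^ 2)
    (hr : 5 * d * s ≤ r) (hD : 10 * d * s ≤ D₀) (hxs : ‖m - xs‖ ≤ D₀)
    (hT0 : 0 ≤ T) (hT : sqNorm S⁻¹ v * (S.trace - sqNorm S v) ≤ T) :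
    lam * (β * (ℓ * (ℓ - 1))) * D₀ ^ (ℓ - 2) * (r / R) ^ (d - 1) * (0.0827 - 0.2 * T) ≤
      sqNorm (hessian (surrogate (extension K f G R) lam m S) m) v := by
  have hneg : ∀ M : Mat d, sqNorm M (-v) = sqNorm M v := fun M => by
    rw [sqNorm_eq_inner, sqNorm_eq_inner, mulV_eq, mulV_eq, map_neg, inner_neg_neg]
  rcases le_total (inner ℝ v m) 0 with hvm | hvm
  · exact h.hessian_ge_of_inner_nonpos h0 h1 hm hS hv hvm hs hSs hr hD hxs hT0 hT
  · have := h.hessian_ge_of_inner_nonpos h0 h1 hm hS (v := -v) (by rwa [norm_neg])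
      (by rw [inner_neg_left]; linarith) hs hSs hr hD hxs hT0 (by rwa [hneg, hneg])
    rwa [hneg] at this

end Setting

end RONM

/-! ### Quadratic forms, inverses and traces. -/

namespace RONM

open Filter Topology RealInnerProductSpace

section Spectral

variable {d : ℕ}

lemma sqNorm_smul_one (c : ℝ) (x : Vec d) : sqNorm (c • (1 : Mat d)) x = c * ‖x‖ ^ 2 := by
  rw [sqNorm_eq_inner, mulV_eq, map_smul, map_one, smul_apply, inner_smul_right,
    one_apply_eq_self, real_inner_self_eq_norm_sq]

lemma sqNorm_add (A B : Mat d) (x : Vec d) : sqNorm (A + B) x = sqNorm A x + sqNorm B x := by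
  rw [sqNorm, Matrix.add_mulVec, dotProduct_add]; rfl

lemma sqNorm_sub (A B : Mat d) (x : Vec d) : sqNorm (A - B) x = sqNorm A x - sqNorm B x := by
  rw [sqNorm, Matrix.sub_mulVec, dotProduct_sub]; rfl

lemma sqNorm_smul (c : ℝ) (A : Mat d) (x : Vec d) : sqNorm (c • A) x = c * sqNorm A x := by
  rw [sqNorm, Matrix.smul_mulVec, dotProduct_smul]; rfl

lemma sqNorm_sum {ι : Type*} (s : Finset ι) (A : ι → Mat d) (x : Vec d) :
    sqNorm (∑ i ∈ s, A i) x = ∑ i ∈ s, sqNorm (A i) x := by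
  classical
  induction s using Finset.induction_on with
  | empty => simp [sqNorm]
  | insert a s ha ih => rw [Finset.sum_insert ha, Finset.sum_insert ha, sqNorm_add, ih]

lemma sqNorm_smul_vec (A : Mat d) (c : ℝ) (x : Vec d) : sqNorm A (c • x) = c ^ 2 * sqNorm A x := by
  rw [sqNorm_eq_inner, sqNorm_eq_inner, mulV_eq, map_smul, inner_smul_left, inner_smul_right,
    mulV_eq]
  simp only [conj_trivial]; ring

lemma loewner_iff {A B : Mat d} (h : (B - A).IsHermitian) :
    Loewner A B ↔ ∀ x, sqNorm A x ≤ sqNorm B x := by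
  rw [Loewner, Matrix.posSemidef_iff_dotProduct_mulVec]
  refine ⟨fun h2 x => ?_, fun h2 => ⟨h, fun x => ?_⟩⟩
  · have := h2.2 x.ofLp
    rw [star_trivial] at this
    rw [← sub_nonneg, ← sqNorm_sub]
    exact this
  · have := h2 (WithLp.toLp 2 x)
    rw [← sub_nonneg, ← sqNorm_sub] at this
    rw [star_trivial]
    exact this

lemma sqNorm_pos {A : Mat d} (hA : A.PosDef) {x : Vec d} (hx : x ≠ 0) : 0 < sqNorm A x := by
  have := (Matrix.posDef_iff_dotProduct_mulVec.1 hA).2 (x := x.ofLp) (by simpa using hx)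
  rwa [star_trivial] at this

lemma inner_mulV_comm {A : Mat d} (hA : A.IsHermitian) (x y : Vec d) :
    inner ℝ (mulV A x) y = inner ℝ x (mulV A y) := by
  have hs : IsSelfAdjoint (Matrix.toEuclideanCLM (𝕜 := ℝ) A) := IsSelfAdjoint.map hA _
  have := ContinuousLinearMap.adjoint_inner_left (Matrix.toEuclideanCLM (𝕜 := ℝ) A) y x
  rwa [hs.adjoint_eq] at this

lemma mulV_inv {A : Mat d} (hA : A.PosDef) (x : Vec d) : mulV A (mulV A⁻¹ x) = x := by
  rw [mulV_eq, mulV_eq, ← mul_apply_eq_comp, ← map_mul,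
    Matrix.mul_nonsing_inv _ ((Matrix.isUnit_iff_isUnit_det _).1 hA.isUnit), map_one]
  rfl

lemma inv_mulV {A : Mat d} (hA : A.PosDef) (x : Vec d) : mulV A⁻¹ (mulV A x) = x := by
  rw [mulV_eq, mulV_eq, ← mul_apply_eq_comp, ← map_mul,
    Matrix.nonsing_inv_mul _ ((Matrix.isUnit_iff_isUnit_det _).1 hA.isUnit), map_one]
  rfl

/-- Inversion is antitone. -/
lemma sqNorm_inv_le {M P : Mat d} (hM : M.PosDef) (hP : P.PosDef)
    (h : ∀ x, sqNorm M x ≤ sqNorm P x) (x : Vec d) : sqNorm P⁻¹ x ≤ sqNorm M⁻¹ x := by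
  set y := mulV P⁻¹ x with hy
  set z := mulV M⁻¹ x with hz
  have hPy : mulV P y = x := mulV_inv hP x
  have hMz : mulV M z = x := mulV_inv hM x
  have h0 : 0 ≤ sqNorm M (y - z) := by
    by_cases h0 : y - z = 0
    · rw [h0, sqNorm]; simp
    · exact (sqNorm_pos hM h0).le
  have h1 := h y
  have e : sqNorm M (y - z) = sqNorm M y - 2 * inner ℝ x y + inner ℝ x z := by
    have c1 : inner ℝ z (mulV M y) = inner ℝ x y := by rw [← inner_mulV_comm hM.1, hMz]
    have c2 : mulV M (y - z) = mulV M y - x := by rw [mulV_eq, map_sub, ← mulV_eq, ← mulV_eq, hMz]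
    rw [sqNorm_eq_inner, c2, inner_sub_left, inner_sub_right, inner_sub_right, c1, sqNorm_eq_inner,
      real_inner_comm x y, real_inner_comm x z]
    ring
  have h2 : sqNorm P y = inner ℝ x y := by rw [sqNorm_eq_inner, hPy, real_inner_comm]
  rw [sqNorm_eq_inner, sqNorm_eq_inner, ← hy, ← hz]
  linarith

lemma trace_eq_sum_sqNorm (Z : Mat d) (b : OrthonormalBasis (Fin d) ℝ (Vec d)) :
    Z.trace = ∑ i, sqNorm Z (b i) := by
  have h1 := LinearMap.trace_eq_sum_inner (Matrix.toEuclideanCLM (𝕜 := ℝ) Z).toLinearMap b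
  have h2 := LinearMap.trace_eq_sum_inner (Matrix.toEuclideanCLM (𝕜 := ℝ) Z).toLinearMap
    (EuclideanSpace.basisFun (Fin d) ℝ)
  have h3 : ∀ x, inner ℝ x ((Matrix.toEuclideanCLM (𝕜 := ℝ) Z).toLinearMap x) = sqNorm Z x :=
    fun x => (sqNorm_eq_inner Z x).symm
  simp only [h3] at h1 h2
  rw [← h1, h2]
  refine Finset.sum_congr rfl fun i _ => ?_
  simp [sqNorm, Matrix.mulVec, dotProduct]

lemma exists_orthonormalBasis_eq {v : Vec d} (hv : ‖v‖ = 1) :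
    ∃ (b : OrthonormalBasis (Fin d) ℝ (Vec d)) (i : Fin d), b i = v := by
  have hd : 0 < d := by
    rcases Nat.eq_zero_or_pos d with rfl | h
    · rw [Subsingleton.elim v 0, norm_zero] at hv; exact absurd hv zero_ne_one
    · exact h
  have h := Orthonormal.exists_orthonormalBasis_extension_of_card_eq (𝕜 := ℝ) (E := Vec d)
    (ι := Fin d) (by simp) (v := fun _ => v) (s := {⟨0, hd⟩})
    ⟨fun _ => hv, fun i j hij => absurd (Subsingleton.elim i j) hij⟩
  obtain ⟨b, hb⟩ := h
  exact ⟨b, ⟨0, hd⟩, hb _ rfl⟩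

/-- The trace off a direction is monotone. -/
lemma trace_sub_le {S T : Mat d} (h : ∀ x, sqNorm S x ≤ sqNorm T x) {v : Vec d} (hv : ‖v‖ = 1) :
    S.trace - sqNorm S v ≤ T.trace - sqNorm T v := by
  classical
  obtain ⟨b, i, rfl⟩ := exists_orthonormalBasis_eq hv
  rw [trace_eq_sum_sqNorm S b, trace_eq_sum_sqNorm T b,
    ← Finset.add_sum_erase _ _ (Finset.mem_univ i), ← Finset.add_sum_erase _ _ (Finset.mem_univ i),
    add_sub_cancel_left, add_sub_cancel_left]
  exact Finset.sum_le_sum fun j _ => h _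

/-- If a matrix is small in one direction and large in the orthogonal ones, its inverse is small
in the orthogonal ones. -/
lemma trace_inv_sub_le {M : Mat d} (hM : M.PosDef) {y A B : ℝ} (hy : 0 < y)
    (hB : 0 < B) (hMy : ∀ x, y * ‖x‖ ^ 2 ≤ sqNorm M x) {v : Vec d} (hv : ‖v‖ = 1)
    (hA : sqNorm M v ≤ A) (hMB : ∀ w, inner ℝ v w = 0 → B * ‖w‖ ^ 2 ≤ sqNorm M w) :
    M⁻¹.trace - sqNorm M⁻¹ v ≤ ((d : ℝ) - 2) / B + A / (y * B) := by
  classical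
  set b := hM.1.eigenvectorBasis with hb
  set ev := hM.1.eigenvalues with hev
  set c : Fin d → ℝ := fun i => inner ℝ (b i) v with hc
  have hMb : ∀ i, mulV M (b i) = ev i • b i := fun i => by
    rw [mulV, hM.1.mulVec_eigenvectorBasis]; rfl
  have hb1 : ∀ i, ‖b i‖ = 1 := fun i => b.orthonormal.1 i
  have hMbs : ∀ i, sqNorm M (b i) = ev i := fun i => by
    rw [sqNorm_eq_inner, hMb, inner_smul_right, real_inner_self_eq_norm_sq, hb1]; ring
  have hevy : ∀ i, y ≤ ev i := fun i => by
    have := hMy (b i)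
    rwa [hb1, hMbs, one_pow, mul_one] at this
  have hev0 : ∀ i, 0 < ev i := fun i => hy.trans_le (hevy i)
  have hMib : ∀ i, mulV M⁻¹ (b i) = (ev i)⁻¹ • b i := fun i => by
    have : b i = mulV M ((ev i)⁻¹ • b i) := by
      rw [mulV_eq, map_smul, ← mulV_eq, hMb, smul_smul, inv_mul_cancel₀ (hev0 i).ne', one_smul]
    conv_lhs => rw [this]
    rw [inv_mulV hM]
  have hMibs : ∀ i, sqNorm M⁻¹ (b i) = (ev i)⁻¹ := fun i => by
    rw [sqNorm_eq_inner, hMib, inner_smul_right, real_inner_self_eq_norm_sq, hb1]; ring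
  have hexp : ∀ N : Mat d, ∀ μ : Fin d → ℝ, (∀ i, mulV N (b i) = μ i • b i) →
      sqNorm N v = ∑ i, μ i * c i ^ 2 := by
    intro N μ hN
    have hvs : v = ∑ i, c i • b i := (b.sum_repr' v).symm
    have h1 : mulV N v = ∑ i, c i • (μ i • b i) := by
      conv_lhs => rw [hvs]
      rw [mulV_eq, map_sum]
      exact Finset.sum_congr rfl fun i _ => by rw [map_smul, ← mulV_eq, hN]
    rw [sqNorm_eq_inner, h1, inner_sum]
    refine Finset.sum_congr rfl fun i _ => ?_
    rw [inner_smul_right, inner_smul_right, real_inner_comm]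
    simp only [hc]; ring
  have hsum : ∑ i, c i ^ 2 = 1 := by
    have := b.sum_sq_inner_right v
    rw [hv] at this
    simpa using this
  have hc1 : ∀ i, c i ^ 2 ≤ 1 := fun i => by
    rw [← hsum]
    exact Finset.single_le_sum (f := fun i => c i ^ 2) (fun j _ => sq_nonneg _) (Finset.mem_univ i)
  -- all eigenvalues but one are large
  have hone : ∀ i j, i ≠ j → ev i < B → ev j < B → False := by
    intro i j hij hi hj
    have hbij : inner ℝ (b i) (b j) = 0 := b.orthonormal.2 hij
    have hbji : inner ℝ (b j) (b i) = 0 := b.orthonormal.2 hij.symm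
    by_cases hci : c i = 0
    · have := hMB (b i) (by rw [real_inner_comm]; exact hci)
      rw [hb1, hMbs] at this
      linarith
    · have hw := hMB (c j • b i - c i • b j) (by
        rw [inner_sub_right, inner_smul_right, inner_smul_right, real_inner_comm, real_inner_comm _ v]
        simp only [hc]; ring)
      have e1 : ‖c j • b i - c i • b j‖ ^ 2 = c j ^ 2 + c i ^ 2 := by
        rw [← real_inner_self_eq_norm_sq]
        simp only [inner_sub_left, inner_sub_right, inner_smul_left, inner_smul_right, hbij, hbji,
          real_inner_self_eq_norm_sq, hb1, conj_trivial]
        ring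
      have e2 : sqNorm M (c j • b i - c i • b j) = ev i * c j ^ 2 + ev j * c i ^ 2 := by
        rw [sqNorm_eq_inner, mulV_eq, map_sub, map_smul, map_smul, ← mulV_eq, ← mulV_eq, hMb, hMb]
        simp only [inner_sub_left, inner_sub_right, inner_smul_left, inner_smul_right, hbij, hbji,
          real_inner_self_eq_norm_sq, hb1, conj_trivial]
        ring
      rw [e1, e2] at hw
      have : 0 < c i ^ 2 := by positivity
      nlinarith [sq_nonneg (c j), mul_pos this (sub_pos.2 hj),
        mul_nonneg (sq_nonneg (c j)) (sub_pos.2 hi).le]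
  obtain ⟨i₀, hi₀⟩ : ∃ i₀, ∀ j, j ≠ i₀ → B ≤ ev j := by
    by_cases hex : ∃ i, ev i < B
    · obtain ⟨i, hi⟩ := hex
      refine ⟨i, fun j hj => ?_⟩
      by_contra! hlt
      exact hone j i hj hlt hi
    · push Not at hex
      obtain ⟨_, i, _⟩ := exists_orthonormalBasis_eq hv
      exact ⟨i, fun j _ => hex j⟩
  have hcard : ((Finset.univ.erase i₀).card : ℝ) = d - 1 := by
    rw [Finset.card_erase_of_mem (Finset.mem_univ _), Finset.card_univ, Fintype.card_fin,
      Nat.cast_sub (by have := i₀.2; omega), Nat.cast_one]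
  have hsum' : ∑ i ∈ Finset.univ.erase i₀, c i ^ 2 = 1 - c i₀ ^ 2 := by
    rw [← hsum, ← Finset.add_sum_erase _ _ (Finset.mem_univ i₀)]; ring
  have hlow : ev i₀ * c i₀ ^ 2 + B * (1 - c i₀ ^ 2) ≤ A := by
    refine le_trans ?_ hA
    rw [hexp M ev hMb, ← Finset.add_sum_erase _ _ (Finset.mem_univ i₀), ← hsum', Finset.mul_sum]
    gcongr with i hi
    exact hi₀ i (Finset.ne_of_mem_erase hi)
  have hup : M⁻¹.trace - sqNorm M⁻¹ v ≤ (1 - c i₀ ^ 2) / ev i₀ + ((d : ℝ) - 2 + c i₀ ^ 2) / B := by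
    rw [trace_eq_sum_sqNorm _ b, hexp _ _ hMib, ← Finset.sum_sub_distrib,
      ← Finset.add_sum_erase _ _ (Finset.mem_univ i₀)]
    have h1 : ∑ i ∈ Finset.univ.erase i₀, (sqNorm M⁻¹ (b i) - (ev i)⁻¹ * c i ^ 2) ≤
        ∑ i ∈ Finset.univ.erase i₀, (1 - c i ^ 2) / B := by
      refine Finset.sum_le_sum fun i hi => ?_
      have hBi := hi₀ i (Finset.ne_of_mem_erase hi)
      have e : sqNorm M⁻¹ (b i) - (ev i)⁻¹ * c i ^ 2 = (1 - c i ^ 2) / ev i := by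
        rw [hMibs]; ring
      rw [e]
      have := sub_nonneg.2 (hc1 i)
      gcongr
    have h2 : ∑ i ∈ Finset.univ.erase i₀, (1 - c i ^ 2) / B = ((d : ℝ) - 2 + c i₀ ^ 2) / B := by
      rw [← Finset.sum_div, Finset.sum_sub_distrib, hsum', Finset.sum_const, nsmul_eq_mul, hcard]
      ring
    rw [h2] at h1
    have e : sqNorm M⁻¹ (b i₀) - (ev i₀)⁻¹ * c i₀ ^ 2 = (1 - c i₀ ^ 2) / ev i₀ := by
      rw [hMibs]; ring
    rw [e]
    linarith
  refine hup.trans ?_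
  have e0 := hev0 i₀
  have hA0 : 0 ≤ A := le_trans (by have := sub_nonneg.2 (hc1 i₀); positivity) hlow
  have h3 : (1 - c i₀ ^ 2) / ev i₀ + c i₀ ^ 2 / B ≤ A / (y * B) := by
    calc (1 - c i₀ ^ 2) / ev i₀ + c i₀ ^ 2 / B
        = (ev i₀ * c i₀ ^ 2 + B * (1 - c i₀ ^ 2)) / (ev i₀ * B) := by field_simp; ring
      _ ≤ A / (y * B) := by
        gcongr
        exact hevy i₀
  rw [add_div]
  linarith

end Spectral

end RONM

/-! ### Numerical estimates for the growth argument. -/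

namespace RONM

open Filter Topology RealInnerProductSpace

section Numerics

/-- The dimensional constant in `Θ`. -/
noncomputable def dimConst (d : ℕ) : ℝ := (Real.sqrt (d * 2 ^ (d - 1)))⁻¹

lemma dimConst_pos {d : ℕ} (hd : 1 ≤ d) : 0 < dimConst d := by
  have : (0 : ℝ) < d := by exact_mod_cast hd
  unfold dimConst; positivity

lemma dimConst_one : dimConst 1 = 1 := by simp [dimConst]

lemma le_two_pow_mul {d : ℕ} (hd : 5 ≤ d) : (d : ℝ) ≤ 0.38 * 2 ^ (d - 1) := by
  induction d, hd using Nat.le_induction with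
  | base => norm_num
  | succ k hk ih =>
    have h5 : (5 : ℝ) ≤ k := by exact_mod_cast hk
    obtain ⟨j, rfl⟩ := Nat.exists_eq_add_of_le hk
    rw [show 5 + j + 1 - 1 = (5 + j - 1) + 1 by omega, pow_succ]
    push_cast at *
    linarith

/-- Here d - 0.852 = (d - 2) + 1.148, where 1.148 bounds (15/14)², the relative growth of the target
over one step from N ≥ 14. -/
lemma dimConst_mul_le {d : ℕ} (hd : 2 ≤ d) : dimConst d * ((d : ℝ) - 0.852) ≤ 0.622 := by
  have hd' : (2 : ℝ) ≤ d := by exact_mod_cast hd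
  have hpos : (0 : ℝ) < d * 2 ^ (d - 1) := by positivity
  rw [dimConst, inv_mul_le_iff₀ (Real.sqrt_pos.2 hpos), mul_comm]
  have key : ((d : ℝ) - 0.852) ^ 2 ≤ 0.622 ^ 2 * (d * 2 ^ (d - 1)) := by
    rcases Nat.lt_or_ge d 5 with h | h
    · interval_cases d <;> norm_num
    · have := le_two_pow_mul h
      nlinarith
  have h0 : (0 : ℝ) ≤ 0.622 * Real.sqrt (d * 2 ^ (d - 1)) := by positivity
  refine abs_le_of_sq_le_sq' ?_ h0 |>.2
  rwa [mul_pow, Real.sq_sqrt hpos.le]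

lemma dimConst_le_half {d : ℕ} (hd : 2 ≤ d) : dimConst d ≤ 1 / 2 := by
  have hd' : (2 : ℝ) ≤ d := by exact_mod_cast hd
  rw [dimConst, one_div]
  refine inv_anti₀ (by norm_num) (Real.le_sqrt_of_sq_le ?_)
  have : (2 : ℝ) ^ 1 ≤ 2 ^ (d - 1) := pow_le_pow_right₀ (by norm_num) (by omega)
  nlinarith

lemma rpow_sub_rpow_le {a b p : ℝ} (ha : 0 < a) (hb : 0 ≤ b) (hp : 1 ≤ p) :
    a ^ p - b ^ p ≤ p * a ^ (p - 1) * (a - b) := by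
  have h1 := one_add_mul_self_le_rpow_one_add (s := (b - a) / a) (by
    rw [le_div_iff₀ ha]; linarith) hp
  have e1 : 1 + (b - a) / a = b / a := by field_simp; ring
  rw [e1, Real.div_rpow hb ha.le, le_div_iff₀ (by positivity)] at h1
  have e2 : a ^ p = a ^ (p - 1) * a := by rw [← Real.rpow_add_one ha.ne']; ring_nf
  rw [e2] at h1 ⊢
  have e3 : (1 + p * ((b - a) / a)) * (a ^ (p - 1) * a) =
      a ^ (p - 1) * a - p * a ^ (p - 1) * (a - b) := by field_simp; ring
  linarith

/-- Telescoping of u^p - (u-1)^p ≤ p u^(p-1), starting at u = 2. -/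
lemma sum_rpow_ge {p : ℝ} (hp : 1 ≤ p) {N : ℕ} (hN : 2 ≤ N) :
    ((N : ℝ) - 1) ^ p - 1 ≤ ∑ u ∈ Finset.Ico 2 N, p * (u : ℝ) ^ (p - 1) := by
  induction N, hN using Nat.le_induction with
  | base => norm_num
  | succ k hk ih =>
    have hk' : (2 : ℝ) ≤ k := by exact_mod_cast hk
    rw [Finset.sum_Ico_succ_top hk]
    have := rpow_sub_rpow_le (a := k) (b := (k : ℝ) - 1) (by linarith) (by linarith) hp
    push_cast
    rw [add_sub_cancel_right]
    rw [sub_sub_cancel, mul_one] at this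
    linarith

/-- Applied with x = N + 1, this absorbs the index shift of `sum_rpow_ge` into the initial jump.
Equality holds at x = 15, p = 2. -/
lemma rpow_shift_le {p x : ℝ} (hp2 : p ≤ 2) (hx : 15 ≤ x) :
    0.82 * x ^ p ≤ 15.5 + (x - 2) ^ p := by
  have hx0 : 0 < x := by linarith
  have h1 : ((x - 2) / x) ^ (2 : ℝ) ≤ ((x - 2) / x) ^ p :=
    Real.rpow_le_rpow_of_exponent_ge (by apply div_pos <;> linarith)
      ((div_le_one hx0).2 (by linarith)) hp2
  have h2 : x ^ p ≤ x ^ (2 : ℝ) := Real.rpow_le_rpow_of_exponent_le (by linarith) hp2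
  rw [Real.div_rpow (by linarith) hx0.le p, le_div_iff₀ (by positivity)] at h1
  rw [Real.rpow_two] at h1 h2
  have h3 : 0.82 - ((x - 2) / x) ^ 2 ≤ 15.5 / x ^ 2 := by
    rw [le_div_iff₀ (by positivity), sub_mul, div_pow, div_mul_cancel₀ _ (by positivity)]
    nlinarith
  have h4 : (0.82 - ((x - 2) / x) ^ 2) * x ^ p ≤ 15.5 := by
    calc _ ≤ 15.5 / x ^ 2 * x ^ p := by gcongr
      _ ≤ 15.5 / x ^ 2 * x ^ 2 := by gcongr
      _ = 15.5 := by field_simp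
  linarith

/-- The exponent 1 - ℓ/2 is at most 1/2, so halving the induction bound from 1/8 to 1/16 costs at
most a factor 4. -/
lemma sixteen_rpow_bound {ℓ : ℝ} (h1 : 1 < ℓ) : 15 / 8 * (2 / ℓ) ≤ 15 * ℓ * (1 / 16) ^ (1 - ℓ / 2) := by
  have h3 : (1 / 16 : ℝ) ^ (1 / 2 : ℝ) ≤ (1 / 16) ^ (1 - ℓ / 2) :=
    Real.rpow_le_rpow_of_exponent_ge (by norm_num) (by norm_num) (by linarith)
  have h4 : (1 / 16 : ℝ) ^ (1 / 2 : ℝ) = 1 / 4 := by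
    rw [← Real.sqrt_eq_rpow, show (1 / 16 : ℝ) = (1 / 4) ^ 2 by norm_num, Real.sqrt_sq (by norm_num)]
  rw [h4] at h3
  have : 15 / 8 * (2 / ℓ) ≤ 15 * ℓ * (1 / 4) := by
    rw [← mul_div_assoc, div_le_iff₀ (by linarith)]; nlinarith
  refine this.trans ?_
  gcongr

end Numerics

/-! ### The deterministic growth recursion. -/

section Growth

variable {d : ℕ}

/-- The conditions on the quadratic forms `q u` of the precision bounds and on their increments
`g u` under which `q u` grows at the rate `u ^ (2 / ℓ)`. -/
structure GrowthData (d : ℕ) (ρ ℓ Θ C : ℝ) (t : ℕ) (q g : ℕ → Vec d → ℝ) : Prop where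
  one_le : 1 ≤ d
  rho_pos : 0 < ρ
  rho_le : ρ ≤ 1
  one_lt : 1 < ℓ
  le_two : ℓ ≤ 2
  theta_pos : 0 < Θ
  const_eq : C * (dimConst d * ρ ^ (d - 1)) = 15 * ℓ * Θ ^ (ℓ / 2)
  homogeneous : ∀ u (c : ℝ) x, q u (c • x) = c ^ 2 * q u x
  nonneg : ∀ u, 1 ≤ u → u ≤ t → ∀ v, 0 ≤ g u v
  init : ∀ v, ‖v‖ = 1 → Θ ≤ q 1 v
  succ : ∀ u, 1 ≤ u → ∀ v, ‖v‖ = 1 → q u v + g u v ≤ q (u + 1) v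
  first : 1 ≤ t → ∀ v, ‖v‖ = 1 → 0.875 * (C * Θ ^ (1 - ℓ / 2)) ≤ g 1 v
  pair : 2 ≤ d → ∀ u, 2 ≤ u → u ≤ t → ∀ z, 0 < z → (∀ x, z * ‖x‖ ^ 2 ≤ 1 / 2 * q u x) →
    ∀ v w, ‖v‖ = 1 → ‖w‖ = 1 → inner ℝ v w = 0 →
      0.765 * (C * z ^ (1 - ℓ / 2)) * ρ ^ (2 - ℓ) ≤ g u v + g u w
  line : d = 1 → ∀ u, 2 ≤ u → u ≤ t → ∀ z, 0 < z → (∀ x, z * ‖x‖ ^ 2 ≤ 1 / 2 * q u x) →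
    ∀ v, ‖v‖ = 1 → C * z ^ (1 - ℓ / 2) * ρ ^ (d - 1) * 0.0827 ≤ g u v
  single : 2 ≤ d → ∀ u, 2 ≤ u → u ≤ t → ∀ z, 0 < z → (∀ x, z * ‖x‖ ^ 2 ≤ 1 / 2 * q u x) →
    ∀ v, ‖v‖ = 1 → ∀ Y B, q u v ≤ Y → 0 < B → (∀ w, inner ℝ v w = 0 → B * ‖w‖ ^ 2 ≤ q u w) →
      C * z ^ (1 - ℓ / 2) * ρ ^ (d - 1) *
        (0.0827 - 0.2 * (3 * Y / B * ((d : ℝ) - 2 + Y / (2 * z)))) ≤ g u v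

namespace GrowthData

variable {ρ ℓ Θ C : ℝ} {t : ℕ} {q g : ℕ → Vec d → ℝ} (h : GrowthData d ρ ℓ Θ C t q g)
include h

lemma exponent_bounds : 1 ≤ 2 / ℓ ∧ 2 / ℓ ≤ 2 := by
  have h1 := h.one_lt
  have h2 := h.le_two
  exact ⟨(one_le_div (by linarith)).2 h2, (div_le_iff₀ (by linarith)).2 (by linarith)⟩

/-- The size of the increments when the form has grown to `Θ u ^ (2 / ℓ) / 8`. -/
lemma const_mul_ge {u : ℕ} (hu : 1 ≤ u) :
    15 / 8 * (2 / ℓ * (u : ℝ) ^ (2 / ℓ - 1)) * Θ ≤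
      C * (Θ * (u : ℝ) ^ (2 / ℓ) / 16) ^ (1 - ℓ / 2) * (dimConst d * ρ ^ (d - 1)) := by
  have hΘ := h.theta_pos
  have hℓ : 0 < ℓ := by linarith [h.one_lt]
  have hu0 : (0 : ℝ) < u := by exact_mod_cast hu
  have e1 : (Θ * (u : ℝ) ^ (2 / ℓ) / 16) ^ (1 - ℓ / 2) =
      Θ ^ (1 - ℓ / 2) * (u : ℝ) ^ (2 / ℓ - 1) * (1 / 16) ^ (1 - ℓ / 2) := by
    rw [div_eq_mul_one_div, Real.mul_rpow (by positivity) (by norm_num),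
      Real.mul_rpow hΘ.le (by positivity), ← Real.rpow_mul hu0.le]
    congr 3
    field_simp
  have e2 : Θ ^ (ℓ / 2) * Θ ^ (1 - ℓ / 2) = Θ := by
    rw [← Real.rpow_add hΘ, add_sub_cancel, Real.rpow_one]
  have e3 : C * (Θ * (u : ℝ) ^ (2 / ℓ) / 16) ^ (1 - ℓ / 2) * (dimConst d * ρ ^ (d - 1)) =
      15 * ℓ * (1 / 16) ^ (1 - ℓ / 2) * ((u : ℝ) ^ (2 / ℓ - 1) * Θ) := by
    rw [e1]
    calc _ = C * (dimConst d * ρ ^ (d - 1)) * (Θ ^ (1 - ℓ / 2) * (u : ℝ) ^ (2 / ℓ - 1) *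
          (1 / 16) ^ (1 - ℓ / 2)) := by ring
      _ = 15 * ℓ * (1 / 16) ^ (1 - ℓ / 2) * ((u : ℝ) ^ (2 / ℓ - 1) *
            (Θ ^ (ℓ / 2) * Θ ^ (1 - ℓ / 2))) := by rw [h.const_eq]; ring
      _ = _ := by rw [e2]
  rw [e3, ← mul_assoc, mul_assoc _ _ Θ]
  refine mul_le_mul_of_nonneg_right (sixteen_rpow_bound h.one_lt) (by positivity)

lemma kappa_pos : 0 < dimConst d * ρ ^ (d - 1) :=
  mul_pos (dimConst_pos h.one_le) (pow_pos h.rho_pos _)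

lemma mono {a b : ℕ} (ha : 1 ≤ a) (hab : a ≤ b) (hb : b ≤ t + 1) {v : Vec d} (hv : ‖v‖ = 1) :
    q a v + ∑ u ∈ Finset.Ico a b, g u v ≤ q b v := by
  induction b, hab using Nat.le_induction with
  | base => simp
  | succ k hk ih =>
    rw [Finset.sum_Ico_succ_top hk, ← add_assoc]
    exact le_trans (by linarith [ih (by omega)]) (h.succ k (by omega) v hv)

/-- The jump of the first round is free of the loss dimConst · ρ^(d-1), hence large by its inverse;
13 rounds down 0.875 · 15. -/
lemma two_ge (ht : 1 ≤ t) {v : Vec d} (hv : ‖v‖ = 1) :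
    Θ * (1 + 13 * ℓ / (dimConst d * ρ ^ (d - 1))) ≤ q 2 v := by
  have h1 := h.succ 1 le_rfl v hv
  have h2 := h.init v hv
  have h3 := h.first ht v hv
  have hκ := h.kappa_pos
  have hΘ := h.theta_pos
  have hℓ : 0 < ℓ := by linarith [h.one_lt]
  have e2 : Θ ^ (ℓ / 2) * Θ ^ (1 - ℓ / 2) = Θ := by
    rw [← Real.rpow_add hΘ, add_sub_cancel, Real.rpow_one]
  have e : C * Θ ^ (1 - ℓ / 2) = Θ * (15 * ℓ / (dimConst d * ρ ^ (d - 1))) := by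
    rw [← mul_div_assoc, eq_div_iff hκ.ne']
    calc _ = C * (dimConst d * ρ ^ (d - 1)) * Θ ^ (1 - ℓ / 2) := by ring
      _ = 15 * ℓ * (Θ ^ (ℓ / 2) * Θ ^ (1 - ℓ / 2)) := by rw [h.const_eq]; ring
      _ = _ := by rw [e2]; ring
  rw [e] at h3
  have h4 : Θ * (13 * ℓ / (dimConst d * ρ ^ (d - 1))) ≤
      0.875 * (Θ * (15 * ℓ / (dimConst d * ρ ^ (d - 1)))) := by
    have : 0 ≤ Θ * (ℓ / (dimConst d * ρ ^ (d - 1))) := by positivity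
    have e5 : Θ * (13 * ℓ / (dimConst d * ρ ^ (d - 1))) =
      13 * (Θ * (ℓ / (dimConst d * ρ ^ (d - 1)))) := by ring
    have e6 : 0.875 * (Θ * (15 * ℓ / (dimConst d * ρ ^ (d - 1)))) =
      13.125 * (Θ * (ℓ / (dimConst d * ρ ^ (d - 1)))) := by ring
    rw [e5, e6]
    linarith
  rw [mul_add, mul_one]
  linarith

lemma scale_bound {u : ℕ} (hIH : ∀ v, ‖v‖ = 1 → Θ * (u : ℝ) ^ (2 / ℓ) / 8 ≤ q u v) (x : Vec d) :
    Θ * (u : ℝ) ^ (2 / ℓ) / 16 * ‖x‖ ^ 2 ≤ 1 / 2 * q u x := by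
  by_cases hx : x = 0
  · have := h.homogeneous u 0 0
    rw [zero_smul] at this
    rw [hx, this]; simp
  · have hn : 0 < ‖x‖ := norm_pos_iff.2 hx
    have h1 := hIH (‖x‖⁻¹ • x) (by rw [norm_smul, norm_inv, norm_norm, inv_mul_cancel₀ hn.ne'])
    rw [h.homogeneous, inv_pow, ← div_eq_inv_mul, le_div_iff₀ (by positivity)] at h1
    linarith

/-- Growth in the step, given a lower bound for the fraction of the curvature that is seen. -/
lemma step_of_fraction {N : ℕ} (hN : 2 ≤ N) {v : Vec d} (hv : ‖v‖ = 1)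
    (hqN : Θ * (N : ℝ) ^ (2 / ℓ) / 8 ≤ q N v) {p : ℝ}
    (hp : C * (Θ * (N : ℝ) ^ (2 / ℓ) / 16) ^ (1 - ℓ / 2) * ρ ^ (d - 1) * p ≤ g N v)
    (hp2 : dimConst d * (((N : ℝ) + 1) / N) ≤ 15 * p) :
    Θ * ((N + 1 : ℕ) : ℝ) ^ (2 / ℓ) / 8 ≤ q (N + 1) v := by
  obtain ⟨hp1, hp3⟩ := h.exponent_bounds
  have hΘ := h.theta_pos
  have hκ := dimConst_pos h.one_le
  have hN0 : (2 : ℝ) ≤ N := by exact_mod_cast hN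
  have hp0 : 0 ≤ p := by
    have : 0 < dimConst d * (((N : ℝ) + 1) / N) := by positivity
    linarith
  have hs := h.succ N (by omega) v hv
  -- The full rate exceeds what the target needs by a factor 15 up to `dimConst d`; a fraction p of
  -- it is enough once 15p also covers the ratio (N+1)/N.
  have hc := h.const_mul_ge (u := N) (by omega)
  have hdiff := rpow_sub_rpow_le (a := (N : ℝ) + 1) (b := N) (by linarith) (by linarith) hp1
  rw [add_sub_cancel_left, mul_one] at hdiff
  set α := 2 / ℓ - 1 with hα
  have hα0 : 0 ≤ α := by rw [hα]; linarith
  have hα1 : α ≤ 1 := by rw [hα]; linarith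
  have hratio : ((N : ℝ) + 1) ^ α ≤ (N : ℝ) ^ α * (((N : ℝ) + 1) / N) := by
    have h1 : 1 ≤ ((N : ℝ) + 1) / N := (one_le_div (by linarith)).2 (by linarith)
    have h2 : (((N : ℝ) + 1) / N) ^ α ≤ ((N : ℝ) + 1) / N := by
      conv_rhs => rw [← Real.rpow_one (((N : ℝ) + 1) / N)]
      exact Real.rpow_le_rpow_of_exponent_le h1 hα1
    rw [Real.div_rpow (by linarith) (by linarith), div_le_iff₀ (by positivity)] at h2
    linarith
  set V := C * (Θ * (N : ℝ) ^ (2 / ℓ) / 16) ^ (1 - ℓ / 2) * ρ ^ (d - 1) with hV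
  have hc' : 15 / 8 * (2 / ℓ * (N : ℝ) ^ α) * Θ ≤ V * dimConst d := by
    rw [hV]; linarith
  have hc2 : 2 / ℓ * (N : ℝ) ^ α * Θ * (((N : ℝ) + 1) / N) ≤ 8 * (V * p) := by
    have h1 := mul_le_mul_of_nonneg_right hc' hp0
    have hnn : 0 ≤ 2 / ℓ * (N : ℝ) ^ α * Θ := by positivity
    have h2 := mul_le_mul_of_nonneg_left hp2 hnn
    refine le_of_mul_le_mul_left ?_ hκ
    calc dimConst d * (2 / ℓ * (N : ℝ) ^ α * Θ * (((N : ℝ) + 1) / N))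
        = 2 / ℓ * (N : ℝ) ^ α * Θ * (dimConst d * (((N : ℝ) + 1) / N)) := by ring
      _ ≤ 2 / ℓ * (N : ℝ) ^ α * Θ * (15 * p) := h2
      _ = 8 * (15 / 8 * (2 / ℓ * (N : ℝ) ^ α) * Θ * p) := by ring
      _ ≤ 8 * (V * dimConst d * p) := by linarith
      _ = _ := by ring
  have h5 : 2 / ℓ * ((N : ℝ) + 1) ^ α * Θ ≤ 2 / ℓ * (N : ℝ) ^ α * Θ * (((N : ℝ) + 1) / N) := by
    calc _ ≤ 2 / ℓ * ((N : ℝ) ^ α * (((N : ℝ) + 1) / N)) * Θ := by gcongr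
      _ = _ := by ring
  have h6 := mul_le_mul_of_nonneg_right hdiff hΘ.le
  push_cast
  linarith

/-- Lower bound in the directions orthogonal to a direction of slow growth. -/
lemma orthogonal_ge (hd : 2 ≤ d) {N : ℕ} (hN : 14 ≤ N) (hNt : N ≤ t)
    (hIH : ∀ u, 2 ≤ u → u ≤ N → ∀ v, ‖v‖ = 1 → Θ * (u : ℝ) ^ (2 / ℓ) / 8 ≤ q u v)
    {v w : Vec d} (hv : ‖v‖ = 1) (hw : ‖w‖ = 1) (hvw : inner ℝ v w = 0) :
    9.4 * (Θ * ((N : ℝ) + 1) ^ (2 / ℓ) / 8) ≤ dimConst d * (q N v + q N w) := by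
  obtain ⟨hp1, hp3⟩ := h.exponent_bounds
  have hΘ := h.theta_pos
  have hκ := dimConst_pos h.one_le
  have hρ := h.rho_pos
  have hℓ := h.one_lt
  have hN0 : (14 : ℝ) ≤ N := by exact_mod_cast hN
  have hmv := h.mono (a := 2) (b := N) (by omega) (by omega) (by omega) hv
  have hmw := h.mono (a := 2) (b := N) (by omega) (by omega) (by omega) hw
  have h2v := h.two_ge (by omega) hv
  have h2w := h.two_ge (by omega) hw
  have hρ1 : ρ ^ (d - 1) ≤ 1 := pow_le_one₀ hρ.le h.rho_le
  have hstart : 13 * Θ ≤ dimConst d * (Θ * (1 + 13 * ℓ / (dimConst d * ρ ^ (d - 1)))) := by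
    have e : dimConst d * (Θ * (1 + 13 * ℓ / (dimConst d * ρ ^ (d - 1)))) =
        dimConst d * Θ + Θ * (13 * ℓ / ρ ^ (d - 1)) := by field_simp
    have h1 : 13 ≤ 13 * ℓ / ρ ^ (d - 1) := by
      rw [le_div_iff₀ (by positivity)]; nlinarith [pow_pos hρ (d - 1)]
    rw [e]
    nlinarith [mul_le_mul_of_nonneg_left h1 hΘ.le, mul_pos hκ hΘ]
  -- 1.434 rounds down 0.765 · 15/8. The weaker loss ρ^(2-ℓ) is at least ρ^(d-1) since d ≥ 2 and ℓ >
  -- 1.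
  have hterm : ∀ u ∈ Finset.Ico 2 N, 1.434 * Θ * (2 / ℓ * (u : ℝ) ^ (2 / ℓ - 1)) ≤
      dimConst d * (g u v + g u w) := by
    intro u hu
    obtain ⟨hu2, huN⟩ := Finset.mem_Ico.1 hu
    have hu0 : (0 : ℝ) < u := by exact_mod_cast (by omega : 0 < u)
    have h1 := h.pair hd u hu2 (by omega) (Θ * (u : ℝ) ^ (2 / ℓ) / 16) (by positivity)
      (h.scale_bound (hIH u hu2 huN.le)) v w hv hw hvw
    have h2 := h.const_mul_ge (u := u) (by omega)
    have hpow : ρ ^ (d - 1) ≤ ρ ^ (2 - ℓ) := by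
      rw [← Real.rpow_natCast]
      refine Real.rpow_le_rpow_of_exponent_ge hρ h.rho_le ?_
      have : (1 : ℝ) ≤ ((d - 1 : ℕ) : ℝ) := by exact_mod_cast (by omega : 1 ≤ d - 1)
      linarith
    set V := C * (Θ * (u : ℝ) ^ (2 / ℓ) / 16) ^ (1 - ℓ / 2) with hV
    have hX0 : 0 ≤ 2 / ℓ * (u : ℝ) ^ (2 / ℓ - 1) := by positivity
    have hV0 : 0 ≤ V := by
      by_contra! hneg
      have : V * (dimConst d * ρ ^ (d - 1)) < 0 := mul_neg_of_neg_of_pos hneg h.kappa_pos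
      have : 0 ≤ 15 / 8 * (2 / ℓ * (u : ℝ) ^ (2 / ℓ - 1)) * Θ := by positivity
      linarith
    have h3 : V * (dimConst d * ρ ^ (d - 1)) ≤ V * (dimConst d * ρ ^ (2 - ℓ)) := by gcongr
    have h4 := mul_le_mul_of_nonneg_left h1 hκ.le
    have h5 : 0 ≤ 2 / ℓ * (u : ℝ) ^ (2 / ℓ - 1) * Θ := by positivity
    linarith
  have hsum := Finset.sum_le_sum hterm
  rw [← Finset.mul_sum, ← Finset.mul_sum (f := fun u => g u v + g u w),
    Finset.sum_add_distrib] at hsum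
  -- The two initial jumps give 26Θ, enough for 1.434 · (1 + 15.5); what remains is 1.434 · 0.82 ≥
  -- 9.4/8.
  have hge := mul_le_mul_of_nonneg_left (sum_rpow_ge hp1 (by omega : 2 ≤ N))
    (by positivity : 0 ≤ 1.434 * Θ)
  have hsh := rpow_shift_le hp3 (x := (N : ℝ) + 1) (by linarith)
  rw [show (N : ℝ) + 1 - 2 = N - 1 by ring] at hsh
  have hsh' := mul_le_mul_of_nonneg_left hsh hΘ.le
  have h7 := mul_le_mul_of_nonneg_left (add_le_add hmv hmw) hκ.le
  have h8 := mul_le_mul_of_nonneg_left h2v hκ.le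
  have h9 := mul_le_mul_of_nonneg_left h2w hκ.le
  have h10 : 0 ≤ Θ * ((N : ℝ) + 1) ^ (2 / ℓ) := by positivity
  linarith

/-- The form never falls below its value after the first jump, so a shortfall can occur only once n²
is large. -/
lemma large_of_lt {n : ℕ} (hn : 2 ≤ n) (hnt : n ≤ t + 1) {v : Vec d} (hv : ‖v‖ = 1)
    (hlt : q n v < Θ * (n : ℝ) ^ (2 / ℓ) / 8) : 8 * (1 + 13 / dimConst d) < (n : ℝ) ^ 2 := by
  obtain ⟨hp1, hp3⟩ := h.exponent_bounds
  have hΘ := h.theta_pos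
  have hκ := dimConst_pos h.one_le
  have hn0 : (2 : ℝ) ≤ n := by exact_mod_cast hn
  have h1 := h.two_ge (by omega) hv
  have h2 := h.mono (a := 2) (b := n) (by omega) hn hnt hv
  have h3 : 0 ≤ ∑ u ∈ Finset.Ico 2 n, g u v := Finset.sum_nonneg fun u hu =>
    h.nonneg u (by have := (Finset.mem_Ico.1 hu).1; omega)
      (by have := (Finset.mem_Ico.1 hu).2; omega) v
  have h4 : 13 / dimConst d ≤ 13 * ℓ / (dimConst d * ρ ^ (d - 1)) := by
    rw [div_le_div_iff₀ hκ h.kappa_pos]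
    have hρ1 : ρ ^ (d - 1) ≤ 1 := pow_le_one₀ h.rho_pos.le h.rho_le
    have := h.one_lt
    have h5 : dimConst d * ρ ^ (d - 1) ≤ ℓ * dimConst d := by
      rw [mul_comm]; gcongr; linarith
    linarith
  have h5 : (n : ℝ) ^ (2 / ℓ) ≤ (n : ℝ) ^ 2 := by
    rw [← Real.rpow_two]
    exact Real.rpow_le_rpow_of_exponent_le (by linarith) hp3
  have h6 : Θ * (1 + 13 / dimConst d) < Θ * ((n : ℝ) ^ 2 / 8) := by
    calc _ ≤ Θ * (1 + 13 * ℓ / (dimConst d * ρ ^ (d - 1))) := by gcongr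
      _ < Θ * (n : ℝ) ^ (2 / ℓ) / 8 := by linarith
      _ ≤ _ := by rw [mul_div_assoc]; gcongr
  have := lt_of_mul_lt_mul_left h6 hΘ.le
  linarith

/-- Strong induction by contradiction. A shortfall at N + 1 forces N ≥ 10 if d = 1 and N ≥ 14
otherwise. In dimension one the single-direction bound has no lateral term. Otherwise the slow
direction v makes all orthogonal directions fast, so the lateral term is at most 0.21. -/
theorem growth {n : ℕ} (hn : 2 ≤ n) (hnt : n ≤ t + 1) :
    ∀ v, ‖v‖ = 1 → Θ * (n : ℝ) ^ (2 / ℓ) / 8 ≤ q n v := by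
  induction n using Nat.strong_induction_on with
  | _ n ih =>
  intro v hv
  obtain ⟨hp1, hp3⟩ := h.exponent_bounds
  have hΘ := h.theta_pos
  have hκ := dimConst_pos h.one_le
  by_contra! hlt
  have hlarge := h.large_of_lt hn hnt hv hlt
  obtain ⟨N, rfl⟩ : ∃ N, n = N + 1 := ⟨n - 1, by omega⟩
  rcases (by have := h.one_le; omega : d = 1 ∨ 2 ≤ d) with hd | hd
  · have hκ1 : dimConst d = 1 := by rw [hd, dimConst_one]
    rw [hκ1] at hlarge
    have hN : 10 ≤ N := by
      by_contra! hc
      have : ((N + 1 : ℕ) : ℝ) ≤ 10 := by exact_mod_cast (by omega : N + 1 ≤ 10)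
      have h0 : (0 : ℝ) ≤ ((N + 1 : ℕ) : ℝ) := by positivity
      nlinarith
    have hN0 : (10 : ℝ) ≤ N := by exact_mod_cast hN
    have hIH := ih N (by omega) (by omega) (by omega)
    refine absurd (h.step_of_fraction (by omega) hv (hIH v hv) (p := 0.0827)
      (h.line hd N (by omega) (by omega) _ (by positivity) (h.scale_bound hIH) v hv) ?_) (not_le.2 hlt)
    rw [hκ1, one_mul, div_le_iff₀ (by linarith)]
    linarith
  · have hκ2 := dimConst_le_half hd
    have h26 : 26 ≤ 13 / dimConst d := by
      rw [le_div_iff₀ hκ]; linarith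
    have hN : 14 ≤ N := by
      by_contra! hc
      have : ((N + 1 : ℕ) : ℝ) ≤ 14 := by exact_mod_cast (by omega : N + 1 ≤ 14)
      have h0 : (0 : ℝ) ≤ ((N + 1 : ℕ) : ℝ) := by positivity
      nlinarith
    have hN0 : (14 : ℝ) ≤ N := by exact_mod_cast hN
    have hIH := ih N (by omega) (by omega) (by omega)
    -- The missed target. By monotonicity q N v is below it, so `orthogonal_ge` attributes the rest
    -- of the pair sum to the orthogonal direction, which yields B.
    set Y := Θ * ((N + 1 : ℕ) : ℝ) ^ (2 / ℓ) / 8 with hY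
    have hY0 : 0 < Y := by positivity
    have hqN : q N v ≤ Y := by
      have := h.succ N (by omega) v hv
      have := h.nonneg N (by omega) (by omega) v
      linarith
    set B := Y * (9.4 / dimConst d - 1) with hB
    have h18 : 18.8 ≤ 9.4 / dimConst d := by
      rw [le_div_iff₀ hκ]; linarith
    have hB0 : 0 < B := mul_pos hY0 (by linarith)
    have horth : ∀ w, inner ℝ v w = 0 → B * ‖w‖ ^ 2 ≤ q N w := by
      intro w hw
      by_cases hw0 : w = 0
      · have := h.homogeneous N 0 0
        rw [zero_smul] at this
        rw [hw0, this]; simp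
      have hn : 0 < ‖w‖ := norm_pos_iff.2 hw0
      have h1 := h.orthogonal_ge hd hN (by omega) (fun u hu2 huN => ih u (by omega) hu2 (by omega))
        hv (w := ‖w‖⁻¹ • w) (by rw [norm_smul, norm_inv, norm_norm, inv_mul_cancel₀ hn.ne'])
        (by rw [inner_smul_right, hw, mul_zero])
      have h2 : B ≤ q N (‖w‖⁻¹ • w) := by
        have e : Θ * ((N : ℝ) + 1) ^ (2 / ℓ) / 8 = Y := by rw [hY]; push_cast; rfl
        rw [e] at h1
        have h3 : Y * (9.4 / dimConst d) ≤ q N v + q N (‖w‖⁻¹ • w) := by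
          rw [← mul_div_assoc, div_le_iff₀ hκ]; linarith
        rw [hB, mul_sub, mul_one]; linarith
      rw [h.homogeneous, inv_pow, ← div_eq_inv_mul, le_div_iff₀ (by positivity)] at h2
      exact h2
    have hz0 : 0 < Θ * (N : ℝ) ^ (2 / ℓ) / 16 := by positivity
    have hsingle := h.single hd N (by omega) (by omega) _ hz0 (h.scale_bound hIH) v hv Y B hqN hB0 horth
    refine absurd (h.step_of_fraction (by omega) hv (hIH v hv) hsingle ?_) (not_le.2 hlt)
    have hYz : Y / (2 * (Θ * (N : ℝ) ^ (2 / ℓ) / 16)) ≤ 1.148 := by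
      have e : Y / (2 * (Θ * (N : ℝ) ^ (2 / ℓ) / 16)) = (((N : ℝ) + 1) / N) ^ (2 / ℓ) := by
        rw [Real.div_rpow (by linarith) (by linarith), hY]
        push_cast
        field_simp
        ring
      rw [e]
      have h1 : 1 ≤ ((N : ℝ) + 1) / N := (one_le_div (by linarith)).2 (by linarith)
      refine (Real.rpow_le_rpow_of_exponent_le h1 hp3).trans ?_
      rw [Real.rpow_two]
      have h2 : ((N : ℝ) + 1) / N ≤ 15 / 14 := by
        rw [div_le_div_iff₀ (by linarith) (by norm_num)]; linarith
      have h3 : (0 : ℝ) ≤ ((N : ℝ) + 1) / N := by linarith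
      nlinarith
    have hdR : (2 : ℝ) ≤ d := by exact_mod_cast hd
    have hT : 3 * Y / B * ((d : ℝ) - 2 + Y / (2 * (Θ * (N : ℝ) ^ (2 / ℓ) / 16))) ≤ 0.21 := by
      have e : 3 * Y / B = 3 * dimConst d / (9.4 - dimConst d) := by
        have : 9.4 - dimConst d ≠ 0 := by linarith
        have : 9.4 / dimConst d - 1 ≠ 0 := by linarith
        rw [hB]
        field_simp
      have hpos : 0 < 9.4 - dimConst d := by linarith
      have h4 := dimConst_mul_le hd
      calc _ ≤ 3 * Y / B * ((d : ℝ) - 2 + 1.148) := by gcongr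
        _ = 3 * (dimConst d * ((d : ℝ) - 0.852)) / (9.4 - dimConst d) := by rw [e]; ring
        _ ≤ 3 * 0.622 / (9.4 - dimConst d) := by gcongr
        _ ≤ 0.21 := by
          rw [div_le_iff₀ hpos]; linarith
    have h2 : ((N : ℝ) + 1) / N ≤ 15 / 14 := by
      rw [div_le_div_iff₀ (by linarith) (by norm_num)]; linarith
    have h3 : dimConst d * (((N : ℝ) + 1) / N) ≤ 1 / 2 * (15 / 14) := by gcongr
    linarith

end GrowthData

end Growth

end RONM

/-! ### From the run of the algorithm to the growth recursion. -/

namespace RONM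

open Filter Topology RealInnerProductSpace

section Scale

variable {d : ℕ}

/-- The run stores the precision and obtains the covariance by the total matrix inverse; positive
definiteness of the latter shows that this is a genuine inverse. -/
lemma posDef_of_inv {P : Mat d} (h : (P⁻¹).PosDef) : P.PosDef ∧ P⁻¹⁻¹ = P := by
  have hu : IsUnit P⁻¹.det := (Matrix.isUnit_iff_isUnit_det _).1 h.isUnit
  have e : P⁻¹⁻¹ = P := Matrix.nonsing_inv_nonsing_inv P (Matrix.isUnit_nonsing_inv_det_iff.1 hu)
  exact ⟨by simpa [e] using h.inv, e⟩

lemma posDef_smul_one {c : ℝ} (hc : 0 < c) : (c • (1 : Mat d)).PosDef :=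
  Matrix.PosDef.smul Matrix.PosDef.one hc

lemma sqNorm_inv_le_of_le {P : Mat d} (hP : P.PosDef) {z : ℝ} (hz : 0 < z)
    (h : ∀ x, z * ‖x‖ ^ 2 ≤ sqNorm P x) (x : Vec d) :
    sqNorm P⁻¹ x ≤ (Real.sqrt z)⁻¹ ^ 2 * ‖x‖ ^ 2 := by
  set y := mulV P⁻¹ x with hy
  have hPy : mulV P y = x := mulV_inv hP x
  have h1 := h y
  rw [sqNorm_eq_inner, hPy, real_inner_comm] at h1
  rw [sqNorm_eq_inner, ← hy, inv_pow, Real.sq_sqrt hz.le, inv_mul_eq_div, le_div_iff₀ hz]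
  have h2 := real_inner_le_norm x y
  nlinarith [sq_nonneg (‖x‖ - z * ‖y‖)]

lemma trace_sub_nonneg {S : Mat d} (hS : S.PosDef) {v : Vec d} (hv : ‖v‖ = 1) :
    0 ≤ S.trace - sqNorm S v := by
  have := trace_sub_le (S := 0) (T := S) (fun x => by
    have : sqNorm (0 : Mat d) x = 0 := by simp [sqNorm]
    rw [this, ← norm_sqrtOp_sq hS]; positivity) hv
  simpa [sqNorm] using this

lemma trace_sub_eq_zero_of_dim_one (hd : d = 1) (S : Mat d) {v : Vec d} (hv : ‖v‖ = 1) :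
    S.trace - sqNorm S v = 0 := by
  obtain ⟨b, i, rfl⟩ := exists_orthonormalBasis_eq hv
  rw [trace_eq_sum_sqNorm S b, Finset.sum_eq_single i (fun j _ hj => absurd (Fin.ext (by omega)) hj)
    (by simp), sub_self]

/-- The radius of the confidence region at precision `z`. -/
lemma radius_rpow {lam L z ℓ : ℝ} (hlam : 0 < lam) (hL : 0 < L) (hz : 0 < z) :
    ((Real.sqrt z)⁻¹ / (lam * L)) ^ (ℓ - 2) = (lam * L) ^ (2 - ℓ) * z ^ (1 - ℓ / 2) := by
  have hlL : 0 < lam * L := mul_pos hlam hL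
  rw [Real.div_rpow (by positivity) hlL.le, Real.inv_rpow (by positivity), Real.sqrt_eq_rpow,
    ← Real.rpow_mul hz.le, ← Real.rpow_neg hz.le, div_eq_mul_inv, ← Real.rpow_neg hlL.le, mul_comm]
  congr 2 <;> ring

lemma radius_ge {lam L : ℝ} (hd : 1 ≤ d) (hlam : 0 < lam) (hL : 0 < L)
    (hlamL : lam ≤ 1 / (10 * d * L)) {s : ℝ} (hs : 0 < s) : 10 * d * s ≤ s / (lam * L) := by
  have hd0 : (0 : ℝ) < d := by exact_mod_cast hd
  rw [le_div_iff₀ (by positivity)]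
  rw [le_div_iff₀ (by positivity)] at hlamL
  nlinarith

lemma inv_sqrt_le {sig z : ℝ} (hσ : 0 < sig) (hzσ : (sig ^ 2)⁻¹ / 2 ≤ z) :
    (Real.sqrt z)⁻¹ ≤ Real.sqrt 2 * sig := by
  have h2 : 0 < Real.sqrt 2 * sig := by positivity
  rw [inv_le_comm₀ (Real.sqrt_pos.2 (lt_of_lt_of_le (by positivity) hzσ)) h2]
  refine Real.le_sqrt_of_sq_le ?_
  rw [inv_pow, mul_pow, Real.sq_sqrt (by norm_num)]
  refine le_of_eq_of_le ?_ hzσ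
  field_simp

lemma norm_sub_le_radius {P : Mat d} {y : Vec d} {lam L z : ℝ} (hlam : 0 < lam) (hL : 0 < L)
    (hz : 0 < z) (h : z * ‖y‖ ^ 2 ≤ sqNorm P y)
    (hpot : 1 / 2 * sqNorm P y ≤ 1 / (2 * lam ^ 2 * L ^ 2)) :
    ‖y‖ ≤ (Real.sqrt z)⁻¹ / (lam * L) := by
  have h0 : 0 ≤ (Real.sqrt z)⁻¹ / (lam * L) := by positivity
  refine abs_le_of_sq_le_sq' ?_ h0 |>.2
  rw [div_pow, inv_pow, Real.sq_sqrt hz.le, mul_pow, inv_eq_one_div, div_div, le_div_iff₀ (by positivity)]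
  rw [le_div_iff₀ (by positivity)] at hpot
  have : 0 < lam ^ 2 * L ^ 2 := by positivity
  nlinarith [mul_le_mul_of_nonneg_right h this.le]

/-- The `ℓ / 2`-th power of `Θ`. -/
lemma theta_pos_and_rpow {ℓ β r R L : ℝ} {p : Params} (hd : 1 ≤ d) (hℓ : 1 < ℓ) (hβ : 0 < β)
    (hr : 0 < r) (hR : 0 < R) (hL : 0 < L) (hη : 0 < p.eta) (hlam : 0 < p.lam) :
    0 < Theta d ℓ β r R L p ∧
    p.eta / 2 * (p.lam * (β * (ℓ * (ℓ - 1)))) * (p.lam * L) ^ (2 - ℓ) *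
      (dimConst d * (r / R) ^ (d - 1)) = 15 * ℓ * Theta d ℓ β r R L p ^ (ℓ / 2) := by
  have hd0 : (0 : ℝ) < d := by exact_mod_cast hd
  have hℓ0 : 0 < ℓ := by linarith
  have hℓ1 : 0 < ℓ - 1 := by linarith
  have hq : 0 < r / (Real.sqrt 2 * R) := by positivity
  have hpow : ∀ {x a b : ℝ}, 0 < x → a * (ℓ / 2) = b → (x ^ a) ^ (ℓ / 2) = x ^ b := by
    intro x a b hx hab
    rw [← Real.rpow_mul hx.le, hab]
  refine ⟨by unfold Theta; positivity, ?_⟩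
  have hΘ : Theta d ℓ β r R L p ^ (ℓ / 2) = (ℓ - 1) / 30 * β * (d : ℝ) ^ (-(1 / 2) : ℝ) *
      (r / (Real.sqrt 2 * R)) ^ ((d : ℝ) - 1) * p.eta * p.lam ^ (3 - ℓ) * L ^ (2 - ℓ) := by
    unfold Theta
    rw [Real.mul_rpow (by positivity) (by positivity), Real.mul_rpow (by positivity) (by positivity),
      Real.mul_rpow (by positivity) (by positivity), Real.mul_rpow (by positivity) (by positivity),
      Real.mul_rpow (by positivity) (by positivity), Real.mul_rpow (by positivity) (by positivity),
      hpow (b := 1) (by positivity) (by field_simp), hpow (b := 1) hβ (by field_simp),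
      hpow (b := -(1 / 2)) hd0 (by field_simp), hpow (b := (d : ℝ) - 1) hq (by field_simp),
      hpow (b := 1) hη (by field_simp), hpow (b := 3 - ℓ) hlam (by field_simp; ring),
      hpow (b := 2 - ℓ) hL (by field_simp; ring), Real.rpow_one, Real.rpow_one, Real.rpow_one]
  -- The factors d^(-1/2) and √2^(-(d-1)) of Θ are exactly `dimConst d`.
  have e1 : (d : ℝ) ^ (-(1 / 2) : ℝ) * (r / (Real.sqrt 2 * R)) ^ ((d : ℝ) - 1) =
      dimConst d * (r / R) ^ (d - 1) := by
    have e2 : ((d : ℝ) - 1) = ((d - 1 : ℕ) : ℝ) := by rw [Nat.cast_sub hd, Nat.cast_one]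
    have e3 : Real.sqrt (2 ^ (d - 1)) = Real.sqrt 2 ^ (d - 1) := by
      rw [Real.sqrt_eq_iff_mul_self_eq (by positivity) (by positivity), ← mul_pow,
        Real.mul_self_sqrt (by norm_num)]
    rw [e2, Real.rpow_natCast, dimConst, Real.sqrt_mul hd0.le, Real.rpow_neg hd0.le,
      ← Real.sqrt_eq_rpow, e3, div_pow, div_pow, mul_pow]
    field_simp
  have e4 : p.lam ^ (3 - ℓ) = p.lam * p.lam ^ (2 - ℓ) := by
    rw [show 3 - ℓ = 1 + (2 - ℓ) by ring, Real.rpow_add hlam, Real.rpow_one]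
  rw [hΘ, ← e1, e4, Real.mul_rpow hlam.le hL.le]
  ring

end Scale

namespace Setting

variable {d : ℕ} {K : Set (Vec d)} {r R : ℝ} {f : Vec d → ℝ} {G : ℝ} {xs : Vec d} {β ℓ : ℝ}
  (h : Setting K r R f G xs β ℓ)
include h

/-- The relation between the curvature constant at the radius of precision `z'` and at a smaller
precision `z`. -/
lemma const_mul_rpow_le {eta lam L z z' : ℝ} (hη : 0 < eta) (hlam : 0 < lam) (hL : 0 < L)
    (hz : 0 < z) (hzz : z ≤ z') :
    eta / 2 * (lam * (β * (ℓ * (ℓ - 1)))) * (lam * L) ^ (2 - ℓ) * z ^ (1 - ℓ / 2) ≤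
      eta / 2 * (lam * (β * (ℓ * (ℓ - 1))) * ((Real.sqrt z')⁻¹ / (lam * L)) ^ (ℓ - 2)) := by
  rw [radius_rpow hlam hL (hz.trans_le hzz)]
  have := h.curv_const_pos
  have h2 := h.le_two
  have h3 : z ^ (1 - ℓ / 2) ≤ z' ^ (1 - ℓ / 2) := Real.rpow_le_rpow hz.le hzz (by linarith)
  calc _ ≤ eta / 2 * (lam * (β * (ℓ * (ℓ - 1)))) * (lam * L) ^ (2 - ℓ) * z' ^ (1 - ℓ / 2) := by gcongr
    _ = _ := by ring

/-- The growth conditions hold along a run up to the stopping time. -/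
lemma growthData {Ω : Type*} {A : Run Ω d} {p : Params} {L : ℝ} {t : ℕ} {ω : Ω}
    (hη : 0 < p.eta) (hlam : 0 < p.lam) (hlam1 : p.lam < 1) (hσ : 0 < p.sig) (hγ : 0 < p.gam)
    (hL : 0 < L) (hσr : 5 * (d : ℝ) ≤ r / (Real.sqrt 2 * p.sig))
    (hlamL : p.lam ≤ 1 / (10 * d * L)) (hΘ : Theta d ℓ β r R L p ≤ (p.sig ^ 2)⁻¹)
    (hF1 : ‖xs‖ ^ 2 / (2 * p.sig ^ 2) ≤ 1 / (2 * p.lam ^ 2 * L ^ 2))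
    (hmean : A.mean 1 ω = 0) (hprec : A.prec 1 ω = (p.sig ^ 2)⁻¹ • (1 : Mat d))
    (hgood : ∀ u, 2 ≤ u → u ≤ t → A.Good (extension K f G R) xs p L u ω ∧ A.mean u ω ∈ K) :
    GrowthData d (r / R) ℓ (Theta d ℓ β r R L p)
      (p.eta / 2 * (p.lam * (β * (ℓ * (ℓ - 1)))) * (p.lam * L) ^ (2 - ℓ)) t
      (fun u => sqNorm (A.precBar (extension K f G R) p u ω))
      (fun u v => p.eta / 2 * sqNorm (A.surrogateHess (extension K f G R) p u ω) v) := by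
  set e := extension K f G R with he
  have hd := h.one_le
  have hd0 : (0 : ℝ) < d := by exact_mod_cast hd
  have hr0 := h.r_pos
  have hR0 := h.R_pos
  obtain ⟨hΘ0, hΘC⟩ := theta_pos_and_rpow (d := d) (ℓ := ℓ) (L := L) (p := p) hd h.one_lt
    h.beta_pos hr0 hR0 hL hη hlam
  have hσ2 : 0 < (p.sig ^ 2)⁻¹ := by positivity
  have hrσ : 5 * d * (Real.sqrt 2 * p.sig) ≤ r := by
    rwa [le_div_iff₀ (by positivity)] at hσr
  have hcov1 : (A.cov 1 ω).PosDef := by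
    rw [Run.cov, hprec]; exact (posDef_smul_one hσ2).inv
  have hq : ∀ u v, sqNorm (A.precBar e p u ω) v = (p.sig ^ 2)⁻¹ * ‖v‖ ^ 2 +
      ∑ k ∈ Finset.Ico 1 u, p.eta / 2 * sqNorm (A.surrogateHess e p k ω) v +
      ((u : ℝ) - 1) * p.eta * p.gam * ‖v‖ ^ 2 := by
    intro u v
    rw [Run.precBar, sqNorm_add, sqNorm_add, hprec, sqNorm_smul_one, sqNorm_smul_one, sqNorm_smul,
      sqNorm_sum, Finset.mul_sum]
  have hnn : ∀ u, 1 ≤ u → u ≤ t → ∀ v, 0 ≤ sqNorm (A.surrogateHess e p u ω) v := by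
    intro u hu hut v
    refine (h.hessian_nonneg_and_lintegral_le hlam hlam1 _ ?_ v).1
    rcases (by omega : u = 1 ∨ 2 ≤ u) with rfl | hu2
    · exact hcov1
    · exact (hgood u hu2 hut).1.2.1
  -- the data of a later round
  have hround : ∀ u, 2 ≤ u → u ≤ t → ∀ z, 0 < z →
      (∀ x, z * ‖x‖ ^ 2 ≤ 1 / 2 * sqNorm (A.precBar e p u ω) x) →
      ∃ z', z ≤ z' ∧ 0 < (Real.sqrt z')⁻¹ ∧
        (∀ x, sqNorm (A.cov u ω) x ≤ (Real.sqrt z')⁻¹ ^ 2 * ‖x‖ ^ 2) ∧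
        5 * d * (Real.sqrt z')⁻¹ ≤ r ∧
        10 * d * (Real.sqrt z')⁻¹ ≤ (Real.sqrt z')⁻¹ / (p.lam * L) ∧
        ‖A.mean u ω - xs‖ ≤ (Real.sqrt z')⁻¹ / (p.lam * L) := by
    intro u hu hut z hz hzq
    obtain ⟨⟨hpot, hcov, hlow, -⟩, -⟩ := hgood u hu hut
    obtain ⟨hP, -⟩ := posDef_of_inv hcov
    have hlow' := (loewner_iff hlow.1).1 hlow
    -- The first argument gives the rate in z; the second, coming from the initial precision, keeps
    -- the Gaussian scale below √2 σ, so that 5ds ≤ r.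
    have hz' : 0 < max z ((p.sig ^ 2)⁻¹ / 2) := lt_max_of_lt_left hz
    have hsc : ∀ x, max z ((p.sig ^ 2)⁻¹ / 2) * ‖x‖ ^ 2 ≤ sqNorm (A.prec u ω) x := by
      intro x
      have h1 := hlow' x
      rw [sqNorm_smul] at h1
      refine le_trans ?_ h1
      rcases max_choice z ((p.sig ^ 2)⁻¹ / 2) with hc | hc
      · rw [hc]; exact hzq x
      · rw [hc, hq]
        have h2 : 0 ≤ ∑ k ∈ Finset.Ico 1 u, p.eta / 2 * sqNorm (A.surrogateHess e p k ω) x :=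
          Finset.sum_nonneg fun k hk => mul_nonneg (by positivity) (hnn k (Finset.mem_Ico.1 hk).1
            (by have := (Finset.mem_Ico.1 hk).2; omega) x)
        have h3 : 0 ≤ ((u : ℝ) - 1) * p.eta * p.gam * ‖x‖ ^ 2 := by
          have : (1 : ℝ) ≤ u := by exact_mod_cast (by omega : 1 ≤ u)
          have : 0 ≤ (u : ℝ) - 1 := by linarith
          positivity
        linarith
    have hs0 : 0 < (Real.sqrt (max z ((p.sig ^ 2)⁻¹ / 2)))⁻¹ := by positivity
    refine ⟨_, le_max_left z ((p.sig ^ 2)⁻¹ / 2), hs0, sqNorm_inv_le_of_le hP hz' hsc, ?_,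
      radius_ge hd hlam hL hlamL hs0, norm_sub_le_radius hlam hL hz' (hsc _) hpot⟩
    refine le_trans ?_ hrσ
    gcongr
    exact inv_sqrt_le hσ (le_max_right _ _)
  refine
    { one_le := hd
      rho_pos := by positivity
      rho_le := (div_le_one hR0).2 h.r_le_R
      one_lt := h.one_lt
      le_two := h.le_two
      theta_pos := hΘ0
      const_eq := hΘC
      homogeneous := fun u c x => sqNorm_smul_vec _ c x
      nonneg := fun u hu hut v => mul_nonneg (by positivity) (hnn u hu hut v)
      init := ?_
      succ := ?_
      first := ?_
      pair := ?_
      line := ?_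
      single := ?_ }
  · intro v hv
    rw [hq, hv]
    simpa using hΘ
  · intro u hu v hv
    rw [hq, hq, Finset.sum_Ico_succ_top hu, hv]
    push_cast
    have := mul_pos hη hγ
    linarith
  · intro _ v hv
    have hs : (Real.sqrt (p.sig ^ 2)⁻¹)⁻¹ = p.sig := by
      rw [Real.sqrt_inv, Real.sqrt_sq hσ.le, inv_inv]
    have hs0 : 0 < (Real.sqrt (p.sig ^ 2)⁻¹)⁻¹ := by rwa [hs]
    have hsq : ∀ x : Vec d, sqNorm ((p.sig ^ 2)⁻¹ • (1 : Mat d)) x = (p.sig ^ 2)⁻¹ * ‖x‖ ^ 2 :=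
      fun x => sqNorm_smul_one _ x
    have h1 := h.hessian_ge_of_mean_zero hlam hlam1 hcov1 hv hs0
      (D₀ := (Real.sqrt (p.sig ^ 2)⁻¹)⁻¹ / (p.lam * L)) (by
        rw [Run.cov, hprec]
        exact sqNorm_inv_le_of_le (posDef_smul_one hσ2) hσ2 fun x => (hsq x).ge)
      (by rwa [hs]) (radius_ge hd hlam hL hlamL hs0) (by
        refine norm_sub_le_radius (P := (p.sig ^ 2)⁻¹ • (1 : Mat d)) hlam hL hσ2 (hsq xs).ge ?_
        rw [hsq]
        refine le_of_eq_of_le ?_ hF1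
        field_simp)
    have h2 := h.const_mul_rpow_le hη hlam hL hΘ0 hΘ
    rw [Run.surrogateHess, hmean]
    have h3 := mul_le_mul_of_nonneg_left h1 (by positivity : 0 ≤ p.eta / 2)
    linarith
  · intro hd2 u hu hut z hz hzq v w hv hw hvw
    obtain ⟨z', hzz, hs0, hS, h5, h10, hm⟩ := hround u hu hut z hz hzq
    obtain ⟨hg, hmK⟩ := hgood u hu hut
    have h1 := h.hessian_add_ge hlam hlam1 hd2 hmK hg.2.1 hv hw hvw hs0 hS h5 h10 hm
    have h2 := h.const_mul_rpow_le hη hlam hL hz hzz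
    have h3 := mul_le_mul_of_nonneg_left h1 (by positivity : 0 ≤ p.eta / 2)
    have h4 : 0 ≤ (r / R) ^ (2 - ℓ) := by positivity
    have h5 := mul_le_mul_of_nonneg_right h2 h4
    rw [Run.surrogateHess]
    linarith
  · intro hd1 u hu hut z hz hzq v hv
    obtain ⟨z', hzz, hs0, hS, h5, h10, hm⟩ := hround u hu hut z hz hzq
    obtain ⟨hg, hmK⟩ := hgood u hu hut
    have h1 := h.hessian_ge hlam hlam1 hmK hg.2.1 hv hs0 hS h5 h10 hm le_rfl
      (by rw [trace_sub_eq_zero_of_dim_one hd1 _ hv, mul_zero])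
    have h2 := h.const_mul_rpow_le hη hlam hL hz hzz
    have h3 := mul_le_mul_of_nonneg_left h1 (by positivity : 0 ≤ p.eta / 2)
    have h4 : 0 ≤ (r / R) ^ (d - 1) := by positivity
    have h5 := mul_le_mul_of_nonneg_right h2 h4
    rw [Run.surrogateHess]
    linarith
  · intro hd2 u hu hut z hz hzq v hv Y B hY hB hBw
    obtain ⟨z', hzz, hs0, hS, h5, h10, hm⟩ := hround u hu hut z hz hzq
    obtain ⟨⟨-, hcov, hlow, hup⟩, hmK⟩ := hgood u hu hut
    obtain ⟨hP, hPinv⟩ := posDef_of_inv hcov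
    have hlow' := (loewner_iff hlow.1).1 hlow
    have hup' := (loewner_iff hup.1).1 hup
    have hdR : (2 : ℝ) ≤ d := by exact_mod_cast hd2
    -- Condition (c) reads M ⪯ Σ_u⁻¹ ⪯ 3M: the left side bounds the lateral trace of Σ_u, the right
    -- side bounds vᵀΣ_u⁻¹v.
    set M := (1 / 2 : ℝ) • A.precBar e p u ω with hM
    have hMs : ∀ x, sqNorm M x = 1 / 2 * sqNorm (A.precBar e p u ω) x := fun x => sqNorm_smul _ _ _
    have hMz : ∀ x, z * ‖x‖ ^ 2 ≤ sqNorm M x := fun x => by rw [hMs]; exact hzq x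
    have hMP : M.PosDef := by
      rw [Matrix.posDef_iff_dotProduct_mulVec]
      refine ⟨?_, fun x hx => ?_⟩
      · have h1 := hP.1.sub hlow.1
        rwa [sub_sub_cancel] at h1
      · have h1 := hMz (WithLp.toLp 2 x)
        rw [star_trivial]
        refine lt_of_lt_of_le ?_ h1
        have : 0 < ‖WithLp.toLp 2 x‖ := norm_pos_iff.2 (by simpa using hx)
        positivity
    have hY0 : 0 < Y := by
      have h1 := hzq v
      rw [hv] at h1
      linarith
    have htr : (A.cov u ω).trace - sqNorm (A.cov u ω) v ≤
        ((d : ℝ) - 2) / (B / 2) + (Y / 2) / (z * (B / 2)) := by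
      refine (trace_sub_le (sqNorm_inv_le hMP hP hlow') hv).trans ?_
      refine trace_inv_sub_le hMP hz (by positivity) hMz hv ?_ fun w hw => ?_
      · rw [hMs]; linarith
      · rw [hMs]; linarith [hBw w hw]
    have hT : sqNorm (A.cov u ω)⁻¹ v * ((A.cov u ω).trace - sqNorm (A.cov u ω) v) ≤
        3 * Y / B * ((d : ℝ) - 2 + Y / (2 * z)) := by
      have h1 : sqNorm (A.cov u ω)⁻¹ v ≤ 3 / 2 * Y := by
        rw [Run.cov, hPinv]
        refine (hup' v).trans ?_
        rw [sqNorm_smul]; linarith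
      calc _ ≤ 3 / 2 * Y * (((d : ℝ) - 2) / (B / 2) + (Y / 2) / (z * (B / 2))) :=
            mul_le_mul h1 htr (trace_sub_nonneg hcov hv) (by positivity)
        _ = _ := by field_simp
    have hT0 : 0 ≤ 3 * Y / B * ((d : ℝ) - 2 + Y / (2 * z)) := by
      have : 0 ≤ (d : ℝ) - 2 := by linarith
      positivity
    have h1 := h.hessian_ge hlam hlam1 hmK hcov hv hs0 hS h5 h10 hm hT0 hT
    have hHn := hnn u (by omega) hut v
    set X := 0.0827 - 0.2 * (3 * Y / B * ((d : ℝ) - 2 + Y / (2 * z))) with hX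
    have h4 : 0 ≤ (r / R) ^ (d - 1) := by positivity
    -- If X is negative, enlarging its coefficient would go the wrong way, but then nonnegativity of
    -- the Hessian suffices.
    rcases le_total 0 X with hX0 | hX0
    · have h2 := h.const_mul_rpow_le hη hlam hL hz hzz
      have h3 := mul_le_mul_of_nonneg_left h1 (by positivity : 0 ≤ p.eta / 2)
      have h6 := mul_le_mul_of_nonneg_right (mul_le_mul_of_nonneg_right h2 h4) hX0
      rw [Run.surrogateHess]
      linarith
    · refine le_trans (mul_nonpos_of_nonneg_of_nonpos ?_ hX0) (mul_nonneg (by positivity) hHn)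
      have := h.curv_const_pos
      positivity

end Setting

end RONM
theorem mainTheorem3 {Ω : Type*} [MeasurableSpace Ω] (Pr : Measure Ω) [IsProbabilityMeasure Pr]
    {d : ℕ} (hd : 1 ≤ d) (n : ℕ)
    (K : Set (RONM.Vec d)) (hKconv : Convex ℝ K) (hKcomp : IsCompact K)
    (r R : ℝ) (hr : 0 < r) (hrK : Metric.closedBall 0 r ⊆ K) (hKR : K ⊆ Metric.closedBall 0 R)
    (f : RONM.Vec d → ℝ) (hf01 : ∀ x ∈ K, f x ∈ Set.Icc (0 : ℝ) 1) (hfconv : ConvexOn ℝ K f)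
    (G : ℝ) (hG : ∀ x ∈ K, ∀ y ∈ K, |f x - f y| ≤ G * ‖x - y‖)
    (xs : RONM.Vec d) (hxsK : xs ∈ K) (hxs : IsMinOn f K xs)
    (β ℓ : ℝ) (hℓ : 1 < ℓ) (hℓ2 : ℓ ≤ 2) (hβℓ : RONM.IsBetaEllConvex K f xs β ℓ)
    (p : RONM.Params) (hη : 0 < p.eta) (hlam : 0 < p.lam) (hlam1 : p.lam < 1)
    (hσ : 0 < p.sig) (hγ : 0 < p.gam) (L : ℝ) (hL : 0 < L)
    (hσr : 5 * (d : ℝ) ≤ r / (Real.sqrt 2 * p.sig))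
    (hlamL : p.lam ≤ 1 / (10 * d * L))
    (hΘ : RONM.Theta d ℓ β r R L p ≤ (p.sig ^ 2)⁻¹)
    (hF1 : ‖xs‖ ^ 2 / (2 * p.sig ^ 2) ≤ 1 / (2 * p.lam ^ 2 * L ^ 2))
    (A : RONM.Run Ω d) (hA : A.IsRONM Pr n K f G R xs p) :
    ∀ᵐ ω ∂Pr, ∀ t : ℕ, 1 ≤ t →
      t ≤ A.tau (RONM.extension K f G R) xs p L n ω →
      RONM.Loewner
        ((RONM.Theta d ℓ β r R L p / 16 * (t : ℝ) ^ (2 / ℓ)) • (1 : RONM.Mat d))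
        (A.prec t ω) := by

  have h : RONM.Setting K r R f G xs β ℓ :=
    ⟨hd, hKconv, hKcomp, hr, hrK, hKR, hf01, hG, hxsK, hℓ, hℓ2, hβℓ⟩
  -- No exceptional set is needed: the argument uses only the initial state, the monitored
  -- conditions and membership of the means in K.
  refine Filter.Eventually.of_forall fun ω t ht1 htτ => ?_
  set e := RONM.extension K f G R
  obtain ⟨hΘ0, -⟩ := RONM.theta_pos_and_rpow (d := d) (ℓ := ℓ) (L := L) (p := p) hd hℓ h.beta_pos hr
    h.R_pos hL hη hlam
  have hτn : A.tau e xs p L n ω ≤ n := Nat.sInf_le (Or.inr rfl)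
  -- A failure at index u stops the run at round u - 1, so t ≤ τ gives the conditions at indices 2
  -- to t, but not at index 1.
  have hgood : ∀ u, 2 ≤ u → u ≤ t → A.Good e xs p L u ω := by
    intro u hu hut
    by_contra hbad
    have hmem : u - 1 ∈ {t | 1 ≤ t ∧ t ≤ n ∧ ¬ A.Good e xs p L (t + 1) ω} ∪ {n} := by
      refine Or.inl ⟨by omega, by omega, ?_⟩
      rwa [Nat.sub_add_cancel (by omega)]
    have : A.tau e xs p L n ω ≤ u - 1 := Nat.sInf_le hmem
    omega
  have hprec := hA.prec_one ω
  have hcov1 : (A.cov 1 ω).PosDef := by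
    rw [RONM.Run.cov, hprec]
    exact (RONM.posDef_smul_one (by positivity)).inv
  have hmeanK : ∀ u, 2 ≤ u → u ≤ t → A.mean u ω ∈ K := by
    intro u hu hut
    have halive : A.Alive (u - 1 + 1) ω := by
      intro s hs
      rcases (by have := hs.1; omega : s = 1 ∨ 2 ≤ s) with rfl | hs2
      · exact hcov1
      · exact (hgood s hs2 (by have := hs.2; omega)).2.1
    have := (hA.mean_succ (u - 1) ⟨by omega, by omega⟩ ω halive).1
    rwa [Nat.sub_add_cancel (by omega)] at this
  have hgrow := h.growthData (t := t) hη hlam hlam1 hσ hγ hL hσr hlamL hΘ hF1 (hA.mean_one ω) hprec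
    fun u hu hut => ⟨hgood u hu hut, hmeanK u hu hut⟩
  -- At t = 1 nothing is monitored; the bound is Θ/16 ≤ σ⁻².
  rcases (by omega : t = 1 ∨ 2 ≤ t) with rfl | ht2
  · rw [hprec, RONM.loewner_iff]
    · intro x
      rw [RONM.sqNorm_smul_one, RONM.sqNorm_smul_one, Nat.cast_one, Real.one_rpow, mul_one]
      gcongr
      linarith
    · exact (RONM.posDef_smul_one (by positivity)).1.sub (RONM.posDef_smul_one (by positivity)).1
  · obtain ⟨-, hcov, hlow, -⟩ := hgood t ht2 le_rfl
    have hlow' := (RONM.loewner_iff hlow.1).1 hlow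
    have ht0 : (0 : ℝ) < t := by exact_mod_cast ht1
    rw [RONM.loewner_iff]
    · intro x
      have h1 := hgrow.scale_bound (hgrow.growth ht2 (Nat.le_succ t)) x
      have h2 := hlow' x
      rw [RONM.sqNorm_smul] at h2
      rw [RONM.sqNorm_smul_one]
      calc _ = RONM.Theta d ℓ β r R L p * (t : ℝ) ^ (2 / ℓ) / 16 * ‖x‖ ^ 2 := by ring
        _ ≤ _ := h1.trans h2
    · exact (RONM.posDef_of_inv hcov).1.1.sub (RONM.posDef_smul_one (by positivity)).1
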